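/- Identify the Heisenberg group $\mathbb{H}^1$ with $\mathbb{R}^3$, with Lebesgue measure, product $x\cdot y=(x_1+y_1,\,x_2+y_2,\,x_3+y_3+\tfrac12(x_1y_2-x_2y_1))$ and inverse $x^{-1}=-x$. Let $\alpha,\beta:\mathbb{R}\to\mathbb{R}$ be continuous odd functions that are $C^3$ on $(0,\infty)$, with $\alpha$ differentiable at $0$ and $\alpha'(0)=0$ (so that $\Gamma(t)=(t,\alpha(t),\beta(t))$ is a continuous odd curve in $\mathbb{H}^1$). Put $$h_2(t)=t\alpha'(t)-\alpha(t),\qquad D_2(t)=\alpha''(t),\qquad \bar\beta(t)=\beta(t)-\tfrac12\int_0^t h_2,\qquad \bar h_\beta(t)=t\bar\beta'(t)-\bar\beta(t),$$ $$\bar N_3(t)=\det\begin{pmatrix} t&\alpha(t)&\bar\beta(t)\\ 1&\alpha'(t)&\bar\beta'(t)\\ 0&\alpha''(t)&\bar\beta''(t)\end{pmatrix},\qquad \bar h_3(t)=\frac{\bar N_3(t)}{D_2(t)}.$$ Assume that for all $t>0$ the following five quantities are positive: $D_2$; $\ \bar D_3=\alpha''\bar\beta'''-\alpha'''\bar\beta''$;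 $\ \alpha''(\bar\beta'''+2\alpha'')-\alpha'''(\bar\beta''+\alpha')$; $\ \alpha''(\bar\beta'''-\alpha'')-\alpha'''(\bar\beta''-\alpha')$; $\ \alpha''(\bar\beta'''-\alpha'')-\alpha'''\big(\bar\beta''-\alpha'+\tfrac{\alpha(t)}{t}\big)$. Assume also that there is a constant $c>0$ such that for all $t>0$ $$h_2'(t)\ge c\,\frac{h_2(t)}{t},\qquad \bar h_3'(t)\ge c\,\frac{\bar h_3(t)}{t},\qquad \bar h_3(t)\ge c\int_0^t h_2 .$$ For $j\in\mathbb{N}=\{0,1,2,\dots\}$ let, with all functions evaluated at $2^{-j}$, $$\widetilde A_j=\begin{pmatrix}2^{-j}&0&0\\ \alpha&h_2&0\\ \bar\beta&\bar h_\beta&2^{-j}h_2+\bar h_3\end{pmatrix},\qquad S_j=\det\widetilde A_j=2^{-j}h_2\,(2^{-j}h_2+\bar h_3).$$ Fix a complex-valued $\varsigma_0\in C_c^\infty(\mathbb{R}^3)$ supported in $[-1,1]^3$ with $\int\varsigma_0=1$; for $j\ge1$ put $\varsigma_j(y)=\varsigma_0(y)-\frac{S_j}{S_{j-1}}\varsigma_0(\widetilde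 A_{j-1}^{-1}\widetilde A_j y)$, and for $j\ge 0$ $$\mathcal{D}_jf(x)=\frac1{S_j}\int_{\mathbb{R}^3} f(x\cdot y^{-1})\,\varsigma_j(\widetilde A_j^{-1}y)\,dy .$$ Then for every $1<p<\infty$ there is a finite constant $C$, depending only on $p$, $\alpha$, $\beta$ and $\varsigma_0$, such that for every complex-valued $f\in L^p(\mathbb{H}^1)$ $$C^{-1}\|f\|_p\le\Big\|\Big(\sum_{j=0}^\infty|\mathcal{D}_jf|^2\Big)^{1/2}\Big\|_p\le C\|f\|_p,$$ and for every sequence $\{g_j\}\in L^p(\mathbb{H}^1,\ell^2(\mathbb{N}))$ $$\Big\|\Big(\sum_{j=0}^\infty|\mathcal{D}_jg_j|^2\Big)^{1/2}\Big\|_p\le C\,\Big\|\Big(\sum_{j=0}^\infty|g_j|^2\Big)^{1/2}\Big\|_p .$$ -/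

import Mathlib

open MeasureTheory
open scoped ENNReal NNReal

namespace HeisenbergLP

noncomputable section

/-- The underlying space of the Heisenberg group: `ℝ³`, with Lebesgue measure `volume`. -/
abbrev H1 : Type := Fin 3 → ℝ

/-- The Heisenberg group law. -/
def mul (x y : H1) : H1 :=
  ![x 0 + y 0, x 1 + y 1, x 2 + y 2 + (1 / 2) * (x 0 * y 1 - x 1 * y 0)]

/-- The Heisenberg group inverse. -/
def inv (x : H1) : H1 := ![-x 0, -x 1, -x 2]

/-! ### Functions attached to the curve `Γ(t) = (t, α(t), β(t))` -/

/-- `h₂(t) = t α'(t) - α(t)`. -/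
def h2 (α : ℝ → ℝ) (t : ℝ) : ℝ := t * deriv α t - α t

/-- `D₂(t) = α''(t)`. -/
def D2 (α : ℝ → ℝ) (t : ℝ) : ℝ := iteratedDeriv 2 α t

/-- `β̄(t) = β(t) - ½ ∫₀ᵗ h₂`. -/
def betaBar (α β : ℝ → ℝ) (t : ℝ) : ℝ := β t - (1 / 2) * ∫ s in (0 : ℝ)..t, h2 α s

/-- `N̄₃(t)`, a Wronskian-type determinant. -/
def N3Bar (α β : ℝ → ℝ) (t : ℝ) : ℝ :=
  Matrix.det !![t, α t, betaBar α β t;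
                1, deriv α t, deriv (betaBar α β) t;
                0, iteratedDeriv 2 α t, iteratedDeriv 2 (betaBar α β) t]

/-- `h̄₃ = N̄₃ / D₂`. -/
def h3Bar (α β : ℝ → ℝ) (t : ℝ) : ℝ := N3Bar α β t / D2 α t

/-- `h̄_β(t) = t β̄'(t) - β̄(t)`. -/
def hBetaBar (α β : ℝ → ℝ) (t : ℝ) : ℝ := t * deriv (betaBar α β) t - betaBar α β t

/-- `D̄₃ = α'' β̄''' - α''' β̄''`. -/
def D3Bar (α β : ℝ → ℝ) (t : ℝ) : ℝ :=
  iteratedDeriv 2 α t * iteratedDeriv 3 (betaBar α β) t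
    - iteratedDeriv 3 α t * iteratedDeriv 2 (betaBar α β) t

/-- `D̂₃ = α'' (β̄''' + 2α'') - α''' (β̄'' + α')`. -/
def D3Hat (α β : ℝ → ℝ) (t : ℝ) : ℝ :=
  iteratedDeriv 2 α t * (iteratedDeriv 3 (betaBar α β) t + 2 * iteratedDeriv 2 α t)
    - iteratedDeriv 3 α t * (iteratedDeriv 2 (betaBar α β) t + deriv α t)

/-- `α'' (β̄''' - α'') - α''' (β̄'' - α')`. -/
def D3DoubleHat (α β : ℝ → ℝ) (t : ℝ) : ℝ :=
  iteratedDeriv 2 α t * (iteratedDeriv 3 (betaBar α β) t - iteratedDeriv 2 α t)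
    - iteratedDeriv 3 α t * (iteratedDeriv 2 (betaBar α β) t - deriv α t)

/-- `α'' (β̄''' - α'') - α''' (β̄'' - α' + α / t)`. -/
def D3TripleHat (α β : ℝ → ℝ) (t : ℝ) : ℝ :=
  iteratedDeriv 2 α t * (iteratedDeriv 3 (betaBar α β) t - iteratedDeriv 2 α t)
    - iteratedDeriv 3 α t * (iteratedDeriv 2 (betaBar α β) t - deriv α t + α t / t)

/-- The standing assumptions on the curve `Γ(t) = (t, α(t), β(t))`. -/
structure AdmissibleCurve (α β : ℝ → ℝ) : Prop where
  continuous_alpha : Continuous α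
  continuous_beta : Continuous β
  odd_alpha : ∀ t, α (-t) = -α t
  odd_beta : ∀ t, β (-t) = -β t
  /-- `α'(0) = 0`. -/
  deriv_alpha_zero : HasDerivAt α 0 0
  contDiffOn_alpha : ContDiffOn ℝ 3 α (Set.Ioi 0)
  contDiffOn_beta : ContDiffOn ℝ 3 β (Set.Ioi 0)
  D2_pos : ∀ t, 0 < t → 0 < D2 α t
  D3Bar_pos : ∀ t, 0 < t → 0 < D3Bar α β t
  D3Hat_pos : ∀ t, 0 < t → 0 < D3Hat α β t
  D3DoubleHat_pos : ∀ t, 0 < t → 0 < D3DoubleHat α β t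
  D3TripleHat_pos : ∀ t, 0 < t → 0 < D3TripleHat α β t
  /-- `h₂' ≳ h₂ / t`. -/
  h2_growth : ∃ c : ℝ, 0 < c ∧ ∀ t, 0 < t → c * (h2 α t / t) ≤ deriv (h2 α) t
  /-- `h̄₃' ≳ h̄₃ / t`. -/
  h3Bar_growth : ∃ c : ℝ, 0 < c ∧ ∀ t, 0 < t →
    c * (h3Bar α β t / t) ≤ deriv (h3Bar α β) t
  /-- `h̄₃ ≳ ∫₀ᵗ h₂`. -/
  h3Bar_dominates : ∃ c : ℝ, 0 < c ∧ ∀ t, 0 < t →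
    c * (∫ s in (0 : ℝ)..t, h2 α s) ≤ h3Bar α β t

/-! ### The operators `𝒟_j` -/

/-- The dyadic point `2^{-j}`. -/
def dy (j : ℕ) : ℝ := (2⁻¹ : ℝ) ^ j

/-- The matrix `Ã_j`. -/
def ATilde (α β : ℝ → ℝ) (j : ℕ) : Matrix (Fin 3) (Fin 3) ℝ :=
  !![dy j, 0, 0;
     α (dy j), h2 α (dy j), 0;
     betaBar α β (dy j), hBetaBar α β (dy j), dy j * h2 α (dy j) + h3Bar α β (dy j)]

/-- `S_j = 2^{-j} h₂(2^{-j}) (2^{-j} h₂(2^{-j}) + h̄₃(2^{-j}))`, which is `det Ã_j`. -/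
def S (α β : ℝ → ℝ) (j : ℕ) : ℝ :=
  dy j * h2 α (dy j) * (dy j * h2 α (dy j) + h3Bar α β (dy j))

/-- The functions `ς_j`, built from `ς₀`. -/
def sig (α β : ℝ → ℝ) (sig0 : H1 → ℂ) : ℕ → H1 → ℂ
  | 0, y => sig0 y
  | j + 1, y => sig0 y - ((S α β (j + 1) / S α β j : ℝ) : ℂ) *
      sig0 (((ATilde α β j)⁻¹ * ATilde α β (j + 1)).mulVec y)

/-- `𝒟_j f(x) = S_j⁻¹ ∫ f(x · y⁻¹) ς_j(Ã_j⁻¹ y) dy`. -/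
def DOp (α β : ℝ → ℝ) (sig0 : H1 → ℂ) (j : ℕ) (f : H1 → ℂ) (x : H1) : ℂ :=
  ((S α β j : ℝ) : ℂ)⁻¹ *
    ∫ y : H1, f (mul x (inv y)) * sig α β sig0 j ((ATilde α β j)⁻¹.mulVec y)

/-- The pointwise `ℓ²` norm `(∑_j |g_j(x)|²)^{1/2}`, with value `∞` where the sum diverges. -/
def sqFun (g : ℕ → H1 → ℂ) (x : H1) : ℝ≥0∞ := (∑' j, ‖g j x‖ₑ ^ 2) ^ (1 / 2 : ℝ)

end

end HeisenbergLP

/-!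
The operators `𝒟_j` are convolutions on the Heisenberg group with the differences `k_j - k_{j-1}`
(and `k_0` for `j = 0`) of the approximate identity `k_j = S_j⁻¹ ς₀(Ã_j⁻¹ ·)`: see `DOp_eq_conv`.
The claim is therefore the Littlewood–Paley theorem for this approximate identity, and the proof
has two independent halves.

*Geometry.* In the coordinates `u = Ã_j⁻¹ x` the group law becomes `law c` with `0 ≤ c ≤ 1`
(`AdmissibleCurve.coord_mul`), although `Ã_j` is not an automorphism. The transition matrix from one
scale to the next coarser one is lower triangular. Its diagonal is bounded by some `σ < 1`, by the
growth of `h₂` and `h̄₃` (`AdmissibleCurve.exists_contraction`), and its other entries are bounded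
by one, by the monotonicity of `α / t` and of the slope `h̄_β / h₂` together with the positivity of
`h₂` and `h̄₃`. It is thus a contraction for a maximum norm weighted heavily against the
off-diagonal entries. The balls of this norm, transported to the group, are nested, shrink to the
identity, and have `B · B` contained in an enlargement of comparable measure
(`AdmissibleCurve.ballSystem`). The bumps `k_j` are Lipschitz at scale `j`, with a gain `ρ ^ n` for
translations by elements of the ball at scale `j + n` (`AdmissibleCurve.exists_approxId`). The
measures of balls at consecutive scales need not be comparable, because `h₂(2t) / h₂(t)` may be
unbounded.

*Littlewood–Paley theory.* It is carried out for a unimodular group with a `BallSystem` and an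
`ApproxId`, in a way that does not compare measures at different scales.

* Compositions of difference kernels decay geometrically in the distance of the scales
  (`ApproxId.conv_diff_diff`), so the Cotlar–Stein lemma gives uniform `L²` bounds for sums of them
  with bounded coefficients.
* A Calderón–Zygmund decomposition stops a point at the coarsest scale `j` at which the average of
  `|f|` is large, and subtracts from the stopped piece its average at scale `j - 1`, instead of
  its average over the stopping ball. The cancellation is then that of `K - k_{j-1} * K`, and the
  good part is controlled in `L²` by correlating the pieces in pairs
  (`BallSystem.lintegral_sq_sum_le`). With interpolation and duality this gives `L^p` bounds for
  `1 < p < ∞` (`exists_eLpNorm_conv_sum_le`).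
* Khintchine's inequality turns the uniform bounds for sums with arbitrary signs into the upper
  square function estimate (`exists_eLpNorm_finSq_conv_diff_le`).
* For the lower estimate, `f * k_J * k_J` is expanded into the products of two difference kernels.
  The diagonals at distance `ℓ` from the main one have norm `O(θ ^ ℓ)`, so those far away amount
  to at most half of `‖f‖`; the remaining finitely many are controlled by the square function
  through duality (`exists_eLpNorm_le_finSq`).
* The vector valued inequality follows for `p > 2` from the maximal theorem, and for `p < 2` by
  duality (`exists_eLpNorm_finSq_conv_le`).
-/

namespace GroupLP

open Filter Topology
open scoped Pointwise

set_option linter.unusedSectionVars false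

/-! ### Convolution with bounded kernels of compact support -/

/-- The convolution `f * K` on a group, `(f * K)(x) = ∫ f (x y⁻¹) K(y) dy`. -/
noncomputable def conv {G : Type*} [Group G] [MeasurableSpace G] (μ : Measure G) (f K : G → ℂ)
    (x : G) : ℂ := ∫ y, f (x * y⁻¹) * K y ∂μ

/-- The class of convolution kernels used throughout: bounded measurable functions that vanish
off a compact set. It is closed under sums, convolution and reflection, and a convolution with
such a kernel is defined at every point for every locally integrable function. -/
structure IsKernel {G : Type*} [TopologicalSpace G] [MeasurableSpace G] (K : G → ℂ) : Prop where
  measurable : Measurable K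
  bounded : ∃ C : ℝ, ∀ x, ‖K x‖ ≤ C
  support : ∃ s : Set G, IsCompact s ∧ ∀ x ∉ s, K x = 0

section Kernel

variable {G : Type*} [TopologicalSpace G] [MeasurableSpace G] {K L : G → ℂ}

lemma IsKernel.zero : IsKernel (0 : G → ℂ) :=
  ⟨measurable_const, ⟨0, by simp⟩, ⟨∅, isCompact_empty, by simp⟩⟩

lemma IsKernel.add (hK : IsKernel K) (hL : IsKernel L) : IsKernel (K + L) := by
  obtain ⟨hKm, ⟨C, hC⟩, s, hs, hs'⟩ := hK
  obtain ⟨hLm, ⟨D, hD⟩, t, ht, ht'⟩ := hL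
  refine ⟨hKm.add hLm, ⟨C + D, fun x => (norm_add_le _ _).trans (add_le_add (hC x) (hD x))⟩,
    s ∪ t, hs.union ht, fun x hx => ?_⟩
  simp only [Set.mem_union, not_or] at hx
  simp [hs' x hx.1, ht' x hx.2]

lemma IsKernel.const_mul (hK : IsKernel K) (c : ℂ) : IsKernel (fun x => c * K x) := by
  obtain ⟨hKm, ⟨C, hC⟩, s, hs, hs'⟩ := hK
  refine ⟨hKm.const_mul c, ⟨‖c‖ * C, fun x => ?_⟩, s, hs, fun x hx => by simp [hs' x hx]⟩
  rw [norm_mul]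
  exact mul_le_mul_of_nonneg_left (hC x) (norm_nonneg _)

lemma IsKernel.sub (hK : IsKernel K) (hL : IsKernel L) : IsKernel (K - L) := by
  have := hK.add (hL.const_mul (-1))
  convert this using 1
  ext x; simp [sub_eq_add_neg]

lemma IsKernel.sum {ι : Type*} (s : Finset ι) {K : ι → G → ℂ} (hK : ∀ i ∈ s, IsKernel (K i)) :
    IsKernel (∑ i ∈ s, K i) := by
  classical
  induction s using Finset.induction_on with
  | empty => simpa using IsKernel.zero
  | insert i s hi ih =>
    rw [Finset.sum_insert hi]
    exact (hK i (by simp)).add (ih fun j hj => hK j (by simp [hj]))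

lemma IsKernel.conj (hK : IsKernel K) : IsKernel (fun x => (starRingEnd ℂ) (K x)) := by
  obtain ⟨hKm, ⟨C, hC⟩, s, hs, hs'⟩ := hK
  exact ⟨Complex.continuous_conj.measurable.comp hKm, ⟨C, fun x => by simpa using hC x⟩, s, hs,
    fun x hx => by simp [hs' x hx]⟩

end Kernel

section Conv

variable {G : Type*} [Group G] [TopologicalSpace G] [IsTopologicalGroup G] [T2Space G]
  [SecondCountableTopology G] [LocallyCompactSpace G] [MeasurableSpace G] [BorelSpace G]
  {μ : Measure G} [μ.IsHaarMeasure] [μ.IsMulRightInvariant] [μ.IsInvInvariant]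
  {f g K L : G → ℂ}

lemma IsKernel.inv (hK : IsKernel K) : IsKernel (fun x => K x⁻¹) := by
  obtain ⟨hKm, ⟨C, hC⟩, s, hs, hs'⟩ := hK
  exact ⟨hKm.comp measurable_inv, ⟨C, fun x => hC _⟩, s⁻¹, hs.inv, fun x hx => hs' _
      (by simpa using hx)⟩

lemma IsKernel.memLp (hK : IsKernel K) (p : ℝ≥0∞) : MemLp K p μ := by
  obtain ⟨hKm, ⟨C, hC⟩, s, hs, hs'⟩ := hK
  have h1 : MemLp (s.indicator (fun _ => C)) p μ :=
    memLp_indicator_const p hs.measurableSet C (Or.inr hs.measure_lt_top.ne)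
  refine h1.mono hKm.aestronglyMeasurable (ae_of_all _ fun x => ?_)
  by_cases hx : x ∈ s
  · simpa [hx] using (hC x).trans (le_abs_self C)
  · simp [hx, hs' x hx]

lemma IsKernel.integrable (hK : IsKernel K) : Integrable K μ :=
  memLp_one_iff_integrable.1 (hK.memLp 1)

lemma integrable_conv (hf : LocallyIntegrable f μ) (hK : IsKernel K) (x : G) :
    Integrable (fun y => f (x * y⁻¹) * K y) μ := by
  obtain ⟨hKm, ⟨C, hC⟩, s, hs, hs'⟩ := hK
  let e : G ≃ₜ G := (Homeomorph.inv G).trans (Homeomorph.mulLeft x)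
  have he : MeasurePreserving e μ μ := by
    have := Measure.measurePreserving_div_left μ x
    simp only [div_eq_mul_inv] at this
    exact this
  have h1 : IntegrableOn (f ∘ e) s μ := by
    have h2 := hf.integrableOn_isCompact (hs.image e.continuous)
    rw [← he.integrableOn_comp_preimage e.measurableEmbedding, e.injective.preimage_image] at h2
    exact h2
  have h3 : IntegrableOn (fun y => f (x * y⁻¹) * K y) s μ :=
    Integrable.mul_bdd (c := C) h1 hKm.aestronglyMeasurable (ae_of_all _ hC)
  exact (integrableOn_iff_integrable_of_support_subset fun y hy => by
    by_contra hys
    exact hy (by simp [hs' y hys])).1 h3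

lemma conv_eq_integral_left (f K : G → ℂ) (x : G) :
    conv μ f K x = ∫ z, f z * K (z⁻¹ * x) ∂μ := by
  have := integral_div_left_eq_self (fun z => f z * K (z⁻¹ * x)) μ x
  rw [← this]
  simp [conv, div_eq_mul_inv, mul_assoc]

lemma conv_add_left (hf : LocallyIntegrable f μ) (hg : LocallyIntegrable g μ) (hK : IsKernel K) :
    conv μ (f + g) K = conv μ f K + conv μ g K := by
  ext x
  simp only [conv, Pi.add_apply, add_mul]
  exact integral_add (integrable_conv hf hK x) (integrable_conv hg hK x)

lemma conv_sub_left (hf : LocallyIntegrable f μ) (hg : LocallyIntegrable g μ) (hK : IsKernel K) :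
    conv μ (f - g) K = conv μ f K - conv μ g K := by
  ext x
  simp only [conv, Pi.sub_apply, sub_mul]
  exact integral_sub (integrable_conv hf hK x) (integrable_conv hg hK x)

lemma conv_sum_left {ι : Type*} (s : Finset ι) {f : ι → G → ℂ}
    (hf : ∀ i ∈ s, LocallyIntegrable (f i) μ) (hK : IsKernel K) :
    conv μ (∑ i ∈ s, f i) K = ∑ i ∈ s, conv μ (f i) K := by
  ext x
  simp only [conv, Finset.sum_apply, Finset.sum_mul]
  exact integral_finsetSum _ fun i hi => integrable_conv (hf i hi) hK x

lemma conv_sub_right (hf : LocallyIntegrable f μ) (hK : IsKernel K) (hL : IsKernel L) :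
    conv μ f (K - L) = conv μ f K - conv μ f L := by
  ext x
  simp only [conv, Pi.sub_apply, mul_sub]
  exact integral_sub (integrable_conv hf hK x) (integrable_conv hf hL x)

lemma conv_sum_right {ι : Type*} (s : Finset ι) {K : ι → G → ℂ} (hf : LocallyIntegrable f μ)
    (hK : ∀ i ∈ s, IsKernel (K i)) :
    conv μ f (∑ i ∈ s, K i) = ∑ i ∈ s, conv μ f (K i) := by
  ext x
  simp only [conv, Finset.sum_apply, Finset.mul_sum]
  exact integral_finsetSum _ fun i hi => integrable_conv hf (hK i hi) x

lemma conv_const_mul_right (c : ℂ) :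
    conv μ f (fun x => c * K x) = fun x => c * conv μ f K x := by
  ext x
  simp only [conv]
  rw [← integral_const_mul]
  congr 1; ext y; ring

lemma quasiMeasurePreserving_mul_inv :
    Measure.QuasiMeasurePreserving (fun q : G × G => q.1 * q.2⁻¹) (μ.prod μ) μ := by
  simpa [div_eq_mul_inv] using quasiMeasurePreserving_div μ μ

lemma aestronglyMeasurable_conv_integrand (hf : AEStronglyMeasurable f μ)
    (hK : AEStronglyMeasurable K μ) :
    AEStronglyMeasurable (fun q : G × G => f (q.1 * q.2⁻¹) * K q.2) (μ.prod μ) :=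
  (hf.comp_quasiMeasurePreserving quasiMeasurePreserving_mul_inv).mul hK.comp_snd

lemma aestronglyMeasurable_conv (hf : AEStronglyMeasurable f μ) (hK : AEStronglyMeasurable K μ) :
    AEStronglyMeasurable (conv μ f K) μ :=
  (aestronglyMeasurable_conv_integrand hf hK).integral_prod_right'

lemma IsKernel.conv (hK : IsKernel K) (hL : IsKernel L) : IsKernel (conv μ K L) := by
  have hLi : Integrable L μ := hL.integrable
  obtain ⟨hKm, ⟨C, hC⟩, s, hs, hs'⟩ := hK
  obtain ⟨hLm, -, t, ht, ht'⟩ := hL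
  refine ⟨?_, ⟨∫ y, C * ‖L y‖ ∂μ, fun x => ?_⟩, s * t, hs.mul ht, fun x hx => ?_⟩
  · have : Measurable fun q : G × G => K (q.1 * q.2⁻¹) * L q.2 := by fun_prop
    exact (this.stronglyMeasurable.integral_prod_right').measurable
  · refine norm_integral_le_of_norm_le (hLi.norm.const_mul C) (ae_of_all _ fun y => ?_)
    rw [norm_mul]
    exact mul_le_mul_of_nonneg_right (hC _) (norm_nonneg _)
  · refine integral_eq_zero_of_ae (ae_of_all _ fun y => ?_)
    by_cases hy : y ∈ t
    · have : x * y⁻¹ ∉ s := fun h => hx (by simpa using Set.mul_mem_mul h hy)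
      simp [hs' _ this]
    · simp [ht' _ hy]

/-- Associativity of convolution, valid at every point. -/
lemma conv_assoc (hf : LocallyIntegrable f μ) (hK : IsKernel K) (hL : IsKernel L) :
    conv μ (conv μ f K) L = conv μ f (conv μ K L) := by
  ext x
  have h1 : ∀ y, (conv μ f K (x * y⁻¹)) * L y = ∫ v, f (x * v⁻¹) * K (v * y⁻¹) * L y ∂μ := by
    intro y
    rw [integral_mul_const]
    congr 1
    rw [conv, ← integral_mul_right_eq_self _ y⁻¹]
    simp [mul_assoc]
  have h2 : ∀ v, f (x * v⁻¹) * conv μ K L v = ∫ y, f (x * v⁻¹) * K (v * y⁻¹) * L y ∂μ := by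
    intro v
    simp only [mul_assoc]
    rw [integral_const_mul]
    rfl
  unfold conv
  rw [show (fun y => (∫ v, f (x * y⁻¹ * v⁻¹) * K v ∂μ) * L y) =
    fun y => conv μ f K (x * y⁻¹) * L y from rfl]
  simp_rw [h1]
  rw [show (fun v => f (x * v⁻¹) * ∫ y, K (v * y⁻¹) * L y ∂μ) =
    fun y => f (x * y⁻¹) * conv μ K L y from rfl]
  simp_rw [h2]
  refine integral_integral_swap ?_
  obtain ⟨hKm, ⟨C, hC⟩, s, hs, hs'⟩ := hK
  -- the integrand vanishes unless `v ∈ s * t`, so `f` may be cut off to a compact set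
  have hL' := hL
  obtain ⟨hLm, -, t, ht, ht'⟩ := hL
  have hind : IsKernel ((s * t).indicator (fun _ => (1 : ℂ)) : G → ℂ) := by
    refine ⟨measurable_const.indicator (hs.mul ht).measurableSet, ⟨1, fun x => ?_⟩, s * t,
      hs.mul ht, fun x hx => by simp [hx]⟩
    exact (norm_indicator_le_norm_self _ _).trans (by simp)
  have h3 := (hL'.integrable (μ := μ)).mul_prod (integrable_conv hf hind x)
  have h4 : Measurable fun q : G × G => K (q.2 * q.1⁻¹) := by fun_prop
  have h5 := h3.mul_bdd (c := C) h4.aestronglyMeasurable (ae_of_all _ fun q => hC _)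
  refine h5.congr (ae_of_all _ fun q => ?_)
  simp only [Function.uncurry]
  by_cases hy : q.1 ∈ t
  · by_cases hk : q.2 * q.1⁻¹ ∈ s
    · have : q.2 ∈ s * t := by simpa using Set.mul_mem_mul hk hy
      simp [this]; ring
    · simp [hs' _ hk]
  · simp [ht' _ hy]

end Conv

/-! ### Minkowski and Young inequalities, approximate identities -/

section Minkowski

variable {α β : Type*} [MeasurableSpace α] [MeasurableSpace β] {μ : Measure α} {ν : Measure β}

/-- A Minkowski type inequality for integrals depending on a parameter: a superposition of
functions of `Lᵖ` seminorm at most `b` with weight `k` has seminorm at most `‖k‖₁ b`. -/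
lemma eLpNorm_integral_mul_le [SFinite μ] [SFinite ν] {p : ℝ≥0∞} (hp : 1 ≤ p) (hp' : p ≠ ∞)
    {Φ : α × β → ℂ} {k : β → ℂ} (hΦ : AEStronglyMeasurable Φ (μ.prod ν))
    (hk : AEStronglyMeasurable k ν) {b : ℝ≥0∞}
    (hb : ∀ y, k y ≠ 0 → eLpNorm (fun x => Φ (x, y)) p μ ≤ b) :
    eLpNorm (fun x => ∫ y, Φ (x, y) * k y ∂ν) p μ ≤ eLpNorm k 1 ν * b := by
  have hp0 : p ≠ 0 := (zero_lt_one.trans_le hp).ne'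
  set r := p.toReal with hr
  have hr1 : 1 ≤ r := by
    rw [hr, ← ENNReal.toReal_one]; exact (ENNReal.toReal_le_toReal (by simp) hp').2 hp
  have hr0 : 0 < r := by linarith
  set N := eLpNorm k 1 ν with hN
  have hN' : N = ∫⁻ y, ‖k y‖ₑ ∂ν := eLpNorm_one_eq_lintegral_enorm
  have hke : AEMeasurable (fun y => ‖k y‖ₑ) ν := hk.enorm
  have hinv : 0 ≤ 1 - r⁻¹ := by
    have := inv_le_one_of_one_le₀ hr1; linarith
  -- Hölder's inequality in the variable `y`
  have h1 : ∀ᵐ x ∂μ, ‖∫ y, Φ (x, y) * k y ∂ν‖ₑ ^ r ≤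
      (∫⁻ y, ‖Φ (x, y)‖ₑ ^ r * ‖k y‖ₑ ∂ν) * N ^ (r - 1) := by
    filter_upwards [hΦ.prodMk_left] with x hx
    have h2 : ‖∫ y, Φ (x, y) * k y ∂ν‖ₑ ≤
        (∫⁻ y, ‖Φ (x, y)‖ₑ ^ r * ‖k y‖ₑ ∂ν) ^ r⁻¹ * N ^ (1 - r⁻¹) := by
      refine (enorm_integral_le_lintegral_enorm _).trans ?_
      rw [hN']
      refine le_trans (le_of_eq ?_) (ENNReal.lintegral_mul_norm_pow_le
        ((hx.enorm.pow_const r).mul hke) hke (inv_nonneg.2 hr0.le) hinv (by ring))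
      refine lintegral_congr fun y => ?_
      simp only [Pi.mul_apply]
      rw [ENNReal.mul_rpow_of_nonneg _ _ (inv_nonneg.2 hr0.le), ← ENNReal.rpow_mul,
        mul_inv_cancel₀ hr0.ne', ENNReal.rpow_one, mul_assoc,
        ← ENNReal.rpow_add_of_nonneg _ _ (inv_nonneg.2 hr0.le) hinv]
      simp
    calc _ ≤ ((∫⁻ y, ‖Φ (x, y)‖ₑ ^ r * ‖k y‖ₑ ∂ν) ^ r⁻¹ * N ^ (1 - r⁻¹)) ^ r :=
          ENNReal.rpow_le_rpow h2 hr0.le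
      _ = _ := by
          rw [ENNReal.mul_rpow_of_nonneg _ _ hr0.le, ← ENNReal.rpow_mul, ← ENNReal.rpow_mul,
            inv_mul_cancel₀ hr0.ne', ENNReal.rpow_one]
          congr 2
          field_simp
  have h3 : ∀ y, (∫⁻ x, ‖Φ (x, y)‖ₑ ^ r ∂μ) * ‖k y‖ₑ ≤ b ^ r * ‖k y‖ₑ := by
    intro y
    by_cases hy : k y = 0
    · simp [hy]
    gcongr
    have := ENNReal.rpow_le_rpow (hb y hy) hr0.le
    rwa [eLpNorm_eq_lintegral_rpow_enorm_toReal hp0 hp', ← ENNReal.rpow_mul, ← hr, one_div,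
      inv_mul_cancel₀ hr0.ne', ENNReal.rpow_one] at this
  have h4 : AEMeasurable (fun q : α × β => ‖Φ q‖ₑ ^ r * ‖k q.2‖ₑ) (μ.prod ν) :=
    (hΦ.enorm.pow_const r).mul hke.comp_snd
  have h5 : ∫⁻ x, ‖∫ y, Φ (x, y) * k y ∂ν‖ₑ ^ r ∂μ ≤ (N * b) ^ r := by
    calc _ ≤ ∫⁻ x, (∫⁻ y, ‖Φ (x, y)‖ₑ ^ r * ‖k y‖ₑ ∂ν) * N ^ (r - 1) ∂μ := lintegral_mono_ae h1
      _ = (∫⁻ x, (∫⁻ y, ‖Φ (x, y)‖ₑ ^ r * ‖k y‖ₑ ∂ν) ∂μ) * N ^ (r - 1) := by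
          rw [lintegral_mul_const'' _ h4.lintegral_prod_right']
      _ = (∫⁻ y, (∫⁻ x, ‖Φ (x, y)‖ₑ ^ r ∂μ) * ‖k y‖ₑ ∂ν) * N ^ (r - 1) := by
          rw [lintegral_lintegral_swap h4]
          congr 1
          refine lintegral_congr_ae ?_
          filter_upwards [(hΦ.prod_swap).prodMk_left] with y hy
          rw [lintegral_mul_const'']
          exact hy.enorm.pow_const r
      _ ≤ (∫⁻ y, b ^ r * ‖k y‖ₑ ∂ν) * N ^ (r - 1) := by
          exact mul_le_mul_left (lintegral_mono h3) _
      _ = (N * b) ^ r := by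
          rw [lintegral_const_mul'' _ hke, ← hN', ENNReal.mul_rpow_of_nonneg _ _ hr0.le, mul_assoc,
            mul_comm]
          congr 1
          nth_rewrite 1 [← ENNReal.rpow_one N]
          rw [← ENNReal.rpow_add_of_nonneg _ _ zero_le_one (by linarith)]
          congr 1; ring
  rw [eLpNorm_eq_lintegral_rpow_enorm_toReal hp0 hp', ← hr, one_div]
  calc _ ≤ ((N * b) ^ r) ^ r⁻¹ := ENNReal.rpow_le_rpow h5 (inv_nonneg.2 hr0.le)
    _ = N * b := by rw [← ENNReal.rpow_mul, mul_inv_cancel₀ hr0.ne', ENNReal.rpow_one]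

end Minkowski

section Young

variable {G : Type*} [Group G] [TopologicalSpace G] [IsTopologicalGroup G] [T2Space G]
  [SecondCountableTopology G] [LocallyCompactSpace G] [MeasurableSpace G] [BorelSpace G]
  {μ : Measure G} [μ.IsHaarMeasure] [μ.IsMulRightInvariant] [μ.IsInvInvariant]
  {f g K L : G → ℂ} {p q : ℝ≥0∞}

lemma eLpNorm_mul_right (hf : AEStronglyMeasurable f μ) (y : G) :
    eLpNorm (fun x => f (x * y)) p μ = eLpNorm f p μ :=
  eLpNorm_comp_measurePreserving hf (measurePreserving_mul_right μ y)

/-- Young's inequality `‖f * K‖ₚ ≤ ‖K‖₁ ‖f‖ₚ`. -/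
lemma eLpNorm_conv_le (hp : 1 ≤ p) (hp' : p ≠ ∞) (hf : AEStronglyMeasurable f μ)
    (hK : AEStronglyMeasurable K μ) :
    eLpNorm (conv μ f K) p μ ≤ eLpNorm K 1 μ * eLpNorm f p μ :=
  eLpNorm_integral_mul_le hp hp' (Φ := fun q => f (q.1 * q.2⁻¹))
    (hf.comp_quasiMeasurePreserving quasiMeasurePreserving_mul_inv) hK
    fun y _ => (eLpNorm_mul_right hf y⁻¹).le

lemma memLp_conv (hp : 1 ≤ p) (hp' : p ≠ ∞) (hf : MemLp f p μ) (hK : IsKernel K) :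
    MemLp (conv μ f K) p μ :=
  ⟨aestronglyMeasurable_conv hf.1 (hK.memLp 1).1,
    (eLpNorm_conv_le hp hp' hf.1 (hK.memLp 1).1).trans_lt
      (ENNReal.mul_lt_top (hK.memLp 1).2 hf.2)⟩

/-- A mean one average of the translates of `f` is as close to `f` as the translates are. -/
lemma eLpNorm_conv_sub_self_le (hp : 1 ≤ p) (hp' : p ≠ ∞) (hf : MemLp f p μ)
    (hK : IsKernel K) (hK1 : ∫ y, K y ∂μ = 1) {b : ℝ≥0∞}
    (hb : ∀ y, K y ≠ 0 → eLpNorm (fun x => f (x * y⁻¹) - f x) p μ ≤ b) :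
    eLpNorm (conv μ f K - f) p μ ≤ eLpNorm K 1 μ * b := by
  have h := eLpNorm_integral_mul_le hp hp' (Φ := fun q => f (q.1 * q.2⁻¹) - f q.1)
    ((hf.1.comp_quasiMeasurePreserving quasiMeasurePreserving_mul_inv).sub hf.1.comp_fst)
    (hK.memLp 1).1 hb
  convert h using 2
  ext x
  simp only [Pi.sub_apply, sub_mul]
  rw [integral_sub (integrable_conv (hf.locallyIntegrable hp) hK x) (hK.integrable.const_mul _),
    integral_const_mul, hK1, mul_one]
  rfl

/-- Translations act continuously on `Lᵖ`. -/
lemma tendsto_eLpNorm_translate_sub [μ.InnerRegularCompactLTTop] (hp : 1 ≤ p) (hp' : p ≠ ∞)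
    (hf : MemLp f p μ) :
    Tendsto (fun y => eLpNorm (fun x => f (x * y⁻¹) - f x) p μ) (𝓝 1) (𝓝 0) := by
  have : Fact (1 ≤ p) := ⟨hp⟩
  let c : C(G, C(G, G)) := (ContinuousMap.mk (fun a : G × G => a.2 * a.1⁻¹)
    (by fun_prop)).curry
  have hc : ∀ y, MeasurePreserving (c y) μ μ := fun y => measurePreserving_mul_right μ y⁻¹
  have h1 : Tendsto (fun y => Lp.compMeasurePreserving (c y) (hc y) (hf.toLp f)) (𝓝 1)
      (𝓝 (Lp.compMeasurePreserving (c 1) (hc 1) (hf.toLp f))) :=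
    tendsto_const_nhds.compMeasurePreservingLp (c.continuous.tendsto 1) hc (hc 1) hp'
  simp_rw [Lp.toLp_compMeasurePreserving hf] at h1
  rw [Lp.tendsto_Lp_iff_tendsto_eLpNorm''] at h1
  convert h1 using 4
  · rename_i y x
    simp [c]

/-- Kernels of mean one that are uniformly bounded in `L¹` and concentrate at the identity form an
approximate identity on `Lᵖ`. -/
lemma tendsto_eLpNorm_conv_sub_self [μ.InnerRegularCompactLTTop] (hp : 1 ≤ p) (hp' : p ≠ ∞)
    (hf : MemLp f p μ) {k : ℕ → G → ℂ} (hk : ∀ j, IsKernel (k j)) (hk1 : ∀ j, ∫ y, k j y ∂μ = 1)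
    {A : ℝ≥0} (hA : ∀ j, eLpNorm (k j) 1 μ ≤ A)
    (hs : ∀ U ∈ 𝓝 (1 : G), ∀ᶠ j in atTop, ∀ y, k j y ≠ 0 → y ∈ U) :
    Tendsto (fun j => eLpNorm (conv μ f (k j) - f) p μ) atTop (𝓝 0) := by
  have h0 := tendsto_eLpNorm_translate_sub hp hp' hf
  rw [ENNReal.tendsto_nhds_zero] at h0 ⊢
  intro ε hε
  have hA' : (A : ℝ≥0∞) + 1 ≠ 0 := by simp
  have hε' : 0 < ε / (A + 1) := ENNReal.div_pos hε.ne' (by simp)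
  filter_upwards [hs _ (h0 _ hε')] with j hj
  calc _ ≤ eLpNorm (k j) 1 μ * (ε / (A + 1)) :=
        eLpNorm_conv_sub_self_le hp hp' hf (hk j) (hk1 j) fun y hy => hj y hy
    _ ≤ (A + 1) * (ε / (A + 1)) := by
        gcongr
        exact (hA j).trans le_self_add
    _ ≤ ε := ENNReal.mul_div_le

lemma memLp_norm_coe (hf : MemLp f p μ) : MemLp (fun x => ((‖f x‖ : ℝ) : ℂ)) p μ :=
  ⟨Complex.continuous_ofReal.comp_aestronglyMeasurable hf.1.norm, by
    have := hf.norm.2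
    rw [← eLpNorm_norm] at this ⊢
    simpa using this⟩

lemma IsKernel.norm_coe (hK : IsKernel K) : IsKernel (fun x => ((‖K x‖ : ℝ) : ℂ)) := by
  obtain ⟨hKm, ⟨C, hC⟩, s, hs, hs'⟩ := hK
  exact ⟨Complex.measurable_ofReal.comp hKm.norm, ⟨C, fun x => by simpa using hC x⟩, s, hs,
    fun x hx => by simp [hs' x hx]⟩

/-- The transpose of convolution by `K` is convolution by the reflected kernel. -/
lemma integral_conv_mul [p.HolderConjugate q] (hp' : p ≠ ∞) (hf : MemLp f p μ)
    (hg : MemLp g q μ) (hK : IsKernel K) :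
    ∫ x, conv μ f K x * g x ∂μ = ∫ x, f x * conv μ g (fun y => K y⁻¹) x ∂μ := by
  have hp : 1 ≤ p := ENNReal.HolderConjugate.one_le p q
  have h1 : ∀ x, conv μ f K x * g x = ∫ z, f z * K (z⁻¹ * x) * g x ∂μ := fun x => by
    rw [conv_eq_integral_left, integral_mul_const]
  have h2 : ∀ z, f z * conv μ g (fun y => K y⁻¹) z = ∫ x, f z * K (z⁻¹ * x) * g x ∂μ := by
    intro z
    rw [conv_eq_integral_left, ← integral_const_mul]
    congr 1; ext x
    simp; ring
  simp_rw [h1, h2]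
  refine integral_integral_swap ?_
  have hm : AEStronglyMeasurable (fun q : G × G => f q.2 * K (q.2⁻¹ * q.1) * g q.1)
      (μ.prod μ) := by
    have hK' := hK.measurable
    have : Measurable fun q : G × G => K (q.2⁻¹ * q.1) := by fun_prop
    exact (hf.1.comp_snd.mul this.aestronglyMeasurable).mul hg.1.comp_fst
  refine (integrable_prod_iff hm).2 ⟨ae_of_all _ fun x => ?_, ?_⟩
  · have h3 := integrable_conv (hf.locallyIntegrable hp) hK x
    have h4 := (h3.comp_mul_right x).comp_inv.mul_const (g x)
    refine h4.congr (ae_of_all _ fun z => ?_)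
    simp [mul_assoc]
  · have h3 : MemLp (conv μ (fun x => ((‖f x‖ : ℝ) : ℂ)) (fun x => ((‖K x‖ : ℝ) : ℂ))) p μ :=
      memLp_conv hp hp' (memLp_norm_coe hf) hK.norm_coe
    have h4 := (h3.integrable_mul hg).norm
    refine h4.congr (ae_of_all _ fun x => ?_)
    simp only [Pi.mul_apply, norm_mul, conv_eq_integral_left]
    rw [integral_mul_const]
    congr 1
    have : ∀ z, ((‖f z‖ : ℝ) : ℂ) * ((‖K (z⁻¹ * x)‖ : ℝ) : ℂ)
      = ((‖f z‖ * ‖K (z⁻¹ * x)‖ : ℝ) : ℂ) := by intro z; push_cast; rfl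
    simp_rw [this]
    rw [integral_complex_ofReal, Complex.norm_real, Real.norm_of_nonneg]
    exact integral_nonneg fun z => by positivity

end Young

/-! ### The Cotlar–Stein lemma -/

section Cotlar

variable {ι : Type*} {A E : Type*}

/-- The sum of `f l` over all words `l` of length `n` whose letters are pairs from `s`. -/
def wordSum [AddCommMonoid E] (s : Finset ι) : ℕ → (List (ι × ι) → E) → E
  | 0, f => f []
  | n + 1, f => ∑ q ∈ s ×ˢ s, wordSum s n fun l => f (q :: l)

lemma norm_wordSum_le [SeminormedAddCommGroup E] (s : Finset ι) (n : ℕ) {f : List (ι × ι) → E}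
    {g : List (ι × ι) → ℝ} (h : ∀ l, ‖f l‖ ≤ g l) : ‖wordSum s n f‖ ≤ wordSum s n g := by
  induction n generalizing f g with
  | zero => exact h []
  | succ n ih =>
    exact (norm_sum_le _ _).trans (Finset.sum_le_sum fun q _ => ih fun l => h (q :: l))

lemma wordSum_const_mul [NonUnitalNonAssocSemiring E] (s : Finset ι) (n : ℕ) (x : E)
    (f : List (ι × ι) → E) : wordSum s n (fun l => x * f l) = x * wordSum s n f := by
  induction n generalizing f with
  | zero => rfl
  | succ n ih => simp only [wordSum, ih, Finset.mul_sum]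

variable [NormedRing A] [StarRing A] [CStarRing A]

/-- The product `T_{j₁}⋆ T_{k₁} T_{j₂}⋆ T_{k₂} ⋯` attached to the word `(j₁, k₁), (j₂, k₂), …`. -/
def wordProd (T : ι → A) (l : List (ι × ι)) : A := (l.map fun q => star (T q.1) * T q.2).prod

lemma wordSum_wordProd (s : Finset ι) (T : ι → A) (n : ℕ) :
    wordSum s n (wordProd T) = (star (∑ i ∈ s, T i) * ∑ i ∈ s, T i) ^ n := by
  induction n with
  | zero => simp [wordSum, wordProd]
  | succ n ih =>
    have : ∀ q : ι × ι, (fun l => wordProd T (q :: l))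
        = fun l => (star (T q.1) * T q.2) * wordProd T l := by
      intro q; ext l; simp [wordProd]
    simp only [wordSum, this, wordSum_const_mul, ih]
    rw [← Finset.sum_mul, pow_succ', star_sum, Finset.sum_mul_sum, Finset.sum_product]

/-- If `x ^ n ≤ c y ^ n` for arbitrarily large `n`, then `x ≤ y`. -/
lemma le_of_frequently_pow_le {x y c : ℝ} (hy : 0 ≤ y)
    (h : ∃ᶠ n : ℕ in atTop, x ^ n ≤ c * y ^ n) : x ≤ y := by
  by_contra! hxy
  have hx : 0 < x := hy.trans_lt hxy
  have h1 : Tendsto (fun n : ℕ => c * (y / x) ^ n) atTop (𝓝 (c * 0)) :=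
    (tendsto_pow_atTop_nhds_zero_of_lt_one (div_nonneg hy hx.le)
      ((div_lt_one hx).2 hxy)).const_mul c
  rw [mul_zero] at h1
  refine h ((h1.eventually_lt_const zero_lt_one).mono fun n hn => ?_)
  rw [not_le]
  rwa [div_pow, ← mul_div_assoc, div_lt_one (pow_pos hx n)] at hn

/-- The **Cotlar–Stein lemma**: operators whose products `T_j⋆ T_k` and `T_j T_k⋆` are bounded by
`γ(j,k)²` have a sum bounded by the row sums of `γ`. The words of the expansion of
`((ΣT)⋆ ΣT)ⁿ` are estimated by grouping adjacent factors in the two possible ways. -/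
theorem cotlar_stein (s : Finset ι) (T : ι → A) (γ : ι → ι → ℝ) (hγ : ∀ j k, 0 ≤ γ j k)
    {σ : ℝ} (hσ0 : 0 ≤ σ) (hσ : ∀ j, ∑ k ∈ s, γ j k ≤ σ) (hd : ∀ j, γ j j ≤ σ)
    (h1 : ∀ j k, ‖star (T j) * T k‖ ≤ γ j k ^ 2)
    (h2 : ∀ j k, ‖T j * star (T k)‖ ≤ γ j k ^ 2) : ‖∑ i ∈ s, T i‖ ≤ σ := by
  have hT : ∀ j, ‖T j‖ ≤ σ := fun j => by
    have := h1 j j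
    rw [CStarRing.norm_star_mul_self, ← sq] at this
    exact (abs_le_of_sq_le_sq' this (hγ j j)).2.trans (hd j)
  -- grouping as `(T_{j₁}⋆ T_{k₁}) (T_{j₂}⋆ T_{k₂}) ⋯`
  let a : List (ι × ι) → ℝ := fun l => (l.map fun q => γ q.1 q.2).prod
  have ha0 : ∀ l, 0 ≤ a l := fun l => by
    refine List.prod_nonneg fun x hx => ?_
    obtain ⟨q, -, rfl⟩ := List.mem_map.1 hx
    exact hγ _ _
  have ha : ∀ q l, ‖wordProd T (q :: l)‖ ≤ a (q :: l) ^ 2 := by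
    intro q l
    induction l generalizing q with
    | nil => simpa [wordProd, a] using h1 q.1 q.2
    | cons q' l ih =>
      have : wordProd T (q :: q' :: l) = (star (T q.1) * T q.2) * wordProd T (q' :: l) := by
        simp [wordProd]
      rw [this, show a (q :: q' :: l) = γ q.1 q.2 * a (q' :: l) by simp [a], mul_pow]
      exact (norm_mul_le _ _).trans (mul_le_mul (h1 _ _) (ih q') (norm_nonneg _) (sq_nonneg _))
  -- grouping as `T_{j₁}⋆ (T_{k₁} T_{j₂}⋆) (T_{k₂} T_{j₃}⋆) ⋯`
  let b : List (ι × ι) → ι → ℝ := fun l =>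
    List.rec (fun _ => 1) (fun q _ ih k => γ k q.1 * ih q.2) l
  have hb_cons : ∀ q l k, b (q :: l) k = γ k q.1 * b l q.2 := fun _ _ _ => rfl
  have hb0 : ∀ l k, 0 ≤ b l k := by
    intro l
    induction l with
    | nil => exact fun k => zero_le_one
    | cons q l ih => exact fun k => mul_nonneg (hγ _ _) (ih _)
  have hb : ∀ l k, ‖T k * wordProd T l‖ ≤ σ * b l k ^ 2 := by
    intro l
    induction l with
    | nil => intro k; simpa [wordProd, b] using hT k
    | cons q l ih =>
      intro k
      have : T k * wordProd T (q :: l) = (T k * star (T q.1)) * (T q.2 * wordProd T l) := by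
        simp [wordProd, mul_assoc]
      rw [this, hb_cons, mul_pow]
      calc _ ≤ γ k q.1 ^ 2 * (σ * b l q.2 ^ 2) :=
            (norm_mul_le _ _).trans (mul_le_mul (h2 _ _) (ih q.2) (norm_nonneg _) (sq_nonneg _))
        _ = _ := by ring
  -- the geometric mean of the estimates from the two groupings, in which each factor `γ` occurs
  -- linearly and summation over one letter after the other is possible
  have hab : ∀ q l, ‖wordProd T (q :: l)‖ ≤ σ * γ q.1 q.2 * (a l * b l q.2) := by
    intro q l
    have h3 : ‖wordProd T (q :: l)‖ ≤ (σ * b l q.2) ^ 2 := by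
      have : wordProd T (q :: l) = star (T q.1) * (T q.2 * wordProd T l) := by
        simp [wordProd, mul_assoc]
      rw [this]
      refine (norm_mul_le _ _).trans ?_
      rw [norm_star]
      calc _ ≤ σ * (σ * b l q.2 ^ 2) := mul_le_mul (hT _) (hb _ _) (norm_nonneg _) hσ0
        _ = _ := by ring
    refine (abs_le_of_sq_le_sq' ?_ (by have := hγ q.1 q.2; have := ha0 l; have := hb0 l q.2
                                       positivity)).2
    calc _ ≤ a (q :: l) ^ 2 * (σ * b l q.2) ^ 2 := by
          rw [sq]; exact mul_le_mul (ha q l) h3 (norm_nonneg _) (sq_nonneg _)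
      _ = _ := by
          rw [show a (q :: l) = γ q.1 q.2 * a l by simp [a]]; ring
  have hsum : ∀ n k, wordSum s n (fun l => a l * b l k) ≤ σ ^ (2 * n) := by
    intro n
    induction n with
    | zero => intro k; simp [wordSum, a, b]
    | succ n ih =>
      intro k
      have h4 : ∀ q : ι × ι, (fun l => a (q :: l) * b (q :: l) k)
          = fun l => (γ q.1 q.2 * γ k q.1) * (a l * b l q.2) := by
        intro q; ext l
        rw [show a (q :: l) = γ q.1 q.2 * a l by simp [a], hb_cons]; ring
      simp only [wordSum, h4, wordSum_const_mul]
      calc _ ≤ ∑ q ∈ s ×ˢ s, γ q.1 q.2 * γ k q.1 * σ ^ (2 * n) :=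
            Finset.sum_le_sum fun q _ =>
              mul_le_mul_of_nonneg_left (ih q.2) (mul_nonneg (hγ _ _) (hγ _ _))
        _ = ∑ j ∈ s, γ k j * (∑ k' ∈ s, γ j k') * σ ^ (2 * n) := by
            rw [Finset.sum_product]
            refine Finset.sum_congr rfl fun j _ => ?_
            rw [← Finset.sum_mul, Finset.mul_sum]
            congr 1
            exact Finset.sum_congr rfl fun _ _ => mul_comm _ _
        _ ≤ ∑ j ∈ s, γ k j * σ * σ ^ (2 * n) :=
            Finset.sum_le_sum fun j _ => mul_le_mul_of_nonneg_right
              (mul_le_mul_of_nonneg_left (hσ j) (hγ _ _)) (by positivity)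
        _ = (∑ j ∈ s, γ k j) * (σ * σ ^ (2 * n)) := by
            rw [Finset.sum_mul]; refine Finset.sum_congr rfl fun _ _ => by ring
        _ ≤ σ * (σ * σ ^ (2 * n)) := mul_le_mul_of_nonneg_right (hσ k) (by positivity)
        _ = _ := by ring
  set S := ∑ i ∈ s, T i with hS
  have hpow : ∀ n, ‖(star S * S) ^ (n + 1)‖ ≤ s.card * σ ^ (2 * (n + 1)) := by
    intro n
    rw [hS, ← wordSum_wordProd]
    calc _ ≤ ∑ q ∈ s ×ˢ s, wordSum s n fun l => σ * γ q.1 q.2 * (a l * b l q.2) :=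
          (norm_sum_le _ _).trans (Finset.sum_le_sum fun q _ =>
            norm_wordSum_le s n fun l => hab q l)
      _ ≤ ∑ q ∈ s ×ˢ s, σ * γ q.1 q.2 * σ ^ (2 * n) := by
          simp only [wordSum_const_mul]
          exact Finset.sum_le_sum fun q _ =>
            mul_le_mul_of_nonneg_left (hsum n q.2) (mul_nonneg hσ0 (hγ _ _))
      _ = ∑ j ∈ s, (∑ k ∈ s, γ j k) * (σ * σ ^ (2 * n)) := by
          rw [Finset.sum_product]
          refine Finset.sum_congr rfl fun j _ => ?_
          rw [Finset.sum_mul]; refine Finset.sum_congr rfl fun _ _ => by ring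
      _ ≤ ∑ j ∈ s, σ * (σ * σ ^ (2 * n)) :=
          Finset.sum_le_sum fun j _ => mul_le_mul_of_nonneg_right (hσ j) (by positivity)
      _ = _ := by rw [Finset.sum_const, nsmul_eq_mul]; ring
  -- the factor `s.card` disappears on taking roots, as `‖(S⋆ S) ^ 2 ^ N‖ = ‖S⋆ S‖ ^ 2 ^ N`
  refine le_of_frequently_pow_le (c := s.card) hσ0 (frequently_atTop.2 fun N => ?_)
  refine ⟨2 * 2 ^ N, (Nat.lt_two_pow_self (n := N)).le.trans (by lia), ?_⟩
  obtain ⟨n, hn⟩ : ∃ n, 2 ^ N = n + 1 := ⟨2 ^ N - 1, by have := Nat.one_le_two_pow (n := N); lia⟩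
  have h5 := hpow n
  rw [← hn] at h5
  have h6 := congrArg NNReal.toReal ((IsSelfAdjoint.star_mul_self S).nnnorm_pow_two_pow N)
  simp only [coe_nnnorm, NNReal.coe_pow] at h6
  rw [h6, CStarRing.norm_star_mul_self, ← sq, ← pow_mul] at h5
  exact h5

end Cotlar

/-! ### Convolution operators on `L²` -/

section L2

variable {G : Type*} [Group G] [TopologicalSpace G] [IsTopologicalGroup G] [T2Space G]
  [SecondCountableTopology G] [LocallyCompactSpace G] [MeasurableSpace G] [BorelSpace G]
  {μ : Measure G} [μ.IsHaarMeasure] [μ.IsMulRightInvariant] [μ.IsInvInvariant]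
  {f g K L : G → ℂ} {p q : ℝ≥0∞}

/-- The reflection `K(x⁻¹)` of a kernel. -/
def reflect (K : G → ℂ) (x : G) : ℂ := K x⁻¹

/-- The adjoint kernel `conj K(x⁻¹)`. -/
noncomputable def adj (K : G → ℂ) (x : G) : ℂ := (starRingEnd ℂ) (K x⁻¹)

lemma IsKernel.reflect (hK : IsKernel K) : IsKernel (reflect K) := hK.inv

lemma IsKernel.adj (hK : IsKernel K) : IsKernel (adj K) := hK.inv.conj

lemma eLpNorm_reflect (hK : AEStronglyMeasurable K μ) :
    eLpNorm (reflect K) p μ = eLpNorm K p μ :=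
  eLpNorm_comp_measurePreserving hK (Measure.measurePreserving_inv μ)

lemma eLpNorm_adj (hK : AEStronglyMeasurable K μ) :
    eLpNorm (adj K) p μ = eLpNorm K p μ := by
  rw [← eLpNorm_reflect hK]
  exact eLpNorm_congr_norm_ae (ae_of_all _ fun x => by simp [reflect, adj])

lemma reflect_conv (K L : G → ℂ) :
    reflect (conv μ K L) = conv μ (reflect L) (reflect K) := by
  ext x
  rw [conv_eq_integral_left, ← integral_inv_eq_self]
  simp [reflect, conv, mul_comm]

lemma adj_conv (K L : G → ℂ) : adj (conv μ K L) = conv μ (adj L) (adj K) := by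
  ext x
  have : adj (conv μ K L) x = (starRingEnd ℂ) (reflect (conv μ K L) x) := rfl
  rw [this, reflect_conv, conv, ← integral_conj]
  simp [conv, adj, reflect]

lemma conv_congr_ae (h : f =ᵐ[μ] g) (K : G → ℂ) : conv μ f K = conv μ g K := by
  ext x
  have h1 : Measure.QuasiMeasurePreserving (fun y => x * y⁻¹) μ μ := by
    simpa [div_eq_mul_inv] using
      (Measure.measurePreserving_div_left μ x).quasiMeasurePreserving
  refine integral_congr_ae ?_
  filter_upwards [h1.ae_eq_comp h] with y hy
  simp only [Function.comp] at hy
  rw [hy]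

/-- Convolution by a kernel as a bounded operator on `L²`. -/
noncomputable def convL2 (μ : Measure G) [μ.IsHaarMeasure] [μ.IsMulRightInvariant]
    [μ.IsInvInvariant] (hK : IsKernel K) : Lp ℂ 2 μ →L[ℂ] Lp ℂ 2 μ :=
  LinearMap.mkContinuous
    { toFun := fun f => (memLp_conv (by norm_num) (by norm_num) (Lp.memLp f) hK).toLp _
      map_add' := fun f g => by
        rw [← MemLp.toLp_add]
        congr 1
        rw [conv_congr_ae (Lp.coeFn_add f g), conv_add_left _ _ hK]
        · exact (Lp.memLp f).locallyIntegrable (by norm_num)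
        · exact (Lp.memLp g).locallyIntegrable (by norm_num)
      map_smul' := fun c f => by
        rw [RingHom.id_apply, ← MemLp.toLp_const_smul]
        congr 1
        rw [conv_congr_ae (Lp.coeFn_smul c f)]
        ext x
        simp only [conv, Pi.smul_apply, smul_eq_mul, ← integral_const_mul]
        congr 1; ext y; ring }
    (eLpNorm K 1 μ).toReal fun f => by
      simp only [LinearMap.coe_mk, AddHom.coe_mk, Lp.norm_toLp]
      rw [Lp.norm_def, ← ENNReal.toReal_mul]
      exact ENNReal.toReal_mono (ENNReal.mul_ne_top (hK.memLp 1).2.ne (Lp.memLp f).2.ne)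
        (eLpNorm_conv_le (by norm_num) (by norm_num) (Lp.memLp f).1 (hK.memLp 1).1)

lemma convL2_apply (hK : IsKernel K) (f : Lp ℂ 2 μ) :
    convL2 μ hK f = (memLp_conv (by norm_num) (by norm_num) (Lp.memLp f) hK).toLp _ := rfl

lemma convL2_toLp (hK : IsKernel K) (hf : MemLp f 2 μ) :
    convL2 μ hK (hf.toLp f) = (memLp_conv (by norm_num) (by norm_num) hf hK).toLp _ := by
  rw [convL2_apply]
  congr 1
  exact conv_congr_ae hf.coeFn_toLp K

lemma norm_convL2_le (hK : IsKernel K) : ‖convL2 μ hK‖ ≤ (eLpNorm K 1 μ).toReal :=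
  LinearMap.mkContinuous_norm_le _ ENNReal.toReal_nonneg _

lemma convL2_mul (hK : IsKernel K) (hL : IsKernel L) :
    convL2 μ hK * convL2 μ hL = convL2 μ (hL.conv hK (μ := μ)) := by
  ext1 f
  rw [mul_apply_eq_comp, convL2_apply hL, convL2_toLp, convL2_apply]
  congr 1
  exact conv_assoc ((Lp.memLp f).locallyIntegrable (by norm_num)) hL hK

lemma star_convL2 (hK : IsKernel K) : star (convL2 μ hK) = convL2 μ hK.adj := by
  rw [ContinuousLinearMap.star_eq_adjoint]
  symm
  rw [ContinuousLinearMap.eq_adjoint_iff]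
  intro f g
  simp only [L2.inner_def, RCLike.inner_apply]
  have hg := Lp.memLp g
  have hf := (Lp.memLp f).star
  have h1 := integral_conv_mul (p := 2) (q := 2) (by norm_num) hg hf hK
  have h2 : ∫ a, g a * (starRingEnd ℂ) (convL2 μ hK.adj f a) ∂μ
      = ∫ x, g x * conv μ (star f) (fun y => K y⁻¹) x ∂μ := by
    refine integral_congr_ae ?_
    rw [convL2_apply]
    filter_upwards [(memLp_conv (by norm_num) (by norm_num) (Lp.memLp f) hK.adj).coeFn_toLp]
      with x hx
    rw [hx, conv, conv, ← integral_conj]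
    simp [adj]
  rw [h2, ← h1]
  refine integral_congr_ae ?_
  rw [convL2_apply]
  filter_upwards [(memLp_conv (by norm_num) (by norm_num) hg hK).coeFn_toLp] with x hx
  rw [hx]; rfl

lemma convL2_sum (s : Finset ℕ) {K : ℕ → G → ℂ} (hK : ∀ i, IsKernel (K i)) :
    convL2 μ (IsKernel.sum s fun i _ => hK i) = ∑ i ∈ s, convL2 μ (hK i) := by
  ext1 f
  rw [convL2_apply, _root_.sum_apply]
  simp_rw [convL2_apply]
  have hf : LocallyIntegrable f μ := (Lp.memLp f).locallyIntegrable (by norm_num)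
  have h1 : ∀ t : Finset ℕ, MemLp (∑ i ∈ t, conv μ f (K i)) 2 μ := fun t =>
    memLp_finsetSum' t fun i _ => memLp_conv (by norm_num) (by norm_num) (Lp.memLp f) (hK i)
  have h2 : ∀ t : Finset ℕ, (h1 t).toLp _ = ∑ i ∈ t,
      (memLp_conv (by norm_num) (by norm_num) (Lp.memLp f) (hK i)).toLp (conv μ f (K i)) := by
    intro t
    induction t using Finset.induction_on with
    | empty => simp
    | insert i t hi ih =>
      simp only [Finset.sum_insert hi]
      rw [MemLp.toLp_add, ← ih]
  rw [← h2]
  congr 1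
  exact conv_sum_right s hf fun i _ => hK i

lemma sum_pow_dist_le {θ : ℝ≥0} (hθ : θ < 1) (s : Finset ℕ) (j : ℕ) :
    ∑ k ∈ s, θ ^ Nat.dist j k ≤ 2 / (1 - θ) := by
  have hgeo : ∀ t : Finset ℕ, ∑ i ∈ t, θ ^ i ≤ 1 / (1 - θ) := fun t => by
    rw [one_div, ← NNReal.tsum_geometric hθ]
    exact (NNReal.summable_geometric hθ).sum_le_tsum _ fun i _ => by positivity
  rw [← Finset.sum_filter_add_sum_filter_not s (fun k => k ≤ j)]
  have e1 : ∑ k ∈ s with k ≤ j, θ ^ Nat.dist j k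
      = ∑ i ∈ (s.filter (fun k => k ≤ j)).image (fun k => j - k), θ ^ i := by
    rw [Finset.sum_image]
    · refine Finset.sum_congr rfl fun k hk => ?_
      rw [Nat.dist_eq_sub_of_le_right (Finset.mem_filter.1 hk).2]
    · intro a ha b hb hab
      simp only [Finset.coe_filter, Set.mem_ofPred_eq] at ha hb hab
      lia
  have e2 : ∑ k ∈ s with ¬ k ≤ j, θ ^ Nat.dist j k
      = ∑ i ∈ (s.filter (fun k => ¬ k ≤ j)).image (fun k => k - j), θ ^ i := by
    rw [Finset.sum_image]
    · refine Finset.sum_congr rfl fun k hk => ?_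
      rw [Nat.dist_eq_sub_of_le (not_le.1 (Finset.mem_filter.1 hk).2).le]
    · intro a ha b hb hab
      simp only [Finset.coe_filter, Set.mem_ofPred_eq] at ha hb hab
      lia
  rw [e1, e2]
  calc _ ≤ 1 / (1 - θ) + 1 / (1 - θ) := add_le_add (hgeo _) (hgeo _)
    _ = _ := by rw [← add_div]; norm_num

/-- The `L²` bound for sums of almost orthogonal convolution operators. -/
lemma eLpNorm_two_conv_sum_le {κ : ℕ → G → ℂ} (hκ : ∀ m, IsKernel (κ m)) {c θ : ℝ≥0} (hθ : θ < 1)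
    (h1 : ∀ j m, eLpNorm (conv μ (κ m) (adj (κ j))) 1 μ ≤ ((c * θ ^ Nat.dist j m) ^ 2 : ℝ≥0))
    (h2 : ∀ j m, eLpNorm (conv μ (adj (κ m)) (κ j)) 1 μ ≤ ((c * θ ^ Nat.dist j m) ^ 2 : ℝ≥0))
    (s : Finset ℕ) (hf : MemLp f 2 μ) :
    eLpNorm (conv μ f (∑ i ∈ s, κ i)) 2 μ ≤ (c * (2 / (1 - θ)) : ℝ≥0) * eLpNorm f 2 μ := by
  have hrow : ∀ j, ∑ k ∈ s, ((c * θ ^ Nat.dist j k : ℝ≥0) : ℝ) ≤ (c * (2 / (1 - θ)) : ℝ≥0) := by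
    intro j
    rw [← NNReal.coe_sum, ← Finset.mul_sum, NNReal.coe_le_coe]
    exact mul_le_mul_right (sum_pow_dist_le hθ s j) c
  have hone : 1 ≤ 2 / (1 - θ) := by
    rw [one_le_div (tsub_pos_of_lt hθ)]
    exact tsub_le_self.trans one_le_two
  have e1 : ∀ j k, ‖star (convL2 μ (hκ j)) * convL2 μ (hκ k)‖
      ≤ ((c * θ ^ Nat.dist j k : ℝ≥0) : ℝ) ^ 2 := by
    intro j k
    rw [star_convL2, convL2_mul, ← NNReal.coe_pow]
    exact (norm_convL2_le _).trans (ENNReal.toReal_le_coe_of_le_coe (h1 j k))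
  have e2 : ∀ j k, ‖convL2 μ (hκ j) * star (convL2 μ (hκ k))‖
      ≤ ((c * θ ^ Nat.dist j k : ℝ≥0) : ℝ) ^ 2 := by
    intro j k
    rw [star_convL2, convL2_mul, ← NNReal.coe_pow]
    exact (norm_convL2_le _).trans (ENNReal.toReal_le_coe_of_le_coe
      ((h2 j k).trans_eq rfl))
  have key := cotlar_stein s (fun i => convL2 μ (hκ i))
    (fun j k => ((c * θ ^ Nat.dist j k : ℝ≥0) : ℝ)) (fun j k => NNReal.coe_nonneg _)
    (NNReal.coe_nonneg _) hrow (fun j => by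
      simp only [Nat.dist_self, pow_zero, mul_one, NNReal.coe_le_coe]
      exact le_mul_of_one_le_right c.2 hone) e1 e2
  rw [← convL2_sum s hκ] at key
  have h3 := (convL2 μ (IsKernel.sum s fun i _ => hκ i)).le_of_opNorm_le key (hf.toLp f)
  rw [convL2_toLp, Lp.norm_toLp, Lp.norm_toLp, ← ENNReal.coe_toReal, ← ENNReal.toReal_mul] at h3
  refine (ENNReal.toReal_le_toReal ?_ ?_).1 h3
  · exact (memLp_conv (by norm_num) (by norm_num) hf (IsKernel.sum s fun i _ => hκ i)).2.ne
  · exact ENNReal.mul_ne_top ENNReal.coe_ne_top hf.2.ne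

end L2

/-! ### Ball systems, approximate identities and their difference kernels -/

section Families

variable {G : Type*} [Group G] [TopologicalSpace G] [IsTopologicalGroup G] [T2Space G]
  [SecondCountableTopology G] [LocallyCompactSpace G] [MeasurableSpace G] [BorelSpace G]

/-- A decreasing sequence of balls `B m j` centred at the identity, `j` being the scale; `m` counts
enlargements, so that `B m j * B m j ⊆ B (m + 1) j`. The measure of an enlargement is controlled at
each scale, but no relation between the measures at consecutive scales is required. -/
structure BallSystem (μ : Measure G) (B : ℕ → ℕ → Set G) : Prop where
  isCompact : ∀ m j, IsCompact (B m j)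
  inv_mem : ∀ {m j x}, x ∈ B m j → x⁻¹ ∈ B m j
  mul_mem : ∀ {m j x y}, x ∈ B m j → y ∈ B m j → x * y ∈ B (m + 1) j
  anti : ∀ m, Antitone (B m)
  mono : ∀ m j, B m j ⊆ B (m + 1) j
  one_mem : ∀ m j, 1 ∈ B m j
  pos : ∀ j, μ (B 0 j) ≠ 0
  doubling : ∀ m, ∃ A : ℝ≥0, ∀ j, μ (B m j) ≤ A * μ (B 0 j)
  shrink : ∀ m, ∀ U ∈ 𝓝 (1 : G), ∀ᶠ j in atTop, B m j ⊆ U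

/-- A family of kernels `k j` of mean one, adapted to the balls `B 0 j`: supported there, of the
natural size, and smooth at that scale in an `L¹` sense with respect to both translations. The gain
is written as `θ ^ (4 * n)` so that the powers of `θ` left after interpolating between two estimates
and taking square roots are still integral. -/
structure ApproxId (μ : Measure G) (B : ℕ → ℕ → Set G) (θ A : ℝ≥0) (k : ℕ → G → ℂ) : Prop where
  isKernel : ∀ j, IsKernel (k j)
  support : ∀ j, ∀ x ∉ B 0 j, k j x = 0
  size : ∀ j x, ‖k j x‖ₑ ≤ A / μ (B 0 j)
  integral_eq_one : ∀ j, ∫ x, k j x ∂μ = 1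
  left : ∀ j n, ∀ w ∈ B 0 (j + n),
    eLpNorm (fun x => k j (w⁻¹ * x) - k j x) 1 μ ≤ (A * θ ^ (4 * n) : ℝ≥0)
  right : ∀ j n, ∀ w ∈ B 0 (j + n),
    eLpNorm (fun x => k j (x * w⁻¹) - k j x) 1 μ ≤ (A * θ ^ (4 * n) : ℝ≥0)

/-- The family shifted by one scale, with `0` as the coarsest member. -/
def prev (k : ℕ → G → ℂ) : ℕ → G → ℂ
  | 0 => 0
  | j + 1 => k j

/-- The difference kernels `k j - k (j - 1)`, starting with `k 0`. -/
def diff (k : ℕ → G → ℂ) (j : ℕ) : G → ℂ := k j - prev k j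

lemma sum_diff (k : ℕ → G → ℂ) (J : ℕ) : ∑ j ∈ Finset.range (J + 1), diff k j = k J := by
  induction J with
  | zero => simp [diff, prev]
  | succ J ih => rw [Finset.sum_range_succ, ih]; simp [diff, prev]

lemma reflect_diff (k : ℕ → G → ℂ) (j : ℕ) :
    reflect (diff k j) = diff (fun j => reflect (k j)) j := by
  cases j <;> (ext x; simp [reflect, diff, prev])

lemma adj_diff (k : ℕ → G → ℂ) (j : ℕ) : adj (diff k j) = diff (fun j => adj (k j)) j := by
  cases j <;> (ext x; simp [adj, diff, prev])

variable {μ : Measure G} [μ.IsHaarMeasure] [μ.IsMulRightInvariant] [μ.IsInvInvariant]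
  {B : ℕ → ℕ → Set G} {θ A A' : ℝ≥0} {k l : ℕ → G → ℂ} {K L : G → ℂ}

lemma BallSystem.measurableSet (hB : BallSystem μ B) (m j : ℕ) : MeasurableSet (B m j) :=
  (hB.isCompact m j).measurableSet

lemma BallSystem.ne_top (hB : BallSystem μ B) (m j : ℕ) : μ (B m j) ≠ ∞ :=
  (hB.isCompact m j).measure_lt_top.ne

lemma BallSystem.mono' (hB : BallSystem μ B) {m n : ℕ} (h : m ≤ n) (j : ℕ) : B m j ⊆ B n j :=
  monotone_nat_of_le_succ (f := fun m => B m j) (fun m => hB.mono m j) h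

/-- The hypotheses are symmetric under inversion. -/
lemma ApproxId.reflectFamily (hB : BallSystem μ B) (hk : ApproxId μ B θ A k) :
    ApproxId μ B θ A (fun j => reflect (k j)) where
  isKernel j := (hk.isKernel j).reflect
  support j x hx := hk.support j _ fun h => hx (by simpa using hB.inv_mem h)
  size j x := hk.size j _
  integral_eq_one j := by
    rw [← hk.integral_eq_one j]
    exact integral_inv_eq_self (k j) μ
  left j n w hw := by
    rw [← eLpNorm_reflect]
    · refine le_trans (le_of_eq ?_) (hk.right j n _ (hB.inv_mem hw))
      congr 1; ext x; simp [GroupLP.reflect]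
    · have := (hk.isKernel j).reflect.measurable
      exact Measurable.aestronglyMeasurable (by fun_prop)
  right j n w hw := by
    rw [← eLpNorm_reflect]
    · refine le_trans (le_of_eq ?_) (hk.left j n _ (hB.inv_mem hw))
      congr 1; ext x; simp [GroupLP.reflect]
    · have := (hk.isKernel j).reflect.measurable
      exact Measurable.aestronglyMeasurable (by fun_prop)

lemma ApproxId.adjFamily (hB : BallSystem μ B) (hk : ApproxId μ B θ A k) :
    ApproxId μ B θ A (fun j => adj (k j)) where
  isKernel j := (hk.isKernel j).adj
  support j x hx := by
    have h : k j x⁻¹ = 0 := (hk.reflectFamily hB).support j x hx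
    simp [GroupLP.adj, h]
  size j x := by
    have : ‖GroupLP.adj (k j) x‖ₑ = ‖k j x⁻¹‖ₑ := by simp [GroupLP.adj, enorm_eq_nnnorm]
    exact this.trans_le (hk.size j x⁻¹)
  integral_eq_one j := by
    have h := integral_conj (μ := μ) (f := GroupLP.reflect (k j)) (𝕜 := ℂ)
    rw [(hk.reflectFamily hB).integral_eq_one j, map_one] at h
    exact h
  left j n w hw := by
    refine le_trans (le_of_eq (eLpNorm_congr_norm_ae (ae_of_all _ fun x => ?_)))
      ((hk.reflectFamily hB).left j n w hw)
    simp only [GroupLP.adj, GroupLP.reflect]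
    rw [← map_sub, RCLike.norm_conj]
  right j n w hw := by
    refine le_trans (le_of_eq (eLpNorm_congr_norm_ae (ae_of_all _ fun x => ?_)))
      ((hk.reflectFamily hB).right j n w hw)
    simp only [GroupLP.adj, GroupLP.reflect]
    rw [← map_sub, RCLike.norm_conj]

lemma ApproxId.eLpNorm_le (hB : BallSystem μ B) (hk : ApproxId μ B θ A k) (j : ℕ) :
    eLpNorm (k j) 1 μ ≤ A := by
  rw [eLpNorm_one_eq_lintegral_enorm]
  calc _ ≤ ∫⁻ x, (B 0 j).indicator (fun _ => A / μ (B 0 j)) x ∂μ := by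
        refine lintegral_mono fun x => ?_
        by_cases hx : x ∈ B 0 j
        · simpa [hx] using hk.size j x
        · simp [hk.support j x hx]
    _ = A / μ (B 0 j) * μ (B 0 j) := by
        rw [lintegral_indicator (hB.measurableSet 0 j), setLIntegral_const]
    _ = A := ENNReal.div_mul_cancel (hB.pos j) (hB.ne_top 0 j)

lemma ApproxId.isKernel_prev (hk : ApproxId μ B θ A k) (j : ℕ) : IsKernel (prev k j) := by
  cases j with
  | zero => exact IsKernel.zero
  | succ j => exact hk.isKernel j

lemma ApproxId.isKernel_diff (hk : ApproxId μ B θ A k) (j : ℕ) : IsKernel (diff k j) :=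
  (hk.isKernel j).sub (hk.isKernel_prev j)

lemma ApproxId.eLpNorm_prev_le (hB : BallSystem μ B) (hk : ApproxId μ B θ A k) (j : ℕ) :
    eLpNorm (prev k j) 1 μ ≤ A := by
  cases j with
  | zero => simp [prev]
  | succ j => exact hk.eLpNorm_le hB j

lemma ApproxId.eLpNorm_diff_le (hB : BallSystem μ B) (hk : ApproxId μ B θ A k) (j : ℕ) :
    eLpNorm (diff k j) 1 μ ≤ (2 * A : ℝ≥0) := by
  refine (eLpNorm_sub_le ((hk.isKernel j).memLp 1).1 ((hk.isKernel_prev j).memLp 1).1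
    le_rfl).trans ?_
  push_cast
  rw [two_mul]
  exact add_le_add (hk.eLpNorm_le hB j) (hk.eLpNorm_prev_le hB j)

lemma IsKernel.locallyIntegrable (hK : IsKernel K) : LocallyIntegrable K μ :=
  hK.integrable.locallyIntegrable

lemma IsKernel.eLpNorm_conv_le (hK : IsKernel K) (hL : IsKernel L) {a b : ℝ≥0∞}
    (ha : eLpNorm K 1 μ ≤ a) (hb : eLpNorm L 1 μ ≤ b) :
    eLpNorm (GroupLP.conv μ K L) 1 μ ≤ a * b := by
  rw [mul_comm]
  exact (GroupLP.eLpNorm_conv_le le_rfl (by simp) (hK.memLp 1).1 (hL.memLp 1).1).trans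
    (mul_le_mul' hb ha)

/-- Averaging a kernel at a finer scale hardly changes it. -/
lemma ApproxId.conv_sub_self_right (hB : BallSystem μ B) (hk : ApproxId μ B θ A k)
    (hl : ApproxId μ B θ A' l) (j n : ℕ) :
    eLpNorm (conv μ (k j) (l (j + n)) - k j) 1 μ ≤ (A * A' * θ ^ (4 * n) : ℝ≥0) := by
  refine (eLpNorm_conv_sub_self_le le_rfl (by simp) ((hk.isKernel j).memLp 1)
    (hl.isKernel _) (hl.integral_eq_one _) (b := (A * θ ^ (4 * n) : ℝ≥0)) fun y hy => ?_).trans ?_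
  · exact hk.right j n y (by_contra fun h => hy (hl.support _ _ h))
  · calc _ ≤ (A' : ℝ≥0∞) * (A * θ ^ (4 * n) : ℝ≥0) := mul_le_mul' (hl.eLpNorm_le hB _) le_rfl
      _ = _ := by rw [← ENNReal.coe_mul]; congr 1; ring

lemma ApproxId.conv_sub_self_left (hB : BallSystem μ B) (hk : ApproxId μ B θ A k)
    (hl : ApproxId μ B θ A' l) (j n : ℕ) :
    eLpNorm (conv μ (l (j + n)) (k j) - k j) 1 μ ≤ (A * A' * θ ^ (4 * n) : ℝ≥0) := by
  have h := (hk.reflectFamily hB).conv_sub_self_right hB (hl.reflectFamily hB) j n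
  rw [← reflect_conv] at h
  rwa [← eLpNorm_reflect
    ((((hl.isKernel (j + n)).conv (hk.isKernel j) (μ := μ)).sub (hk.isKernel j)).memLp 1).1]

/-- The common constant in the estimates for compositions of difference kernels. -/
noncomputable def diffConst (θ A A' : ℝ≥0) : ℝ≥0 := 4 * (1 + A) * (1 + A') / θ ^ 4

lemma le_diffConst_mul (hθ0 : 0 < θ) (n : ℕ) :
    4 * (1 + A) * (1 + A') * θ ^ (4 * n) = diffConst θ A A' * θ ^ (4 * (n + 1)) := by
  rw [diffConst, mul_add 4 n 1, pow_add]
  field_simp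

/-- The kernel `k j` is almost annihilated by a finer difference kernel, which has mean zero. -/
lemma ApproxId.conv_diff (hB : BallSystem μ B) (hk : ApproxId μ B θ A k)
    (hl : ApproxId μ B θ A' l) (hθ1 : θ ≤ 1) (j n : ℕ) :
    eLpNorm (conv μ (k j) (diff l (j + n + 1))) 1 μ ≤ (2 * A * A' * θ ^ (4 * n) : ℝ≥0) := by
  have hkl : LocallyIntegrable (k j) μ := (hk.isKernel j).locallyIntegrable
  have e : conv μ (k j) (diff l (j + n + 1)) = (conv μ (k j) (l (j + (n + 1))) - k j)
      - (conv μ (k j) (l (j + n)) - k j) := by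
    simp only [diff, prev]
    rw [conv_sub_right hkl (hl.isKernel _) (hl.isKernel _), ← add_assoc]
    abel
  have hm : ∀ i, AEStronglyMeasurable (conv μ (k j) (l i) - k j) μ := fun i =>
    ((((hk.isKernel j).conv (hl.isKernel i) (μ := μ)).sub (hk.isKernel j)).memLp 1).1
  rw [e]
  refine (eLpNorm_sub_le (hm _) (hm _) le_rfl).trans
    ((add_le_add (hk.conv_sub_self_right hB hl j (n + 1))
        (hk.conv_sub_self_right hB hl j n)).trans ?_)
  rw [← ENNReal.coe_add, ENNReal.coe_le_coe]
  have : θ ^ (4 * (n + 1)) ≤ θ ^ (4 * n) := pow_le_pow_of_le_one zero_le hθ1 (by lia)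
  calc _ ≤ A * A' * θ ^ (4 * n) + A * A' * θ ^ (4 * n) := by gcongr
    _ = _ := by ring

lemma two_mul_le_aux (x : ℝ≥0) : 2 * A * A' * x ≤ 4 * (1 + A) * (1 + A') * x := by
  gcongr
  · norm_num
  · exact le_add_self
  · exact le_add_self

lemma ApproxId.conv_prev_diff (hB : BallSystem μ B) (hk : ApproxId μ B θ A k)
    (hl : ApproxId μ B θ A' l) (hθ0 : 0 < θ) (hθ1 : θ ≤ 1) {j m : ℕ} (h : j < m) :
    eLpNorm (conv μ (prev k j) (diff l m)) 1 μ ≤ (diffConst θ A A' * θ ^ (4 * (m - j)) : ℝ≥0) := by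
  cases j with
  | zero =>
    have : conv μ (prev k 0) (diff l m) = 0 := by ext x; simp [conv, prev]
    simp [this]
  | succ j =>
    obtain ⟨n, rfl⟩ : ∃ n, m = j + (n + 1) + 1 := ⟨m - j - 2, by lia⟩
    refine (hk.conv_diff hB hl hθ1 j (n + 1)).trans ?_
    rw [ENNReal.coe_le_coe, show j + (n + 1) + 1 - (j + 1) = n + 1 by lia, ← le_diffConst_mul hθ0]
    refine (two_mul_le_aux _).trans ?_
    exact mul_le_mul_right (pow_le_pow_of_le_one (zero_le) hθ1 (show 4 * n ≤ 4 * (n + 1) by lia)) _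

/-- The cancellation of the finer kernel is played against the smoothness of the coarser one; the
coarsest difference kernel `diff k 0` has no cancellation, and none is needed. -/
lemma ApproxId.conv_diff_diff_of_le (hB : BallSystem μ B) (hk : ApproxId μ B θ A k)
    (hl : ApproxId μ B θ A' l) (hθ0 : 0 < θ) (hθ1 : θ ≤ 1) {j m : ℕ} (h : j ≤ m) :
    eLpNorm (conv μ (diff k j) (diff l m)) 1 μ ≤ (diffConst θ A A' * θ ^ (4 * (m - j)) : ℝ≥0) := by
  rcases h.eq_or_lt with rfl | h
  · refine ((hk.isKernel_diff j).eLpNorm_conv_le (hl.isKernel_diff j)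
      (hk.eLpNorm_diff_le hB j) (hl.eLpNorm_diff_le hB j)).trans ?_
    rw [← ENNReal.coe_mul, ENNReal.coe_le_coe, diffConst]
    simp only [tsub_self, mul_zero, pow_zero, mul_one]
    rw [le_div_iff₀ (by positivity)]
    calc 2 * A * (2 * A') * θ ^ 4 ≤ 2 * (1 + A) * (2 * (1 + A')) * 1 := by
          gcongr
          · exact le_add_self
          · exact le_add_self
          · exact pow_le_one₀ zero_le hθ1
      _ = _ := by ring
  · obtain ⟨n, rfl⟩ : ∃ n, m = j + n + 1 := ⟨m - j - 1, by lia⟩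
    rw [show j + n + 1 - j = n + 1 by lia, ← le_diffConst_mul hθ0]
    have e : conv μ (diff k j) (diff l (j + n + 1)) = conv μ (k j) (diff l (j + n + 1))
        - conv μ (prev k j) (diff l (j + n + 1)) :=
      conv_sub_left (hk.isKernel j).locallyIntegrable (hk.isKernel_prev j).locallyIntegrable
        (hl.isKernel_diff _)
    have h2 : eLpNorm (conv μ (prev k j) (diff l (j + n + 1))) 1 μ
        ≤ (2 * A * A' * θ ^ (4 * n) : ℝ≥0) := by
      cases j with
      | zero =>
        have : conv μ (prev k 0) (diff l (0 + n + 1)) = 0 := by ext x; simp [conv, prev]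
        rw [this]; simp
      | succ j =>
        have := hk.conv_diff hB hl hθ1 j (n + 1)
        rw [show j + 1 + n + 1 = j + (n + 1) + 1 by lia]
        refine this.trans ?_
        rw [ENNReal.coe_le_coe]
        exact mul_le_mul_right (pow_le_pow_of_le_one (zero_le) hθ1
            (show 4 * n ≤ 4 * (n + 1) by lia)) _
    rw [e]
    refine (eLpNorm_sub_le (((hk.isKernel j).conv (hl.isKernel_diff _) (μ := μ)).memLp 1).1
      (((hk.isKernel_prev j).conv (hl.isKernel_diff _) (μ := μ)).memLp 1).1 le_rfl).trans
      ((add_le_add (hk.conv_diff hB hl hθ1 j n) h2).trans ?_)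
    rw [← ENNReal.coe_add, ENNReal.coe_le_coe]
    calc _ = 4 * A * A' * θ ^ (4 * n) := by ring
      _ ≤ _ := by
        gcongr
        · exact le_add_self
        · exact le_add_self

/-- Almost orthogonality of difference kernels of two families adapted to the same balls. -/
lemma ApproxId.conv_diff_diff (hB : BallSystem μ B) (hk : ApproxId μ B θ A k)
    (hl : ApproxId μ B θ A' l) (hθ0 : 0 < θ) (hθ1 : θ ≤ 1) (j m : ℕ) :
    eLpNorm (conv μ (diff k j) (diff l m)) 1 μ
      ≤ (diffConst θ A A' * θ ^ (4 * Nat.dist j m) : ℝ≥0) := by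
  rcases le_total j m with h | h
  · rw [Nat.dist_eq_sub_of_le h]
    exact hk.conv_diff_diff_of_le hB hl hθ0 hθ1 h
  · rw [Nat.dist_eq_sub_of_le_right h]
    have h2 := (hl.reflectFamily hB).conv_diff_diff_of_le hB (hk.reflectFamily hB) hθ0 hθ1 h
    rw [← reflect_diff, ← reflect_diff, ← reflect_conv, eLpNorm_reflect
      (((hk.isKernel_diff j).conv (hl.isKernel_diff m) (μ := μ)).memLp 1).1] at h2
    refine h2.trans_eq ?_
    rw [diffConst, diffConst]
    congr 3
    ring

/-- A difference kernel is reproduced, up to a small error, by averaging at a finer scale. -/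
lemma ApproxId.diff_sub_conv (hB : BallSystem μ B) (hk : ApproxId μ B θ A k)
    (hl : ApproxId μ B θ A' l) (hθ0 : 0 < θ) (hθ1 : θ ≤ 1) {j m : ℕ} (h : m ≤ j) :
    eLpNorm (diff l m - conv μ (prev k j) (diff l m)) 1 μ
      ≤ (diffConst θ A A' * θ ^ (4 * (j - m)) : ℝ≥0) := by
  rcases h.eq_or_lt with rfl | h
  · refine (eLpNorm_sub_le ((hl.isKernel_diff m).memLp 1).1
      (((hk.isKernel_prev m).conv (hl.isKernel_diff m) (μ := μ)).memLp 1).1 le_rfl).trans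
      ((add_le_add (hl.eLpNorm_diff_le hB m) ((hk.isKernel_prev m).eLpNorm_conv_le
        (hl.isKernel_diff m) (hk.eLpNorm_prev_le hB m) (hl.eLpNorm_diff_le hB m))).trans ?_)
    rw [← ENNReal.coe_mul, ← ENNReal.coe_add, ENNReal.coe_le_coe, diffConst]
    simp only [tsub_self, mul_zero, pow_zero, mul_one]
    rw [le_div_iff₀ (by positivity)]
    calc (2 * A' + A * (2 * A')) * θ ^ 4 = 2 * (1 + A) * A' * θ ^ 4 := by ring
      _ ≤ 4 * (1 + A) * (1 + A') * 1 := by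
          gcongr
          · norm_num
          · exact le_add_self
          · exact pow_le_one₀ zero_le hθ1
      _ = _ := by ring
  · obtain ⟨n, rfl⟩ : ∃ n, j = m + n + 1 := ⟨j - m - 1, by lia⟩
    rw [show m + n + 1 - m = n + 1 by lia, ← le_diffConst_mul hθ0]
    have hkk := (hk.isKernel (m + n))
    have hlm := hl.isKernel m
    have hlp := hl.isKernel_prev m
    have e : diff l m - conv μ (prev k (m + n + 1)) (diff l m) =
        (conv μ (k (m + n)) (prev l m) - prev l m) - (conv μ (k (m + n)) (l m) - l m) := by
      simp only [diff]
      rw [conv_sub_right (hk.isKernel_prev _).locallyIntegrable hlm hlp]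
      simp only [prev]
      abel
    have h2 : eLpNorm (conv μ (k (m + n)) (prev l m) - prev l m) 1 μ
        ≤ (A' * A * θ ^ (4 * n) : ℝ≥0) := by
      cases m with
      | zero =>
        have : conv μ (k (0 + n)) (prev l 0) - prev l 0 = 0 := by ext x; simp [conv, prev]
        rw [this]; simp
      | succ m =>
        have := hl.conv_sub_self_left hB hk m (n + 1)
        rw [show m + 1 + n = m + (n + 1) by lia]
        refine this.trans ?_
        rw [ENNReal.coe_le_coe]
        exact mul_le_mul_right (pow_le_pow_of_le_one (zero_le) hθ1
            (show 4 * n ≤ 4 * (n + 1) by lia)) _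
    rw [e]
    refine (eLpNorm_sub_le (((hkk.conv hlp (μ := μ)).sub hlp).memLp 1).1
      (((hkk.conv hlm (μ := μ)).sub hlm).memLp 1).1 le_rfl).trans
      ((add_le_add h2 (hl.conv_sub_self_left hB hk m n)).trans ?_)
    rw [← ENNReal.coe_add, ENNReal.coe_le_coe]
    calc _ = 2 * A * A' * θ ^ (4 * n) := by ring
      _ ≤ _ := two_mul_le_aux _

end Families

/-! ### Multiscale sequences of kernels -/

section Multiscale

variable {G : Type*} [Group G] [TopologicalSpace G] [IsTopologicalGroup G] [T2Space G]
  [SecondCountableTopology G] [LocallyCompactSpace G] [MeasurableSpace G] [BorelSpace G]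

/-- A sequence of kernels `κ m`, with `κ m` living at scale `m` relative to the approximate
identity `k`: composing `κ m` with averaging at a scale `j - 1` gains a factor `θ ^ (m - j)` when
`m > j` (cancellation of `κ m`), and differs from `κ m` by `O(θ ^ (j - m))` when `m ≤ j` (smoothness
of `κ m`). The constant `c` measures the size of the whole sequence. -/
structure Multiscale (μ : Measure G) (B : ℕ → ℕ → Set G) (k : ℕ → G → ℂ) (c θ : ℝ≥0)
    (κ : ℕ → G → ℂ) : Prop where
  isKernel : ∀ m, IsKernel (κ m)
  support : ∀ {j m}, j < m → ∀ x ∉ B 1 j, κ m x = 0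
  far : ∀ {j m}, j < m → eLpNorm (conv μ (prev k j) (κ m)) 1 μ ≤ (c * θ ^ (m - j) : ℝ≥0)
  smooth : ∀ {j m}, m ≤ j →
    eLpNorm (κ m - conv μ (prev k j) (κ m)) 1 μ ≤ (c * θ ^ (j - m) : ℝ≥0)
  orth_right : ∀ j m,
    eLpNorm (conv μ (κ m) (adj (κ j))) 1 μ ≤ ((c * θ ^ Nat.dist j m) ^ 2 : ℝ≥0)
  orth_left : ∀ j m,
    eLpNorm (conv μ (adj (κ m)) (κ j)) 1 μ ≤ ((c * θ ^ Nat.dist j m) ^ 2 : ℝ≥0)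

variable {μ : Measure G} [μ.IsHaarMeasure] [μ.IsMulRightInvariant] [μ.IsInvInvariant]
  {B : ℕ → ℕ → Set G} {θ A A' c : ℝ≥0} {k l κ : ℕ → G → ℂ} {K L : G → ℂ}

/-- The Hörmander type condition satisfied by the sum of a multiscale sequence, uniformly in the
number of terms. -/
lemma Multiscale.lintegral_compl_le (hB : BallSystem μ B) (hk : ApproxId μ B θ A k)
    (hκ : Multiscale μ B k c θ κ) (hθ : θ < 1) (s : Finset ℕ) (j : ℕ) :
    ∫⁻ x in (B 1 j)ᶜ, ‖(∑ m ∈ s, κ m) x - conv μ (prev k j) (∑ m ∈ s, κ m) x‖ₑ ∂μ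
      ≤ (c * (2 / (1 - θ)) : ℝ≥0) := by
  have hp := hk.isKernel_prev j
  have hterm : ∀ m, ∫⁻ x in (B 1 j)ᶜ, ‖κ m x - conv μ (prev k j) (κ m) x‖ₑ ∂μ
      ≤ (c * θ ^ Nat.dist j m : ℝ≥0) := by
    intro m
    -- coarse terms are smooth at scale `j`; fine terms are supported in `B 1 j`, so that only
    -- their averages contribute
    rcases le_or_gt m j with h | h
    · rw [Nat.dist_eq_sub_of_le_right h]
      refine le_trans ?_ (hκ.smooth h)
      rw [eLpNorm_one_eq_lintegral_enorm]
      exact setLIntegral_le_lintegral _ _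
    · rw [Nat.dist_eq_sub_of_le h.le]
      refine le_trans ?_ (hκ.far h)
      rw [eLpNorm_one_eq_lintegral_enorm]
      refine le_trans (le_of_eq ?_) (setLIntegral_le_lintegral (B 1 j)ᶜ _)
      refine setLIntegral_congr_fun (hB.measurableSet 1 j).compl fun x hx => ?_
      simp [hκ.support h x hx]
  calc _ ≤ ∫⁻ x in (B 1 j)ᶜ, ∑ m ∈ s, ‖κ m x - conv μ (prev k j) (κ m) x‖ₑ ∂μ := by
        refine lintegral_mono fun x => ?_
        rw [conv_sum_right s hp.locallyIntegrable fun i _ => hκ.isKernel i, Finset.sum_apply,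
          Finset.sum_apply, ← Finset.sum_sub_distrib]
        exact enorm_sum_le _ _
    _ = ∑ m ∈ s, ∫⁻ x in (B 1 j)ᶜ, ‖κ m x - conv μ (prev k j) (κ m) x‖ₑ ∂μ := by
        refine lintegral_finsetSum' _ fun m _ => ?_
        exact (((hκ.isKernel m).sub
            (hp.conv (hκ.isKernel m) (μ := μ))).measurable.enorm).aemeasurable
    _ ≤ ∑ m ∈ s, ((c * θ ^ Nat.dist j m : ℝ≥0) : ℝ≥0∞) := Finset.sum_le_sum fun m _ => hterm m
    _ ≤ _ := by
        rw [← ENNReal.ofNNReal_finsetSum, ENNReal.coe_le_coe, ← Finset.mul_sum]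
        exact mul_le_mul_right (sum_pow_dist_le hθ s j) c

lemma le_coe_mul_pow_of_le {x : ℝ≥0∞} {C C' : ℝ≥0} (hθ : θ ≤ 1) {a b : ℕ}
    (h : x ≤ (C * θ ^ a : ℝ≥0)) (hC : C ≤ C') (hab : b ≤ a) : x ≤ (C' * θ ^ b : ℝ≥0) := by
  refine h.trans (ENNReal.coe_le_coe.2 ?_)
  exact mul_le_mul' hC (pow_le_pow_of_le_one zero_le hθ hab)

lemma diff_support (hB : BallSystem μ B) (hk : ApproxId μ B θ A k) {j m : ℕ} (h : j < m) {x : G}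
    (hx : x ∉ B 0 j) : diff k m x = 0 := by
  cases m with
  | zero => exact absurd h (Nat.not_lt_zero _)
  | succ m =>
    have h1 : x ∉ B 0 (m + 1) := fun h' => hx (hB.anti 0 h.le h')
    have h2 : x ∉ B 0 m := fun h' => hx (hB.anti 0 (Nat.lt_succ_iff.1 h) h')
    simp [diff, prev, hk.support _ _ h1, hk.support _ _ h2]

lemma conv_support (hB : BallSystem μ B) {j : ℕ} (hK : ∀ x ∉ B 0 j, K x = 0)
    (hL : ∀ x ∉ B 0 j, L x = 0) : ∀ x ∉ B 1 j, conv μ K L x = 0 := by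
  intro x hx
  refine integral_eq_zero_of_ae (ae_of_all _ fun y => ?_)
  by_cases hy : y ∈ B 0 j
  · have : x * y⁻¹ ∉ B 0 j := fun h => hx (by simpa using hB.mul_mem h hy)
    simp [hK _ this]
  · simp [hL _ hy]

/-- A constant dominating all those that occur for products of two difference kernels. -/
noncomputable def prodConst (θ A : ℝ≥0) : ℝ≥0 := (1 + 2 * A) ^ 2 * (1 + diffConst θ A A) ^ 2

lemma one_le_prodConst : 1 ≤ prodConst θ A := by
  refine one_le_mul_of_one_le_of_one_le ?_ ?_ <;> exact one_le_pow₀ le_self_add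

/-- Difference kernels with bounded coefficients form a multiscale sequence. -/
lemma ApproxId.multiscale_diff (hB : BallSystem μ B) (hk : ApproxId μ B θ A k) (hθ0 : 0 < θ)
    (hθ1 : θ < 1) {ε : ℕ → ℂ} (hε : ∀ m, ‖ε m‖ ≤ 1) :
    Multiscale μ B k (prodConst θ A) θ (fun m x => ε m * diff k m x) := by
  have hD : diffConst θ A A ≤ prodConst θ A := by
    calc _ ≤ 1 * (1 + diffConst θ A A) ^ 2 := by
          rw [one_mul]; nlinarith [sq_nonneg (diffConst θ A A), zero_le (a := diffConst θ A A)]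
      _ ≤ _ := by
          rw [prodConst]; gcongr; exact one_le_pow₀ le_self_add
  have hscale : ∀ (c : ℂ), ‖c‖ ≤ 1 → ∀ F : G → ℂ, eLpNorm (fun x => c * F x) 1 μ
      ≤ eLpNorm F 1 μ := fun c hc F => by
    refine eLpNorm_mono fun x => ?_
    rw [norm_mul]
    exact mul_le_of_le_one_left (norm_nonneg _) hc
  have horth : ∀ (x : ℝ≥0∞) (n : ℕ), x ≤ (diffConst θ A A * θ ^ (4 * n) : ℝ≥0) →
      x ≤ ((prodConst θ A * θ ^ n) ^ 2 : ℝ≥0) := by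
    intro x n hx
    rw [mul_pow, ← pow_mul]
    refine le_coe_mul_pow_of_le hθ1.le hx (hD.trans ?_) (by lia)
    exact le_self_pow₀ one_le_prodConst two_ne_zero
  have hadj : ∀ m, adj (fun x => ε m * diff k m x)
      = fun x => (starRingEnd ℂ) (ε m) * diff (fun j => adj (k j)) m x := fun m => by
    rw [← adj_diff]; ext x; simp [adj]
  have hleft : ∀ (c : ℂ) (F H : G → ℂ), conv μ (fun x => c * F x) H
      = fun x => c * conv μ F H x := fun c F H => by
    ext x
    simp only [conv, mul_assoc, integral_const_mul]
  refine ⟨fun m => (hk.isKernel_diff m).const_mul _, fun h x hx => ?_, fun {j m} h => ?_,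
    fun {j m} h => ?_, fun j m => ?_, fun j m => ?_⟩
  · have := diff_support hB hk h fun h' => hx (hB.mono 0 _ h')
    simp [this]
  · rw [conv_const_mul_right]
    refine (hscale _ (hε m) _).trans ?_
    exact le_coe_mul_pow_of_le hθ1.le (hk.conv_prev_diff hB hk hθ0 hθ1.le h) hD (by lia)
  · have : (fun x => ε m * diff k m x) - conv μ (prev k j) (fun x => ε m * diff k m x)
        = fun x => ε m * (diff k m - conv μ (prev k j) (diff k m)) x := by
      rw [conv_const_mul_right]; ext x; simp [mul_sub]
    rw [this]
    refine (hscale _ (hε m) _).trans ?_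
    exact le_coe_mul_pow_of_le hθ1.le (hk.diff_sub_conv hB hk hθ0 hθ1.le h) hD (by lia)
  · rw [hadj, conv_const_mul_right, hleft]
    refine (hscale _ (by simpa using hε j) _).trans ((hscale _ (hε m) _).trans ?_)
    rw [Nat.dist_comm]
    exact horth _ _ (hk.conv_diff_diff hB (hk.adjFamily hB) hθ0 hθ1.le m j)
  · rw [hadj, conv_const_mul_right, hleft]
    refine (hscale _ (hε j) _).trans ((hscale _ (by simpa using hε m) _).trans ?_)
    rw [Nat.dist_comm]
    exact horth _ _ ((hk.adjFamily hB).conv_diff_diff hB hk hθ0 hθ1.le m j)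

/-- The `L¹` norm of a fourfold convolution, with the two inner factors grouped. -/
lemma eLpNorm_conv_conv_le {M N : G → ℂ} (hK : IsKernel K) (hL : IsKernel L) (hM : IsKernel M)
    (hN : IsKernel N) {a b d : ℝ≥0∞} (h1 : eLpNorm K 1 μ ≤ a) (h2 : eLpNorm (conv μ L M) 1 μ ≤ b)
    (h3 : eLpNorm N 1 μ ≤ d) : eLpNorm (conv μ (conv μ K L) (conv μ M N)) 1 μ ≤ a * b * d := by
  rw [← conv_assoc (hK.conv hL).locallyIntegrable hM hN, conv_assoc hK.locallyIntegrable hL hM]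
  exact (hK.conv (hL.conv hM)).eLpNorm_conv_le hN (hK.eLpNorm_conv_le (hL.conv hM) h1 h2) h3

lemma prodConst_bounds :
    diffConst θ A A * (2 * A) ≤ prodConst θ A ∧ (1 + A) * diffConst θ A A ≤ prodConst θ A ∧
    diffConst θ A A * diffConst θ A A ≤ prodConst θ A ∧
    2 * A * diffConst θ A A * (2 * A) ≤ prodConst θ A := by
  unfold prodConst
  generalize diffConst θ A A = D
  have hD : (0 : ℝ) ≤ D := D.2
  have hA : (0 : ℝ) ≤ A := A.2
  have hAD := mul_nonneg hA hD
  have hAD2 := mul_nonneg hA hAD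
  have h3 : 0 ≤ (D : ℝ) * (A * D) := mul_nonneg hD hAD
  have h4 : 0 ≤ ((A : ℝ) * D) ^ 2 := sq_nonneg _
  simp only [← NNReal.coe_le_coe]
  push_cast
  refine ⟨?_, ?_, ?_, ?_⟩ <;> nlinarith [sq_nonneg (D : ℝ), sq_nonneg (A : ℝ)]

/-- The almost orthogonality part for products of two difference kernels. In a product of four,
either the outer pairs are grouped, which gains powers of `θ ^ ℓ`, or the two inner factors, which
gains powers of `θ ^ dist j m`; the better of the two estimates gives both. -/
lemma ApproxId.orth_conv_diff (hB : BallSystem μ B) (hk : ApproxId μ B θ A k)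
    (hθ0 : 0 < θ) (hθ1 : θ < 1) {ℓ : ℕ} {a b : ℕ → ℕ} (hab : ∀ m, Nat.dist (a m) (b m) = ℓ)
    (hb : ∀ j m, Nat.dist (b j) (b m) = Nat.dist j m) (j m : ℕ) :
    eLpNorm (conv μ (conv μ (diff k (a m)) (diff k (b m)))
      (adj (conv μ (diff k (a j)) (diff k (b j))))) 1 μ
      ≤ ((prodConst θ A * θ ^ ℓ * θ ^ Nat.dist j m) ^ 2 : ℝ≥0) := by
  have hd := hk.isKernel_diff
  have hd' := (hk.adjFamily hB).isKernel_diff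
  obtain ⟨-, -, hc3, hc4⟩ := prodConst_bounds (θ := θ) (A := A)
  rw [show (prodConst θ A * θ ^ ℓ * θ ^ Nat.dist j m) ^ 2
    = prodConst θ A ^ 2 * θ ^ (2 * (ℓ + Nat.dist j m)) by
      rw [mul_assoc, ← pow_add, mul_pow, ← pow_mul, mul_comm 2]]
  have hle : prodConst θ A ≤ prodConst θ A ^ 2 := le_self_pow₀ one_le_prodConst two_ne_zero
  rcases le_total (Nat.dist j m) ℓ with h | h
  · refine le_coe_mul_pow_of_le hθ1.le (C := diffConst θ A A * diffConst θ A A) (a := 4 * ℓ + 4 * ℓ)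
      ?_ (hc3.trans hle) (by lia)
    have h1 : ∀ i, eLpNorm (conv μ (diff k (a i)) (diff k (b i))) 1 μ
        ≤ (diffConst θ A A * θ ^ (4 * ℓ) : ℝ≥0) := fun i => by
      have := hk.conv_diff_diff hB hk hθ0 hθ1.le (a i) (b i)
      rwa [hab] at this
    have hij : ∀ i, IsKernel (conv μ (diff k (a i)) (diff k (b i))) := fun i => (hd _).conv (hd _)
    refine ((hij m).eLpNorm_conv_le (hij j).adj (h1 m)
      ((eLpNorm_adj ((hij j).memLp 1).1).trans_le (h1 j))).trans_eq ?_
    rw [← ENNReal.coe_mul]; congr 1; ring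
  · refine le_coe_mul_pow_of_le hθ1.le (C := 2 * A * diffConst θ A A * (2 * A))
      (a := 4 * Nat.dist j m) ?_ (hc4.trans hle) (by lia)
    rw [adj_conv, adj_diff, adj_diff]
    have h2 := hk.conv_diff_diff hB (hk.adjFamily hB) hθ0 hθ1.le (b m) (b j)
    rw [hb, Nat.dist_comm] at h2
    refine (eLpNorm_conv_conv_le (hd _) (hd _) (hd' _) (hd' _) (hk.eLpNorm_diff_le hB _) h2
      ((hk.adjFamily hB).eLpNorm_diff_le hB _)).trans_eq ?_
    rw [← ENNReal.coe_mul, ← ENNReal.coe_mul]; congr 1; ring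

/-- Products of difference kernels at scales `m` and `m + ℓ` form multiscale sequences with a
constant decaying in `ℓ`. -/
lemma ApproxId.multiscale_conv_diff (hB : BallSystem μ B) (hk : ApproxId μ B θ A k) (hθ0 : 0 < θ)
    (hθ1 : θ < 1) {ℓ : ℕ} {a b : ℕ → ℕ}
    (h : (a = fun m => m) ∧ (b = fun m => m + ℓ) ∨ (a = fun m => m + ℓ) ∧ b = fun m => m) :
    Multiscale μ B k (prodConst θ A * θ ^ ℓ) θ (fun m => conv μ (diff k (a m)) (diff k (b m))) := by
  have hd := hk.isKernel_diff
  have hd' := (hk.adjFamily hB).isKernel_diff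
  have hp := hk.isKernel_prev
  obtain ⟨hc1, hc2, hc3, hc4⟩ := prodConst_bounds (θ := θ) (A := A)
  have ham : ∀ m, m ≤ a m := by rcases h with ⟨rfl, rfl⟩ | ⟨rfl, rfl⟩ <;> simp
  have hbm : ∀ m, m ≤ b m := by rcases h with ⟨rfl, rfl⟩ | ⟨rfl, rfl⟩ <;> simp
  have hab : ∀ m, Nat.dist (a m) (b m) = ℓ := by
    rcases h with ⟨rfl, rfl⟩ | ⟨rfl, rfl⟩ <;> simp [Nat.dist]
  have hdb : ∀ j m, Nat.dist (b j) (b m) = Nat.dist j m := by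
    rcases h with ⟨rfl, rfl⟩ | ⟨rfl, rfl⟩ <;>
      first | exact fun _ _ => rfl | exact fun j m => Nat.dist_add_add_right j ℓ m
  have hda : ∀ j m, Nat.dist (a j) (a m) = Nat.dist j m := by
    rcases h with ⟨rfl, rfl⟩ | ⟨rfl, rfl⟩ <;>
      first | exact fun _ _ => rfl | exact fun j m => Nat.dist_add_add_right j ℓ m
  have hcomp : ∀ m, eLpNorm (conv μ (diff k (a m)) (diff k (b m))) 1 μ
      ≤ (diffConst θ A A * θ ^ (4 * ℓ) : ℝ≥0) := fun m => by
    have := hk.conv_diff_diff hB hk hθ0 hθ1.le (a m) (b m)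
    rwa [hab] at this
  have hker : ∀ m, IsKernel (conv μ (diff k (a m)) (diff k (b m))) := fun m => (hd _).conv (hd _)
  refine ⟨hker, fun {j m} hjm => ?_, fun {j m} hjm => ?_, fun {j m} hjm => ?_, fun j m => ?_,
    fun j m => ?_⟩
  · exact conv_support hB
      (fun x hx => diff_support hB hk (hjm.trans_le (ham m)) hx)
      (fun x hx => diff_support hB hk (hjm.trans_le (hbm m)) hx)
  · rw [mul_assoc, ← pow_add]
    rcases le_total ℓ (m - j) with h1 | h1
    · refine le_coe_mul_pow_of_le hθ1.le (C := diffConst θ A A * (2 * A)) (a := 4 * (a m - j))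
        ?_ hc1 (by have := ham m; lia)
      rw [← conv_assoc (hp j).locallyIntegrable (hd _) (hd _)]
      refine (((hp j).conv (hd _)).eLpNorm_conv_le (hd _) (hk.conv_prev_diff hB hk hθ0 hθ1.le
        (hjm.trans_le (ham m))) (hk.eLpNorm_diff_le hB _)).trans_eq ?_
      rw [← ENNReal.coe_mul]; congr 1; ring
    · refine le_coe_mul_pow_of_le hθ1.le (C := (1 + A) * diffConst θ A A) (a := 4 * ℓ)
        ?_ hc2 (by lia)
      refine ((hp j).eLpNorm_conv_le (hker m) (hk.eLpNorm_prev_le hB j) (hcomp m)).trans ?_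
      rw [← ENNReal.coe_mul, ENNReal.coe_le_coe, mul_assoc]
      exact mul_le_mul_left le_add_self _
  · rw [mul_assoc, ← pow_add]
    have hbd : eLpNorm (conv μ (diff k (a m)) (diff k (b m))
        - conv μ (prev k j) (conv μ (diff k (a m)) (diff k (b m)))) 1 μ
        ≤ ((1 + A) * diffConst θ A A * θ ^ (4 * ℓ) : ℝ≥0) := by
      refine (eLpNorm_sub_le ((hker m).memLp 1).1 (((hp j).conv (hker m)).memLp 1).1 le_rfl).trans
        ((add_le_add (hcomp m) ((hp j).eLpNorm_conv_le (hker m) (hk.eLpNorm_prev_le hB j)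
          (hcomp m))).trans_eq ?_)
      rw [← ENNReal.coe_mul, ← ENNReal.coe_add]; congr 1; ring
    -- for `j - m ≥ 2 ℓ` half of the gain in `j - a m` pays for the factor `θ ^ ℓ`
    rcases le_or_gt (2 * ℓ) (j - m) with h1 | h1
    · have haj : a m ≤ j := by rcases h with ⟨rfl, rfl⟩ | ⟨rfl, rfl⟩ <;> (simp only; lia)
      have haj' : a m ≤ m + ℓ := by rcases h with ⟨rfl, rfl⟩ | ⟨rfl, rfl⟩ <;> simp
      refine le_coe_mul_pow_of_le hθ1.le (C := diffConst θ A A * (2 * A)) (a := 4 * (j - a m))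
        ?_ hc1 (by lia)
      have e : conv μ (diff k (a m)) (diff k (b m))
          - conv μ (prev k j) (conv μ (diff k (a m)) (diff k (b m)))
          = conv μ (diff k (a m) - conv μ (prev k j) (diff k (a m))) (diff k (b m)) := by
        rw [conv_sub_left (hd _).locallyIntegrable ((hp j).conv (hd _)).locallyIntegrable (hd _),
          conv_assoc (hp j).locallyIntegrable (hd _) (hd _)]
      rw [e]
      refine (((hd _).sub ((hp j).conv (hd _))).eLpNorm_conv_le (hd _)
        (hk.diff_sub_conv hB hk hθ0 hθ1.le haj) (hk.eLpNorm_diff_le hB _)).trans_eq ?_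
      rw [← ENNReal.coe_mul]; congr 1; ring
    · exact le_coe_mul_pow_of_le hθ1.le hbd hc2 (by lia)
  · exact hk.orth_conv_diff hB hθ0 hθ1 hab hdb j m
  · -- the left version for `k` is the right version for the family of adjoint kernels
    have h5 := (hk.adjFamily hB).orth_conv_diff hB hθ0 hθ1 (a := b) (b := a) (ℓ := ℓ)
      (fun m => by rw [Nat.dist_comm, hab]) hda j m
    have hadj : ∀ i, conv μ (diff (fun j => adj (k j)) (b i)) (diff (fun j => adj (k j)) (a i))
        = adj (conv μ (diff k (a i)) (diff k (b i))) := fun i => by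
      rw [adj_conv, adj_diff, adj_diff]
    rw [hadj, hadj] at h5
    have : ∀ F : G → ℂ, adj (adj F) = F := fun F => by ext x; simp [adj]
    rwa [this] at h5

end Multiscale

/-! ### Real interpolation -/

section Marcinkiewicz

variable {α : Type*} [MeasurableSpace α] {μ : Measure α}

lemma lintegral_indicator_rpow (a : ℝ≥0∞) {q : ℝ} (hq : 0 < q) :
    ∫⁻ t in Set.Ioi (0 : ℝ), (if ENNReal.ofReal t < a then 1 else 0) * ENNReal.ofReal (t ^ (q - 1))
      = ENNReal.ofReal q⁻¹ * a ^ q := by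
  have key : ∀ r : ℝ, 0 ≤ r → ∫⁻ t in Set.Ioi (0 : ℝ),
      (if ENNReal.ofReal t < ENNReal.ofReal r then 1 else 0) * ENNReal.ofReal (t ^ (q - 1))
      = ENNReal.ofReal q⁻¹ * ENNReal.ofReal r ^ q := by
    intro r hr
    have h := lintegral_rpow_eq_lintegral_meas_lt_mul (Measure.dirac ()) (f := fun _ => r)
      (ae_of_all _ fun _ => hr) aemeasurable_const hq
    simp only [lintegral_const, measure_univ, mul_one] at h
    rw [ENNReal.ofReal_rpow_of_nonneg hr hq.le, h, ← mul_assoc, ← ENNReal.ofReal_mul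
        (by positivity),
      inv_mul_cancel₀ hq.ne', ENNReal.ofReal_one, one_mul]
    refine setLIntegral_congr_fun measurableSet_Ioi fun t ht => ?_
    congr 1
    have ht' : 0 < t := ht
    by_cases h1 : t < r
    · simp [h1, (ENNReal.ofReal_lt_ofReal_iff (ht'.trans h1)).2 h1]
    · have : ¬ ENNReal.ofReal t < ENNReal.ofReal r := fun h2 =>
        h1 ((ENNReal.ofReal_lt_ofReal_iff_of_nonneg ht'.le).1 h2)
      simp [h1, this]
  rcases eq_or_ne a ∞ with rfl | ha
  · rw [ENNReal.top_rpow_of_pos hq, ENNReal.mul_top (by simpa using hq)]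
    refine ENNReal.eq_top_of_forall_nnreal_le fun x => ?_
    have h1 := key ((q * x) ^ q⁻¹) (by positivity)
    rw [ENNReal.ofReal_rpow_of_nonneg (by positivity) hq.le, ← Real.rpow_mul (by positivity),
      inv_mul_cancel₀ hq.ne', Real.rpow_one, ← ENNReal.ofReal_mul (by positivity),
      inv_mul_cancel_left₀ hq.ne', ENNReal.ofReal_coe_nnreal] at h1
    rw [← h1]
    refine lintegral_mono fun t => mul_le_mul_left ?_ _
    split_ifs <;> simp_all
  · have := key a.toReal ENNReal.toReal_nonneg
    rwa [ENNReal.ofReal_toReal ha] at this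

lemma measurable_ite_lt {F : α → ℝ≥0∞} (hF : Measurable F) :
    Measurable fun z : α × ℝ => if ENNReal.ofReal z.2 < F z.1 then (1 : ℝ≥0∞) else 0 := by
  refine Measurable.ite (measurableSet_lt ?_ ?_) measurable_const measurable_const
  · exact ENNReal.measurable_ofReal.comp measurable_snd
  · exact hF.comp measurable_fst

/-- The layer cake formula for functions with values in `[0, ∞]`. -/
lemma lintegral_rpow_eq_distribution [SFinite μ] {g : α → ℝ≥0∞} (hg : Measurable g) {q : ℝ}
    (hq : 0 < q) :
    ∫⁻ x, g x ^ q ∂μ = ENNReal.ofReal q *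
      ∫⁻ t in Set.Ioi (0 : ℝ), μ {x | ENNReal.ofReal t < g x} * ENNReal.ofReal (t ^ (q - 1)) := by
  have h1 : ∀ x, g x ^ q = ENNReal.ofReal q * ∫⁻ t in Set.Ioi (0 : ℝ),
      (if ENNReal.ofReal t < g x then 1 else 0) * ENNReal.ofReal (t ^ (q - 1)) := fun x => by
    rw [lintegral_indicator_rpow _ hq, ← mul_assoc, ← ENNReal.ofReal_mul hq.le,
      mul_inv_cancel₀ hq.ne', ENNReal.ofReal_one, one_mul]
  have hm : Measurable fun z : α × ℝ => (if ENNReal.ofReal z.2 < g z.1 then (1 : ℝ≥0∞) else 0)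
      * ENNReal.ofReal (z.2 ^ (q - 1)) := (measurable_ite_lt hg).mul (by fun_prop)
  simp_rw [h1]
  rw [lintegral_const_mul _ hm.lintegral_prod_right', lintegral_lintegral_swap hm.aemeasurable]
  congr 1
  refine lintegral_congr fun t => ?_
  have hm' : Measurable fun x => if ENNReal.ofReal t < g x then (1 : ℝ≥0∞) else 0 :=
    (measurable_ite_lt hg).comp (measurable_id.prodMk measurable_const)
  simp only
  rw [lintegral_mul_const _ hm']
  congr 1
  rw [← lintegral_indicator_one (measurableSet_lt measurable_const hg)]
  exact lintegral_congr fun x => by simp [Set.indicator]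

/-- Integrating the large part of `F` over all levels, by Tonelli. -/
lemma lintegral_tail_upper [SFinite μ] {F : α → ℝ≥0∞} (hF : Measurable F) {q : ℝ} (hq : 1 < q) :
    ∫⁻ t in Set.Ioi (0 : ℝ), (∫⁻ x, (if ENNReal.ofReal t < F x then F x else 0) ∂μ)
      * ENNReal.ofReal (t ^ (q - 2)) = ENNReal.ofReal (q - 1)⁻¹ * ∫⁻ x, F x ^ q ∂μ := by
  have hm : Measurable fun z : ℝ × α => F z.2 * ((if ENNReal.ofReal z.1 < F z.2 then (1 : ℝ≥0∞)
      else 0) * ENNReal.ofReal (z.1 ^ (q - 2))) :=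
    (hF.comp measurable_snd).mul (((measurable_ite_lt hF).comp measurable_swap).mul (by fun_prop))
  calc _ = ∫⁻ t in Set.Ioi (0 : ℝ), ∫⁻ x, F x * ((if ENNReal.ofReal t < F x then (1 : ℝ≥0∞)
      else 0) * ENNReal.ofReal (t ^ (q - 2))) ∂μ := by
        refine lintegral_congr fun t => ?_
        rw [← lintegral_mul_const]
        · refine lintegral_congr fun x => ?_
          split_ifs <;> simp
        · exact Measurable.ite (measurableSet_lt measurable_const hF) hF measurable_const
    _ = ∫⁻ x, F x * (ENNReal.ofReal (q - 1)⁻¹ * F x ^ (q - 1)) ∂μ := by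
        rw [lintegral_lintegral_swap hm.aemeasurable]
        refine lintegral_congr fun x => ?_
        rw [lintegral_const_mul]
        · rw [← lintegral_indicator_rpow _ (show 0 < q - 1 by linarith)]
          ring_nf
        · exact ((measurable_ite_lt hF).comp (measurable_const.prodMk measurable_id)).mul
            (by fun_prop)
    _ = _ := by
        rw [← lintegral_const_mul _ (hF.pow_const q)]
        refine lintegral_congr fun x => ?_
        rw [mul_left_comm]
        congr 1
        nth_rewrite 1 [← ENNReal.rpow_one (F x)]
        rw [← ENNReal.rpow_add_of_nonneg _ _ zero_le_one (by linarith)]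
        congr 1; ring

lemma lintegral_tail_rpow {a : ℝ} (ha : 0 < a) {q : ℝ} (hq : q < 2) :
    ∫⁻ t in Set.Ioi a, ENNReal.ofReal (t ^ (q - 3)) = ENNReal.ofReal ((2 - q)⁻¹ * a ^ (q - 2)) := by
  rw [← ofReal_integral_eq_lintegral_ofReal (integrableOn_Ioi_rpow_of_lt (by linarith) ha),
    integral_Ioi_rpow_of_lt (by linarith) ha]
  · congr 1
    rw [show q - 3 + 1 = -(2 - q) by ring, neg_div_neg_eq, show -(2 - q) = q - 2 by ring,
      div_eq_inv_mul]
  · filter_upwards [ae_restrict_mem measurableSet_Ioi] with t ht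
    exact Real.rpow_nonneg (ha.trans ht).le _

/-- Integrating the square of the small part of `F` over all levels, by Tonelli. -/
lemma lintegral_tail_lower [SFinite μ] {F : α → ℝ≥0∞} (hF : Measurable F) {q : ℝ} (hq0 : 0 < q)
    (hq : q < 2) :
    ∫⁻ t in Set.Ioi (0 : ℝ), (∫⁻ x, (if ENNReal.ofReal t < F x then 0 else F x ^ 2) ∂μ)
      * ENNReal.ofReal (t ^ (q - 3)) ≤ ENNReal.ofReal (2 - q)⁻¹ * ∫⁻ x, F x ^ q ∂μ := by
  have hite : Measurable fun z : ℝ × α => if ENNReal.ofReal z.1 < F z.2 then (0 : ℝ≥0∞)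
      else 1 := Measurable.ite (measurableSet_lt (ENNReal.measurable_ofReal.comp measurable_fst)
        (hF.comp measurable_snd)) measurable_const measurable_const
  have hm : Measurable fun z : ℝ × α => F z.2 ^ 2 * ((if ENNReal.ofReal z.1 < F z.2 then (0 : ℝ≥0∞)
      else 1) * ENNReal.ofReal (z.1 ^ (q - 3))) :=
    ((hF.comp measurable_snd).pow_const 2).mul (hite.mul (by fun_prop))
  calc _ = ∫⁻ t in Set.Ioi (0 : ℝ), ∫⁻ x, F x ^ 2 * ((if ENNReal.ofReal t < F x then (0 : ℝ≥0∞)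
      else 1) * ENNReal.ofReal (t ^ (q - 3))) ∂μ := by
        refine lintegral_congr fun t => ?_
        rw [← lintegral_mul_const]
        · refine lintegral_congr fun x => ?_
          split_ifs <;> simp
        · exact Measurable.ite (measurableSet_lt measurable_const hF) measurable_const
            (hF.pow_const 2)
    _ = ∫⁻ x, F x ^ 2 * (∫⁻ t in Set.Ioi (0 : ℝ), (if ENNReal.ofReal t < F x then (0 : ℝ≥0∞)
      else 1) * ENNReal.ofReal (t ^ (q - 3))) ∂μ := by
        rw [lintegral_lintegral_swap hm.aemeasurable]
        refine lintegral_congr fun x => ?_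
        rw [lintegral_const_mul]
        exact (hite.comp (measurable_id.prodMk measurable_const)).mul (by fun_prop)
    _ ≤ ∫⁻ x, ENNReal.ofReal (2 - q)⁻¹ * F x ^ q ∂μ := by
        refine lintegral_mono fun x => ?_
        rcases eq_or_ne (F x) 0 with h0 | h0
        · simp [h0]
        rcases eq_or_ne (F x) ∞ with h1 | h1
        · simp [h1, ENNReal.top_rpow_of_pos hq0,
            ENNReal.mul_top (show ENNReal.ofReal (2 - q)⁻¹ ≠ 0 by simpa using hq)]
        have ha : 0 < (F x).toReal := ENNReal.toReal_pos h0 h1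
        have hle : ∫⁻ t in Set.Ioi (0 : ℝ), (if ENNReal.ofReal t < F x then (0 : ℝ≥0∞)
            else 1) * ENNReal.ofReal (t ^ (q - 3))
            = ∫⁻ t in Set.Ioi (F x).toReal, ENNReal.ofReal (t ^ (q - 3)) := by
          rw [← setLIntegral_congr (Ioi_ae_eq_Ici (a := (F x).toReal)).symm,
            ← lintegral_indicator measurableSet_Ioi, ← lintegral_indicator measurableSet_Ici]
          refine lintegral_congr fun t => ?_
          by_cases ht : (F x).toReal ≤ t
          · have : ¬ ENNReal.ofReal t < F x := not_lt.2 (ENNReal.le_ofReal_iff_toReal_le h1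
              (ha.le.trans ht) |>.2 ht)
            simp [Set.indicator, ht, this, ha.trans_le ht]
          · have h2 : ENNReal.ofReal t < F x := by
              rcases le_or_gt t 0 with h3 | h3
              · rw [ENNReal.ofReal_of_nonpos h3]; exact pos_iff_ne_zero.2 h0
              · exact (ENNReal.ofReal_lt_iff_lt_toReal h3.le h1).2 (not_le.1 ht)
            simp [Set.indicator, ht, h2]
        rw [hle, lintegral_tail_rpow ha hq, ENNReal.ofReal_mul (inv_nonneg.2 (by linarith)),
          ← ENNReal.ofReal_rpow_of_pos ha, ENNReal.ofReal_toReal h1, mul_left_comm]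
        refine mul_le_mul_right (le_of_eq ?_) _
        rw [← ENNReal.rpow_natCast, ← ENNReal.rpow_add _ _ h0 h1]
        congr 1; push_cast; ring
    _ = _ := lintegral_const_mul _ (hF.pow_const q)

/-- Real interpolation: a distributional estimate that combines a weak type `(1, 1)` bound for the
large part of `F` with a weak type `(2, 2)` bound for its small part yields strong type `(q, q)`
for `1 < q < 2`. When the second bound is absent (`b = 0`) every `q > 1` is allowed. -/
lemma lintegral_rpow_le_of_weak [SFinite μ] {g F : α → ℝ≥0∞} (hg : Measurable g)
    (hF : Measurable F) {a b : ℝ≥0∞} {q : ℝ} (hq1 : 1 < q) (hq2 : b = 0 ∨ q < 2)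
    (h : ∀ t : ℝ, 0 < t → μ {x | ENNReal.ofReal t < g x} ≤
      a * ENNReal.ofReal t⁻¹ * ∫⁻ x, (if ENNReal.ofReal t < F x then F x else 0) ∂μ
      + b * ENNReal.ofReal (t ^ 2)⁻¹ * ∫⁻ x, (if ENNReal.ofReal t < F x then 0 else F x ^ 2) ∂μ) :
    ∫⁻ x, g x ^ q ∂μ ≤ ENNReal.ofReal q * (a * ENNReal.ofReal (q - 1)⁻¹
      + b * ENNReal.ofReal (2 - q)⁻¹) * ∫⁻ x, F x ^ q ∂μ := by
  have hm1 : Measurable fun t : ℝ => ∫⁻ x, (if ENNReal.ofReal t < F x then F x else 0) ∂μ := by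
    refine Measurable.lintegral_prod_right' (f := fun z : ℝ × α =>
      if ENNReal.ofReal z.1 < F z.2 then F z.2 else 0) ?_
    exact Measurable.ite (measurableSet_lt (ENNReal.measurable_ofReal.comp measurable_fst)
      (hF.comp measurable_snd)) (hF.comp measurable_snd) measurable_const
  rw [lintegral_rpow_eq_distribution hg (by linarith), mul_assoc]
  refine mul_le_mul_right ?_ _
  calc _ ≤ ∫⁻ t in Set.Ioi (0 : ℝ),
        (a * ((∫⁻ x, (if ENNReal.ofReal t < F x then F x else 0) ∂μ) * ENNReal.ofReal (t ^ (q - 2)))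
        + b * ((∫⁻ x, (if ENNReal.ofReal t < F x then 0 else F x ^ 2) ∂μ)
          * ENNReal.ofReal (t ^ (q - 3)))) := by
        refine setLIntegral_mono' measurableSet_Ioi fun t ht => ?_
        have ht' : 0 < t := ht
        refine (mul_le_mul_left (h t ht') _).trans (le_of_eq ?_)
        rw [add_mul]
        have e1 : ENNReal.ofReal t⁻¹ * ENNReal.ofReal (t ^ (q - 1)) =
            ENNReal.ofReal (t ^ (q - 2)) := by
          rw [← ENNReal.ofReal_mul (by positivity), ← Real.rpow_neg_one, ← Real.rpow_add ht']
          congr 2; ring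
        have e2 : ENNReal.ofReal (t ^ 2)⁻¹ * ENNReal.ofReal (t ^ (q - 1))
            = ENNReal.ofReal (t ^ (q - 3)) := by
          rw [← ENNReal.ofReal_mul (by positivity), ← Real.rpow_natCast, ← Real.rpow_neg ht'.le,
            ← Real.rpow_add ht']
          congr 2; push_cast; ring
        rw [← e1, ← e2]
        ring
    _ = a * (∫⁻ t in Set.Ioi (0 : ℝ), (∫⁻ x, (if ENNReal.ofReal t < F x then F x else 0) ∂μ)
          * ENNReal.ofReal (t ^ (q - 2)))
        + ∫⁻ t in Set.Ioi (0 : ℝ), b * ((∫⁻ x, (if ENNReal.ofReal t < F x then 0 else F x ^ 2) ∂μ)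
          * ENNReal.ofReal (t ^ (q - 3))) := by
        rw [lintegral_add_left, lintegral_const_mul]
        · exact hm1.mul (by fun_prop)
        · exact (hm1.mul (by fun_prop)).const_mul a
    _ ≤ a * (ENNReal.ofReal (q - 1)⁻¹ * ∫⁻ x, F x ^ q ∂μ)
        + b * (ENNReal.ofReal (2 - q)⁻¹ * ∫⁻ x, F x ^ q ∂μ) := by
        rw [lintegral_tail_upper hF hq1]
        refine add_le_add_right ?_ _
        rcases hq2 with rfl | hq2
        · simp
        · rw [lintegral_const_mul]
          · exact mul_le_mul_right (lintegral_tail_lower hF (by linarith) hq2) _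
          · refine Measurable.mul ?_ (by fun_prop)
            refine Measurable.lintegral_prod_right' (f := fun z : ℝ × α =>
              if ENNReal.ofReal z.1 < F z.2 then 0 else F z.2 ^ 2) ?_
            exact Measurable.ite (measurableSet_lt (ENNReal.measurable_ofReal.comp measurable_fst)
              (hF.comp measurable_snd)) measurable_const ((hF.comp measurable_snd).pow_const 2)
    _ = _ := by ring

end Marcinkiewicz

/-! ### The maximal function -/

section Maximal

variable {G : Type*} [Group G] [TopologicalSpace G] [IsTopologicalGroup G] [T2Space G]
  [SecondCountableTopology G] [LocallyCompactSpace G] [MeasurableSpace G] [BorelSpace G]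
  {μ : Measure G} [μ.IsHaarMeasure] [μ.IsMulRightInvariant] [μ.IsInvInvariant]
  {B : ℕ → ℕ → Set G}

/-- The translated ball `x · B m j`. -/
def ballAt (B : ℕ → ℕ → Set G) (m j : ℕ) (x : G) : Set G := {z | x⁻¹ * z ∈ B m j}

lemma measure_ballAt (m j : ℕ) (x : G) : μ (ballAt B m j x) = μ (B m j) :=
  measure_preimage_mul μ x⁻¹ (B m j)

lemma BallSystem.measurableSet_ballAt (hB : BallSystem μ B) (m j : ℕ) (x : G) :
    MeasurableSet (ballAt B m j x) :=
  (measurable_const_mul x⁻¹) (hB.measurableSet m j)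

lemma BallSystem.measure_pos (hB : BallSystem μ B) (m j : ℕ) : μ (B m j) ≠ 0 := fun h =>
  hB.pos j (measure_mono_null (hB.mono' (Nat.zero_le m) j) h)

/-- The weak type `(1, 1)` inequality for the maximal function over the balls `x · B m j`. Two balls
that meet satisfy: the centre of the smaller one lies in an enlargement of the larger one, so
Vitali's covering argument applies although consecutive scales need not be comparable. -/
lemma BallSystem.weak_maximal (hB : BallSystem μ B) (m : ℕ) : ∃ A : ℝ≥0, ∀ (F : G → ℝ≥0∞)
    (t : ℝ≥0∞), t * μ {x | ∃ j, t * μ (B m j) < ∫⁻ z in ballAt B m j x, F z ∂μ}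
      ≤ A * ∫⁻ z, F z ∂μ := by
  obtain ⟨A, hA⟩ := hB.doubling (m + 1)
  refine ⟨A, fun F t => ?_⟩
  -- Vitali's lemma with size function `2 ^ (-j)`: the factor `3 / 2 < 2` means that every ball
  -- meets a selected ball of the same or of a coarser scale
  let T : Set (G × ℕ) := {a | t * μ (B m a.2) < ∫⁻ z in ballAt B m a.2 a.1, F z ∂μ}
  obtain ⟨u, huT, hdisj, hcov⟩ := Vitali.exists_disjoint_subfamily_covering_enlargement
    (fun a : G × ℕ => ballAt B m a.2 a.1) T (fun a => (1 / 2 : ℝ) ^ a.2) (3 / 2) (by norm_num)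
    (fun a _ => by positivity) 1 (fun a _ => pow_le_one₀ (by norm_num) (by norm_num))
    (fun a _ => ⟨a.1, by simpa [ballAt] using hB.one_mem m a.2⟩)
  have hcount : u.Countable := by
    have h := Measure.countable_meas_pos_of_disjoint_iUnion (μ := μ)
      (As := fun a : u => ballAt B m a.1.2 a.1.1) (fun a => hB.measurableSet_ballAt _ _ _)
      (fun a b hab => hdisj a.2 b.2 (fun h => hab (Subtype.ext h)))
    have huniv : {i : u | 0 < μ (ballAt B m i.1.2 i.1.1)} = Set.univ := by
      ext a
      simpa [measure_ballAt] using pos_iff_ne_zero.2 (hB.measure_pos m a.1.2)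
    rw [huniv] at h
    exact Set.countable_coe_iff.1 (Set.countable_univ_iff.1 h)
  have hsub : {x | ∃ j, t * μ (B m j) < ∫⁻ z in ballAt B m j x, F z ∂μ}
      ⊆ ⋃ a ∈ u, ballAt B (m + 1) a.2 a.1 := by
    rintro x ⟨j, hj⟩
    obtain ⟨b, hbu, ⟨z, hz1, hz2⟩, hδ⟩ := hcov (x, j) hj
    have hjb : b.2 ≤ j := by
      by_contra! hlt
      have h1 : (1 / 2 : ℝ) ^ b.2 ≤ (1 / 2) ^ (j + 1) :=
        pow_le_pow_of_le_one (by norm_num) (by norm_num) hlt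
      have h2 : (0 : ℝ) < (1 / 2) ^ j := by positivity
      rw [pow_succ] at h1
      simp only at hδ
      linarith
    refine Set.mem_biUnion hbu ?_
    have h3 : x⁻¹ * z ∈ B m b.2 := hB.anti m hjb hz1
    have h4 := hB.mul_mem hz2 (hB.inv_mem h3)
    simpa [ballAt, mul_assoc] using h4
  calc t * μ {x | ∃ j, t * μ (B m j) < ∫⁻ z in ballAt B m j x, F z ∂μ}
      ≤ t * ∑' a : u, μ (ballAt B (m + 1) a.1.2 a.1.1) := by
        gcongr
        exact (measure_mono hsub).trans (measure_biUnion_le μ hcount _)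
    _ ≤ ∑' a : u, A * ∫⁻ z in ballAt B m a.1.2 a.1.1, F z ∂μ := by
        rw [← ENNReal.tsum_mul_left]
        refine ENNReal.tsum_le_tsum fun a => ?_
        rw [measure_ballAt]
        calc t * μ (B (m + 1) a.1.2) ≤ t * (A * μ (B m a.1.2)) := by
              gcongr
              exact (hA _).trans (by gcongr; exact hB.mono' (Nat.zero_le m) _)
          _ = A * (t * μ (B m a.1.2)) := by ring
          _ ≤ _ := by
              gcongr
              exact (huT a.2).le
    _ = A * ∫⁻ z in ⋃ a ∈ u, ballAt B m a.2 a.1, F z ∂μ := by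
        rw [ENNReal.tsum_mul_left, lintegral_biUnion hcount
          (fun a _ => hB.measurableSet_ballAt _ _ _) hdisj]
    _ ≤ _ := mul_le_mul_right (setLIntegral_le_lintegral _ _) _

/-- The maximal function of `F` over the balls `x · B m j`. -/
noncomputable def maximal (μ : Measure G) (B : ℕ → ℕ → Set G) (m : ℕ) (F : G → ℝ≥0∞) (x : G) :
    ℝ≥0∞ := ⨆ j, (μ (B m j))⁻¹ * ∫⁻ z in ballAt B m j x, F z ∂μ

lemma BallSystem.measurable_average (hB : BallSystem μ B) (m j : ℕ) {F : G → ℝ≥0∞}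
    (hF : Measurable F) : Measurable fun x => ∫⁻ z in ballAt B m j x, F z ∂μ := by
  have h1 : ∀ x, ∫⁻ z in ballAt B m j x, F z ∂μ
      = ∫⁻ z, (B m j).indicator (fun _ => (1 : ℝ≥0∞)) (x⁻¹ * z) * F z ∂μ := fun x => by
    rw [← lintegral_indicator (hB.measurableSet_ballAt m j x)]
    refine lintegral_congr fun z => ?_
    by_cases hz : x⁻¹ * z ∈ B m j
    · simp [Set.indicator, ballAt, hz]
    · simp [Set.indicator, ballAt, hz]
  simp_rw [h1]
  have h2 : Measurable fun q : G × G =>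
      (B m j).indicator (fun _ => (1 : ℝ≥0∞)) (q.1⁻¹ * q.2) * F q.2 :=
    ((measurable_const.indicator (hB.measurableSet m j)).comp (by fun_prop)).mul (by fun_prop)
  exact h2.lintegral_prod_right'

lemma BallSystem.measurable_maximal (hB : BallSystem μ B) (m : ℕ) {F : G → ℝ≥0∞}
    (hF : Measurable F) : Measurable (maximal μ B m F) :=
  Measurable.iSup fun j => (hB.measurable_average m j hF).const_mul _

lemma BallSystem.lt_maximal_iff (hB : BallSystem μ B) (m : ℕ) (F : G → ℝ≥0∞) (t : ℝ≥0∞) (x : G) :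
    t < maximal μ B m F x ↔ ∃ j, t * μ (B m j) < ∫⁻ z in ballAt B m j x, F z ∂μ := by
  rw [maximal, lt_iSup_iff]
  refine exists_congr fun j => ?_
  rw [mul_comm, ← div_eq_mul_inv, ENNReal.lt_div_iff_mul_lt (Or.inl (hB.measure_pos m j))
    (Or.inl (hB.ne_top m j))]

/-- The maximal function is bounded on `L^q` for `1 < q < ∞`. -/
lemma BallSystem.strong_maximal (hB : BallSystem μ B) (m : ℕ) {q : ℝ} (hq : 1 < q) :
    ∃ C : ℝ≥0, ∀ F : G → ℝ≥0∞, Measurable F →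
      ∫⁻ x, maximal μ B m F x ^ q ∂μ ≤ C * ∫⁻ x, F x ^ q ∂μ := by
  obtain ⟨A, hA⟩ := hB.weak_maximal m
  refine ⟨2 ^ q * (Real.toNNReal q * (A * Real.toNNReal (q - 1)⁻¹)), fun F hF => ?_⟩
  have h := lintegral_rpow_le_of_weak (μ := μ) (g := fun x => 2⁻¹ * maximal μ B m F x) (F := F)
    ((hB.measurable_maximal m hF).const_mul _) hF (a := A) (b := 0) hq (Or.inl rfl) fun t ht => by
      rw [zero_mul, zero_mul, add_zero]
      have ht0 : ENNReal.ofReal t ≠ 0 := by simpa using ht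
      have h1 := hA (fun x => if ENNReal.ofReal t < F x then F x else 0) (ENNReal.ofReal t)
      rw [mul_comm, ← ENNReal.le_div_iff_mul_le (Or.inl ht0) (Or.inl ENNReal.ofReal_ne_top)] at h1
      refine (measure_mono fun x hx => ?_).trans (h1.trans_eq ?_)
      · have hx' : 2 * ENNReal.ofReal t < maximal μ B m F x := by
          have : ENNReal.ofReal t < maximal μ B m F x / 2 := by
            rw [ENNReal.div_eq_inv_mul]; exact hx
          rwa [ENNReal.lt_div_iff_mul_lt (by simp) (by simp), mul_comm] at this
        obtain ⟨j, hj⟩ := (hB.lt_maximal_iff m F _ x).1 hx'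
        refine ⟨j, ?_⟩
        -- the part of `F` below the level `t` contributes at most `t` to an average
        have h2 : ∫⁻ z in ballAt B m j x, F z ∂μ ≤
            (∫⁻ z in ballAt B m j x, (if ENNReal.ofReal t < F z then F z else 0) ∂μ)
              + ENNReal.ofReal t * μ (B m j) := by
          rw [← measure_ballAt m j x, ← setLIntegral_const,
              ← lintegral_add_right _ measurable_const]
          refine lintegral_mono fun z => ?_
          by_cases hz : ENNReal.ofReal t < F z
          · simp [hz]
          · simpa [hz] using not_lt.1 hz
        have h3 := hj.trans_le h2
        rw [two_mul, add_mul] at h3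
        exact (ENNReal.add_lt_add_iff_right
          (ENNReal.mul_ne_top ENNReal.ofReal_ne_top (hB.ne_top m j))).1 h3
      · rw [ENNReal.ofReal_inv_of_pos ht, div_eq_mul_inv]; ring
  simp_rw [ENNReal.mul_rpow_of_nonneg _ _ (show 0 ≤ q by linarith)] at h
  rw [lintegral_const_mul _ ((hB.measurable_maximal m hF).pow_const q), zero_mul, add_zero,
    ENNReal.inv_rpow, ← ENNReal.div_eq_inv_mul,
    ENNReal.div_le_iff_le_mul (Or.inl (by simp)) (Or.inl (by finiteness))] at h
  refine h.trans_eq ?_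
  push_cast
  rw [ENNReal.coe_rpow_of_nonneg _ (by linarith)]
  simp only [ENNReal.ofReal]
  push_cast
  ring

end Maximal

/-! ### Stopping scales and the good part of a function -/

section Weak

variable {G : Type*} [Group G] [TopologicalSpace G] [IsTopologicalGroup G] [T2Space G]
  [SecondCountableTopology G] [LocallyCompactSpace G] [MeasurableSpace G] [BorelSpace G]
  {μ : Measure G} [μ.IsHaarMeasure] [μ.IsMulRightInvariant] [μ.IsInvInvariant]
  {B : ℕ → ℕ → Set G} {θ A : ℝ≥0} {k : ℕ → G → ℂ} {f K : G → ℂ}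

lemma sq_sum_le_two_mul (a : ℕ → ℝ≥0∞) (s : Finset ℕ) :
    (∑ i ∈ s, a i) ^ 2 ≤ 2 * ∑ i ∈ s, a i * ∑ j ∈ s with i ≤ j, a j := by
  have h1 : ∀ i, ∑ j ∈ s, a j ≤ ∑ j ∈ s with i ≤ j, a j + ∑ j ∈ s with j ≤ i, a j := by
    intro i
    rw [← Finset.sum_filter_add_sum_filter_not s (fun j => i ≤ j)]
    refine add_le_add_right (Finset.sum_le_sum_of_subset fun j hj => ?_) _
    simp only [Finset.mem_filter, not_le] at hj ⊢
    exact ⟨hj.1, hj.2.le⟩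
  have h2 : ∑ i ∈ s, a i * ∑ j ∈ s with j ≤ i, a j = ∑ i ∈ s, a i * ∑ j ∈ s with i ≤ j, a j := by
    simp only [Finset.mul_sum, Finset.sum_filter]
    rw [Finset.sum_comm]
    refine Finset.sum_congr rfl fun i _ => Finset.sum_congr rfl fun j _ => ?_
    split_ifs <;> ring
  calc (∑ i ∈ s, a i) ^ 2 = ∑ i ∈ s, a i * ∑ j ∈ s, a j := by rw [sq, Finset.sum_mul]
    _ ≤ ∑ i ∈ s, a i * (∑ j ∈ s with i ≤ j, a j + ∑ j ∈ s with j ≤ i, a j) :=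
        Finset.sum_le_sum fun i _ => mul_le_mul_right (h1 i) _
    _ = _ := by
        simp only [mul_add, Finset.sum_add_distrib]
        rw [h2, two_mul]

lemma sum_indicator_le_self {α : Type*} {E : ℕ → Set α} (hd : Pairwise (Function.onFun Disjoint E))
    {F : α → ℝ≥0∞} (s : Finset ℕ) (w : α) : ∑ j ∈ s, (E j).indicator F w ≤ F w := by
  by_cases hw : ∃ j ∈ s, w ∈ E j
  · obtain ⟨j, hjs, hj⟩ := hw
    rw [Finset.sum_eq_single_of_mem j hjs, Set.indicator_of_mem hj]
    intro i _ hij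
    exact Set.indicator_of_notMem (fun hi => (hd hij).le_bot ⟨hi, hj⟩) _
  · push Not at hw
    rw [Finset.sum_eq_zero fun j hj => Set.indicator_of_notMem (hw j hj) _]
    exact zero_le

/-- The natural majorant of `|prev k j|`, constant on the ball one scale coarser than `j`. -/
noncomputable def majorant (μ : Measure G) (B : ℕ → ℕ → Set G) (A : ℝ≥0) : ℕ → G → ℝ≥0∞
  | 0 => 0
  | j + 1 => (B 0 j).indicator fun _ => A / μ (B 0 j)

lemma BallSystem.measurable_majorant (hB : BallSystem μ B) (j : ℕ) :
    Measurable (majorant μ B A j) := by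
  cases j with
  | zero => exact measurable_const
  | succ j => exact measurable_const.indicator (hB.measurableSet 0 j)

lemma ApproxId.enorm_prev_le (hk : ApproxId μ B θ A k) (j : ℕ) (x : G) :
    ‖prev k j x‖ₑ ≤ majorant μ B A j x := by
  cases j with
  | zero => simp [prev, majorant]
  | succ j =>
    by_cases hx : x ∈ B 0 j
    · simpa [prev, majorant, hx] using hk.size j x
    · simp [prev, majorant, hx, hk.support j x hx]

lemma BallSystem.lintegral_majorant_le (hB : BallSystem μ B) (j : ℕ) :
    ∫⁻ x, majorant μ B A j x ∂μ ≤ A := by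
  cases j with
  | zero => simp [majorant]
  | succ j =>
    simp only [majorant]
    rw [lintegral_indicator (hB.measurableSet 0 j), setLIntegral_const]
    exact (ENNReal.div_mul_cancel (hB.pos j) (hB.ne_top 0 j)).le

/-- The correlation of two majorants is bounded at the coarser scale. -/
lemma BallSystem.lintegral_majorant_mul_le (hB : BallSystem μ B) {i j : ℕ} (hij : i + 1 ≤ j)
    (z w : G) : ∫⁻ x, majorant μ B A (i + 1) (z⁻¹ * x) * majorant μ B A j (w⁻¹ * x) ∂μ
      ≤ A / μ (B 0 i) * A * (ballAt B 1 i z).indicator 1 w := by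
  obtain ⟨j, rfl⟩ : ∃ n, j = n + 1 := ⟨j - 1, by lia⟩
  have hij' : i ≤ j := by lia
  calc _ ≤ ∫⁻ x, (A / μ (B 0 i) * (ballAt B 1 i z).indicator 1 w)
        * majorant μ B A (j + 1) (w⁻¹ * x) ∂μ := by
        refine lintegral_mono fun x => ?_
        by_cases h1 : w⁻¹ * x ∈ B 0 j
        · refine mul_le_mul_left ?_ _
          by_cases h2 : z⁻¹ * x ∈ B 0 i
          · have h3 : w ∈ ballAt B 1 i z := by
              have := hB.mul_mem h2 (hB.inv_mem (hB.anti 0 hij' h1))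
              simpa [ballAt, mul_assoc] using this
            simp [majorant, h2, h3]
          · simp [majorant, h2]
        · simp [majorant, h1]
    _ = A / μ (B 0 i) * (ballAt B 1 i z).indicator 1 w * ∫⁻ x, majorant μ B A (j + 1) x ∂μ := by
        have hm : Measurable fun x => majorant μ B A (j + 1) (w⁻¹ * x) :=
          (hB.measurable_majorant (j + 1)).comp (measurable_const_mul _)
        rw [lintegral_const_mul _ hm,
          lintegral_mul_left_eq_self (fun x => majorant μ B A (j + 1) x) w⁻¹]
    _ ≤ A / μ (B 0 i) * (ballAt B 1 i z).indicator 1 w * A :=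
        mul_le_mul_right (hB.lintegral_majorant_le _) _
    _ = _ := by ring

lemma measurable_lintegral_mul_translate {F h : G → ℝ≥0∞} (hF : Measurable F)
    (hh : Measurable h) : Measurable fun x => ∫⁻ z, F z * h (z⁻¹ * x) ∂μ := by
  have : Measurable fun q : G × G => F q.2 * h (q.2⁻¹ * q.1) := by fun_prop
  exact this.lintegral_prod_right'

/-- The `L²` estimate for the good part: the pieces of `F` on which the averages stop at scale `j`
are spread out at scale `j - 1`, where the averages are still at most `t`. -/
lemma BallSystem.lintegral_sq_sum_le (hB : BallSystem μ B) {A₁ : ℝ≥0}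
    (hA₁ : ∀ j, μ (B 1 j) ≤ A₁ * μ (B 0 j)) {F : G → ℝ≥0∞} (hF : Measurable F) {E : ℕ → Set G}
    (hE : ∀ j, MeasurableSet (E j)) (hd : Pairwise (Function.onFun Disjoint E)) {t : ℝ≥0∞}
    (ht : ∀ j, ∀ z ∈ E (j + 1), ∫⁻ w in ballAt B 1 j z, F w ∂μ ≤ t * μ (B 1 j)) (J : ℕ) :
    ∫⁻ x, (∑ j ∈ Finset.range J, ∫⁻ z, (E j).indicator F z * majorant μ B A j (z⁻¹ * x) ∂μ) ^ 2 ∂μ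
      ≤ 2 * (A * A * A₁ * t) * ∫⁻ z, F z ∂μ := by
  set u : ℕ → G → ℝ≥0∞ := fun j x => ∫⁻ z, (E j).indicator F z * majorant μ B A j (z⁻¹ * x) ∂μ
    with hu
  have hFE : ∀ j, Measurable ((E j).indicator F) := fun j => hF.indicator (hE j)
  have hmaj := fun j => hB.measurable_majorant (A := A) j
  have hum : ∀ j, Measurable (u j) := fun j => measurable_lintegral_mul_translate (hFE j) (hmaj j)
  have hsumE : ∀ (s : Finset ℕ) w, ∑ j ∈ s, (E j).indicator F w ≤ F w :=
    sum_indicator_le_self hd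
  -- a piece stopped at scale `i` against all those stopped at scale `i` or finer: they only see the
  -- mass of `F` in a ball at scale `i - 1`, where the stopping condition did not yet hold
  have hpair : ∀ i, ∫⁻ x, u i x * ∑ j ∈ Finset.range J with i ≤ j, u j x ∂μ
      ≤ (A * A * A₁ * t) * ∫⁻ z, (E i).indicator F z ∂μ := by
    intro i
    cases i with
    | zero => simp [hu, majorant]
    | succ i =>
    set V : G → ℝ≥0∞ := fun x => ∑ j ∈ Finset.range J with i + 1 ≤ j, u j x with hV
    have hVm : Measurable V := Finset.measurable_fun_sum _ fun j _ => hum j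
    have h1 : ∫⁻ x, u (i + 1) x * V x ∂μ = ∫⁻ z, (E (i + 1)).indicator F z *
        ∫⁻ x, majorant μ B A (i + 1) (z⁻¹ * x) * V x ∂μ ∂μ := by
      have hm : Measurable fun q : G × G => (E (i + 1)).indicator F q.2 *
          (majorant μ B A (i + 1) (q.2⁻¹ * q.1) * V q.1) := by
        have := hFE (i + 1)
        have := hmaj (i + 1)
        fun_prop
      have e1 : ∀ x, u (i + 1) x * V x = ∫⁻ z, (E (i + 1)).indicator F z *
          (majorant μ B A (i + 1) (z⁻¹ * x) * V x) ∂μ := fun x => by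
        simp only [hu, ← mul_assoc]
        rw [lintegral_mul_const]
        have := hFE (i + 1)
        have := hmaj (i + 1)
        fun_prop
      simp_rw [e1]
      rw [lintegral_lintegral_swap hm.aemeasurable]
      refine lintegral_congr fun z => ?_
      rw [lintegral_const_mul]
      have := hmaj (i + 1)
      fun_prop
    rw [h1, ← lintegral_const_mul _ (hFE _)]
    refine lintegral_mono fun z => ?_
    by_cases hz : z ∈ E (i + 1)
    swap
    · simp [hz]
    rw [mul_comm]
    refine mul_le_mul_left ?_ _
    calc ∫⁻ x, majorant μ B A (i + 1) (z⁻¹ * x) * V x ∂μ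
        = ∑ j ∈ Finset.range J with i + 1 ≤ j,
            ∫⁻ x, majorant μ B A (i + 1) (z⁻¹ * x) * u j x ∂μ := by
          simp only [hV, Finset.mul_sum]
          refine lintegral_finsetSum _ fun j _ => ?_
          have := hmaj (i + 1)
          have := hum j
          fun_prop
      _ ≤ ∑ j ∈ Finset.range J with i + 1 ≤ j,
            ∫⁻ w, (E j).indicator F w * (A / μ (B 0 i) * A * (ballAt B 1 i z).indicator 1 w) ∂μ :=
                by
          refine Finset.sum_le_sum fun j hj => ?_
          have hm : Measurable fun q : G × G => majorant μ B A (i + 1) (z⁻¹ * q.1) *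
              ((E j).indicator F q.2 * majorant μ B A j (q.2⁻¹ * q.1)) := by
            have := hFE j
            have := hmaj (i + 1)
            have := hmaj j
            fun_prop
          have e1 : ∀ x, majorant μ B A (i + 1) (z⁻¹ * x) * u j x = ∫⁻ w,
              majorant μ B A (i + 1) (z⁻¹ * x) *
              ((E j).indicator F w * majorant μ B A j (w⁻¹ * x)) ∂μ := fun x => by
            simp only [hu]
            rw [lintegral_const_mul]
            have := hFE j
            have := hmaj j
            fun_prop
          simp_rw [e1]
          rw [lintegral_lintegral_swap hm.aemeasurable]
          refine lintegral_mono fun w => ?_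
          simp_rw [mul_left_comm _ ((E j).indicator F w)]
          rw [lintegral_const_mul]
          · exact mul_le_mul_right (hB.lintegral_majorant_mul_le (Finset.mem_filter.1 hj).2 z w) _
          · have := hmaj (i + 1)
            have := hmaj j
            fun_prop
      _ = ∫⁻ w, (∑ j ∈ Finset.range J with i + 1 ≤ j, (E j).indicator F w) *
            (A / μ (B 0 i) * A * (ballAt B 1 i z).indicator 1 w) ∂μ := by
          rw [← lintegral_finsetSum]
          · simp_rw [Finset.sum_mul]
          · intro j _
            exact (hFE j).mul ((measurable_one.indicator
              (hB.measurableSet_ballAt 1 i z)).const_mul _)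
      _ ≤ ∫⁻ w, A / μ (B 0 i) * A * (ballAt B 1 i z).indicator F w ∂μ := by
          refine lintegral_mono fun w => ?_
          by_cases hw : w ∈ ballAt B 1 i z
          · simp only [hw, Set.indicator_of_mem, Pi.one_apply, mul_one]
            rw [mul_comm]
            exact mul_le_mul_right (hsumE _ w) _
          · simp [hw]
      _ = A / μ (B 0 i) * A * ∫⁻ w in ballAt B 1 i z, F w ∂μ := by
          rw [lintegral_const_mul _ (hF.indicator (hB.measurableSet_ballAt 1 i z)),
            lintegral_indicator (hB.measurableSet_ballAt 1 i z)]
      _ ≤ A / μ (B 0 i) * A * (t * (A₁ * μ (B 0 i))) := by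
          gcongr
          exact (ht i z hz).trans (by gcongr; exact hA₁ i)
      _ = (A / μ (B 0 i) * μ (B 0 i)) * A * A₁ * t := by ring
      _ = _ := by rw [ENNReal.div_mul_cancel (hB.pos i) (hB.ne_top 0 i)]
  calc _ ≤ ∫⁻ x, 2 * ∑ i ∈ Finset.range J, u i x * ∑ j ∈ Finset.range J with i ≤ j, u j x ∂μ :=
        lintegral_mono fun x => sq_sum_le_two_mul (fun j => u j x) _
    _ = 2 * ∑ i ∈ Finset.range J, ∫⁻ x, u i x * ∑ j ∈ Finset.range J with i ≤ j, u j x ∂μ := by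
        rw [lintegral_const_mul, lintegral_finsetSum]
        · exact fun i _ => (hum i).mul (Finset.measurable_fun_sum _ fun j _ => hum j)
        · exact Finset.measurable_fun_sum _ fun i _ =>
            (hum i).mul (Finset.measurable_fun_sum _ fun j _ => hum j)
    _ ≤ 2 * ∑ i ∈ Finset.range J, (A * A * A₁ * t) * ∫⁻ z, (E i).indicator F z ∂μ :=
        mul_le_mul_right (Finset.sum_le_sum fun i _ => hpair i) _
    _ = 2 * (A * A * A₁ * t) * ∫⁻ z, ∑ i ∈ Finset.range J, (E i).indicator F z ∂μ := by
        rw [lintegral_finsetSum _ fun i _ => hFE i, ← Finset.mul_sum]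
        ring
    _ ≤ _ := mul_le_mul_right (lintegral_mono fun w => hsumE _ w) _

lemma enorm_conv_le (f K : G → ℂ) (x : G) :
    ‖conv μ f K x‖ₑ ≤ ∫⁻ z, ‖f z‖ₑ * ‖K (z⁻¹ * x)‖ₑ ∂μ := by
  rw [conv_eq_integral_left]
  refine (enorm_integral_le_lintegral_enorm _).trans (le_of_eq ?_)
  simp_rw [enorm_mul]

/-- A function whose averages over all balls are at most `t` is itself at most `t`: the averages
form an approximate identity, and a subsequence converges almost everywhere. -/
lemma BallSystem.ae_le_of_average_le [μ.InnerRegularCompactLTTop] (hB : BallSystem μ B) (m : ℕ)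
    (hf : MemLp f 1 μ) (t : ℝ≥0∞) :
    ∀ᵐ x ∂μ, (∀ j, ∫⁻ z in ballAt B m j x, ‖f z‖ₑ ∂μ ≤ t * μ (B m j)) → ‖f x‖ₑ ≤ t := by
  set f' : G → ℂ := fun x => ((‖f x‖ : ℝ) : ℂ)
  have hf' : MemLp f' 1 μ := memLp_norm_coe hf
  let h : ℕ → G → ℂ := fun j => (B m j).indicator fun _ => (((μ (B m j)).toReal⁻¹ : ℝ) : ℂ)
  have hpos : ∀ j, 0 < (μ (B m j)).toReal := fun j =>
    ENNReal.toReal_pos (hB.measure_pos m j) (hB.ne_top m j)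
  have hker : ∀ j, IsKernel (h j) := fun j => by
    refine ⟨measurable_const.indicator (hB.measurableSet m j), ⟨_, fun x =>
      norm_indicator_le_norm_self _ _⟩, B m j, hB.isCompact m j, fun x hx => by simp [h, hx]⟩
  have hone : ∀ j, ∫ y, h j y ∂μ = 1 := fun j => by
    simp only [h]
    rw [integral_indicator (hB.measurableSet m j), setIntegral_const, Measure.real]
    rw [Complex.real_smul, ← Complex.ofReal_mul, mul_inv_cancel₀ (hpos j).ne', Complex.ofReal_one]
  have henorm : ∀ j x, ‖h j x‖ₑ = (B m j).indicator (fun _ => (μ (B m j))⁻¹) x := fun j x => by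
    by_cases hx : x ∈ B m j
    · simp only [h, hx, Set.indicator_of_mem]
      rw [← ofReal_norm, Complex.norm_real, Real.norm_of_nonneg (inv_nonneg.2 (hpos j).le),
        ENNReal.ofReal_inv_of_pos (hpos j), ENNReal.ofReal_toReal (hB.ne_top m j)]
    · simp [h, hx]
  have hnorm : ∀ j, eLpNorm (h j) 1 μ ≤ (1 : ℝ≥0) := fun j => by
    rw [eLpNorm_one_eq_lintegral_enorm]
    simp_rw [henorm]
    rw [lintegral_indicator (hB.measurableSet m j), setLIntegral_const,
      ENNReal.inv_mul_cancel (hB.measure_pos m j) (hB.ne_top m j), ENNReal.coe_one]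
  have hlim := tendsto_eLpNorm_conv_sub_self le_rfl (by simp) hf' hker hone hnorm fun U hU => by
    filter_upwards [hB.shrink m U hU] with j hj y hy
    exact hj (by_contra fun h' => hy (by simp [h, h']))
  have hlim' := tendstoInMeasure_of_tendsto_eLpNorm one_ne_zero
    (fun j => (memLp_conv le_rfl (by simp) hf' (hker j)).1) hf'.1 hlim
  obtain ⟨ns, -, hns⟩ := hlim'.exists_seq_tendsto_ae
  filter_upwards [hns] with x hx hav
  have h1 : ∀ j, ‖conv μ f' (h j) x‖ₑ ≤ t := fun j => by
    refine (enorm_conv_le _ _ _).trans ?_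
    have e1 : ∀ z, ‖f' z‖ₑ * ‖h j (z⁻¹ * x)‖ₑ
        = (μ (B m j))⁻¹ * (ballAt B m j x).indicator (fun z => ‖f z‖ₑ) z := by
      intro z
      have e2 : ‖f' z‖ₑ = ‖f z‖ₑ := by simp [f', ← ofReal_norm]
      have e3 : z⁻¹ * x ∈ B m j ↔ z ∈ ballAt B m j x := by
        constructor
        · intro hz; have := hB.inv_mem hz; simpa [ballAt] using this
        · intro hz; have := hB.inv_mem hz; simpa using this
      rw [e2, henorm]
      by_cases hz : z ∈ ballAt B m j x
      · rw [Set.indicator_of_mem (e3.2 hz), Set.indicator_of_mem hz, mul_comm]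
      · rw [Set.indicator_of_notMem (fun h' => hz (e3.1 h')), Set.indicator_of_notMem hz]; simp
    simp_rw [e1]
    rw [lintegral_const_mul' _ _ (ENNReal.inv_ne_top.2 (hB.measure_pos m j)),
      lintegral_indicator (hB.measurableSet_ballAt m j x), ← ENNReal.div_eq_inv_mul]
    exact ENNReal.div_le_of_le_mul (hav j)
  have h2 : ‖f' x‖ₑ ≤ t := le_of_tendsto (hx.enorm) (Eventually.of_forall fun i => h1 (ns i))
  simpa [f', ← ofReal_norm] using h2

end Weak

/-! ### The weak type inequality -/

section WeakType

variable {G : Type*} [Group G] [TopologicalSpace G] [IsTopologicalGroup G] [T2Space G]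
  [SecondCountableTopology G] [LocallyCompactSpace G] [MeasurableSpace G] [BorelSpace G]
  {μ : Measure G} [μ.IsHaarMeasure] [μ.IsMulRightInvariant] [μ.IsInvInvariant]
  {B : ℕ → ℕ → Set G} {θ A : ℝ≥0} {k : ℕ → G → ℂ} {f K : G → ℂ}

/-- Chebyshev's inequality for the square, on the half level. -/
lemma mul_measure_half_lt_le_of_sq {α : Type*} [MeasurableSpace α] {ν : Measure α} {u : α → ℝ≥0∞}
    (hu : AEMeasurable u ν) {τ b : ℝ≥0∞} (hτ : τ ≠ 0) (hτ' : τ ≠ ∞)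
    (h : ∫⁻ x, u x ^ 2 ∂ν ≤ b * τ) : τ * ν {x | τ / 2 < u x} ≤ 4 * b := by
  have h1 := mul_meas_ge_le_lintegral₀ (hu.pow_const 2) ((τ / 2) ^ 2)
  have h2 : ν {x | τ / 2 < u x} ≤ ν {x | (τ / 2) ^ 2 ≤ u x ^ 2} :=
    measure_mono fun x (hx : τ / 2 < u x) =>
      pow_le_pow_left' hx.le 2
  have h3 : (τ / 2) ^ 2 * ν {x | τ / 2 < u x} ≤ b * τ :=
    (mul_le_mul_right h2 _).trans (h1.trans h)
  have h4 : τ * (τ * ν {x | τ / 2 < u x}) ≤ τ * (4 * b) := by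
    have e : (τ / 2) ^ 2 * 4 = τ * τ := by
      rw [sq, show (4 : ℝ≥0∞) = 2 * 2 by norm_num,
        show τ / 2 * (τ / 2) * (2 * 2) = (τ / 2 * 2) * (τ / 2 * 2) by ring,
        ENNReal.div_mul_cancel (by simp) (by simp)]
    calc τ * (τ * ν {x | τ / 2 < u x}) = 4 * ((τ / 2) ^ 2 * ν {x | τ / 2 < u x}) := by
          rw [← mul_assoc, ← e]; ring
      _ ≤ 4 * (b * τ) := mul_le_mul_right h3 _
      _ = _ := by ring
  exact (ENNReal.mul_le_mul_iff_right hτ hτ').1 h4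

lemma mul_measure_half_lt_le {α : Type*} [MeasurableSpace α] {ν : Measure α} {u : α → ℝ≥0∞}
    (hu : AEMeasurable u ν) {τ b : ℝ≥0∞}
    (h : ∫⁻ x, u x ∂ν ≤ b) : τ * ν {x | τ / 2 < u x} ≤ 2 * b := by
  have h1 := mul_meas_ge_le_lintegral₀ hu (τ / 2)
  have h2 : ν {x | τ / 2 < u x} ≤ ν {x | τ / 2 ≤ u x} := measure_mono fun x (hx : τ / 2 < u x) =>
      hx.le
  calc τ * ν {x | τ / 2 < u x} = 2 * (τ / 2 * ν {x | τ / 2 < u x}) := by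
        rw [← mul_assoc, ENNReal.mul_div_cancel (by simp) (by simp)]
    _ ≤ 2 * b := mul_le_mul_right ((mul_le_mul_right h2 _).trans (h1.trans h)) _

/-- The bad part: away from the dilated balls only the part of the kernel outside `B 1 j` is
seen. -/
lemma BallSystem.lintegral_conv_compl_le (hB : BallSystem μ B) {M : Set G} {E : Set G}
    (hM : MeasurableSet M) (hE : MeasurableSet E) (j : ℕ)
    (hEM : ∀ z ∈ E, ∀ x, z⁻¹ * x ∈ B 1 j → x ∈ M) {H : G → ℂ} (hH : IsKernel H)
    (hf : Measurable f) (hH1 : ∫⁻ x in (B 1 j)ᶜ, ‖H x‖ₑ ∂μ ≤ 1) :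
    ∫⁻ x in Mᶜ, ‖conv μ (E.indicator f) H x‖ₑ ∂μ ≤ ∫⁻ z, E.indicator (fun z => ‖f z‖ₑ) z ∂μ := by
  have hHm := hH.measurable
  set H' : G → ℝ≥0∞ := (B 1 j)ᶜ.indicator fun x => ‖H x‖ₑ with hH'
  have hH'm : Measurable H' := hHm.enorm.indicator (hB.measurableSet 1 j).compl
  have hFm : Measurable (E.indicator fun z => ‖f z‖ₑ) := hf.enorm.indicator hE
  have hnn : ∀ z, ‖E.indicator f z‖ₑ = E.indicator (fun z => ‖f z‖ₑ) z := fun z => by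
    by_cases hz : z ∈ E <;> simp [hz]
  have h1 : ∀ x ∈ Mᶜ, ‖conv μ (E.indicator f) H x‖ₑ
      ≤ ∫⁻ z, E.indicator (fun z => ‖f z‖ₑ) z * H' (z⁻¹ * x) ∂μ := by
    intro x hx
    refine (enorm_conv_le _ _ _).trans (lintegral_mono fun z => ?_)
    rw [hnn]
    by_cases hz : z ∈ E
    · have : z⁻¹ * x ∈ (B 1 j)ᶜ := fun h => hx (hEM z hz x h)
      rw [hH', Set.indicator_of_mem this]
    · simp [hz]
  calc _ ≤ ∫⁻ x in Mᶜ, ∫⁻ z, E.indicator (fun z => ‖f z‖ₑ) z * H' (z⁻¹ * x) ∂μ ∂μ :=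
        setLIntegral_mono' hM.compl h1
    _ ≤ ∫⁻ x, ∫⁻ z, E.indicator (fun z => ‖f z‖ₑ) z * H' (z⁻¹ * x) ∂μ ∂μ :=
        setLIntegral_le_lintegral _ _
    _ = ∫⁻ z, ∫⁻ x, E.indicator (fun z => ‖f z‖ₑ) z * H' (z⁻¹ * x) ∂μ ∂μ := by
        refine lintegral_lintegral_swap ?_
        have : Measurable fun q : G × G => E.indicator (fun z => ‖f z‖ₑ) q.2 * H' (q.2⁻¹ * q.1) :=
            by
          fun_prop
        exact this.aemeasurable
    _ ≤ ∫⁻ z, E.indicator (fun z => ‖f z‖ₑ) z * 1 ∂μ := by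
        refine lintegral_mono fun z => ?_
        have hm : Measurable fun x => H' (z⁻¹ * x) := by fun_prop
        simp only
        rw [lintegral_const_mul _ hm, lintegral_mul_left_eq_self (fun x => H' x) z⁻¹]
        refine mul_le_mul_right ?_ _
        rwa [hH', lintegral_indicator (hB.measurableSet 1 j).compl]
    _ = _ := by simp

/-- The truncated decomposition: the weak type bound for `f` with the pieces stopped at scales
`≥ J` removed, for a stopping family `E`. -/
lemma exists_weakType_truncated [μ.InnerRegularCompactLTTop] (hB : BallSystem μ B)
    (hk : ApproxId μ B θ A k) : ∃ C : ℝ≥0, ∀ K : G → ℂ, IsKernel K →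
      (∀ f, MemLp f 2 μ → eLpNorm (conv μ f K) 2 μ ≤ eLpNorm f 2 μ) →
      (∀ j, ∫⁻ x in (B 1 j)ᶜ, ‖K x - conv μ (prev k j) K x‖ₑ ∂μ ≤ 1) →
      ∀ f, Measurable f → MemLp f 1 μ → ∀ τ : ℝ≥0∞, τ ≠ 0 → τ ≠ ∞ →
      ∃ E : ℕ → Set G, (∀ j, MeasurableSet (E j)) ∧ Pairwise (Function.onFun Disjoint E) ∧ ∀ J,
        τ * μ {x | τ < ‖conv μ ((⋃ j, E j)ᶜ.indicator f
          + ∑ j ∈ Finset.range J, (E j).indicator f) K x‖ₑ} ≤ C * ∫⁻ x, ‖f x‖ₑ ∂μ := by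
  obtain ⟨A₁, hA₁⟩ := hB.doubling 1
  obtain ⟨A₂, hA₂⟩ := hB.doubling 2
  obtain ⟨Am, hAm⟩ := hB.weak_maximal 2
  refine ⟨4 * (2 + 4 * (A * A * A₁)) + 2 + (A₂ + 1) * Am,
    fun K hK hK2 hK1 f hf hf1 τ hτ hτ' => ?_⟩
  set F : G → ℝ≥0∞ := fun x => ‖f x‖ₑ with hF
  have hFm : Measurable F := hf.enorm
  set N := ∫⁻ x, F x ∂μ with hN
  -- `E j` consists of the points for which `j` is the coarsest scale with a large average. A piece
  -- of `f` on `E j` is replaced by its average at scale `j - 1`; for `j = 0` there is no such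
  -- average and `prev k 0 = 0`, so that the whole of the piece is bad
  set Q : ℕ → Set G := fun j => {x | τ * μ (B 1 j) < ∫⁻ z in ballAt B 1 j x, F z ∂μ} with hQ
  have hQm : ∀ j, MeasurableSet (Q j) := fun j =>
    measurableSet_lt measurable_const (hB.measurable_average 1 j hFm)
  set E := disjointed Q with hE
  have hEm : ∀ j, MeasurableSet (E j) := fun j => .disjointed hQm j
  have hEd : Pairwise (Function.onFun Disjoint E) := disjoint_disjointed Q
  have hEU : ⋃ j, E j = ⋃ j, Q j := iUnion_disjointed
  refine ⟨E, hEm, hEd, fun J => ?_⟩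
  set Ω := ⋃ j, E j with hΩ
  have hΩm : MeasurableSet Ω := .iUnion hEm
  set f0 := Ωᶜ.indicator f with hf0
  have hfi : ∀ s, MeasurableSet s → MemLp (s.indicator f) 1 μ := fun s hs => hf1.indicator hs
  have hloc : ∀ s, MeasurableSet s → LocallyIntegrable (s.indicator f) μ := fun s hs =>
    (hfi s hs).locallyIntegrable le_rfl
  have hp := hk.isKernel_prev
  set H : ℕ → G → ℂ := fun j => K - conv μ (prev k j) K with hH
  have hHk : ∀ j, IsKernel (H j) := fun j => hK.sub ((hp j).conv hK)
  set g : G → ℂ := f0 + ∑ j ∈ Finset.range J, conv μ ((E j).indicator f) (prev k j) with hg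
  have hcl : ∀ j, LocallyIntegrable (conv μ ((E j).indicator f) (prev k j)) μ := fun j =>
    (memLp_conv le_rfl (by simp) (hfi _ (hEm j)) (hp j)).locallyIntegrable le_rfl
  -- the decomposition into a good and a bad part
  have hdec : conv μ (f0 + ∑ j ∈ Finset.range J, (E j).indicator f) K
      = conv μ g K + ∑ j ∈ Finset.range J, conv μ ((E j).indicator f) (H j) := by
    have hl0 := hloc _ hΩm.compl
    rw [hg, conv_add_left hl0 (locallyIntegrable_finsetSum' _ fun j _ => hloc _ (hEm j)) hK,
      conv_add_left hl0 (locallyIntegrable_finsetSum' _ fun j _ => hcl j) hK,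
      conv_sum_left _ (fun j _ => hloc _ (hEm j)) hK, conv_sum_left _ (fun j _ => hcl j) hK,
      add_assoc, ← Finset.sum_add_distrib]
    congr 1
    refine Finset.sum_congr rfl fun j _ => ?_
    rw [hH, conv_sub_right (hloc _ (hEm j)) hK ((hp j).conv hK),
      conv_assoc (hloc _ (hEm j)) (hp j) hK]
    abel
  -- the good part
  have hgm : AEStronglyMeasurable g μ :=
    (hfi _ hΩm.compl).1.add (Finset.aestronglyMeasurable_sum _ fun j _ =>
      aestronglyMeasurable_conv (hfi _ (hEm j)).1 ((hp j).memLp 1).1)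
  have hf0le : ∀ᵐ x ∂μ, ‖f0 x‖ₑ ≤ τ := by
    filter_upwards [hB.ae_le_of_average_le 1 hf1 τ] with x hx
    by_cases hxΩ : x ∈ Ω
    · simp [hf0, hxΩ]
    · rw [hf0, Set.indicator_of_mem (by exact hxΩ)]
      refine hx fun j => not_lt.1 fun h => hxΩ ?_
      rw [hEU]
      exact Set.mem_iUnion.2 ⟨j, h⟩
  have hg2 : ∫⁻ x, ‖g x‖ₑ ^ 2 ∂μ ≤ ((2 + 4 * (A * A * A₁) : ℝ≥0) * N) * τ := by
    set v : G → ℝ≥0∞ := fun x => ∑ j ∈ Finset.range J,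
      ∫⁻ z, (E j).indicator F z * majorant μ B A j (z⁻¹ * x) ∂μ with hv
    have hle : ∀ x, ‖g x‖ₑ ^ 2 ≤ 2 * ‖f0 x‖ₑ ^ 2 + 2 * v x ^ 2 := by
      intro x
      have h1 : ‖g x‖ₑ ≤ ‖f0 x‖ₑ + v x := by
        simp only [hg, Pi.add_apply, Finset.sum_apply]
        refine (enorm_add_le _ _).trans (add_le_add_right ?_ _)
        refine (enorm_sum_le _ _).trans (Finset.sum_le_sum fun j _ => ?_)
        refine (enorm_conv_le _ _ _).trans (lintegral_mono fun z => ?_)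
        by_cases hz : z ∈ E j
        · simpa [hz, hF] using mul_le_mul_right (hk.enorm_prev_le j (z⁻¹ * x)) _
        · simp [hz]
      refine (pow_le_pow_left' h1 2).trans ?_
      rw [← mul_add]
      have := ENNReal.rpow_add_le_mul_rpow_add_rpow ‖f0 x‖ₑ (v x) (p := 2) one_le_two
      norm_num at this
      exact this
    have hf02 : ∫⁻ x, ‖f0 x‖ₑ ^ 2 ∂μ ≤ τ * N := by
      rw [hN, ← lintegral_const_mul _ hFm]
      refine lintegral_mono_ae ?_
      filter_upwards [hf0le] with x hx
      rw [sq]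
      refine mul_le_mul' hx ?_
      simp only [hf0, hF]
      by_cases h : x ∈ Ωᶜ
      · rw [Set.indicator_of_mem h]
      · rw [Set.indicator_of_notMem h]; simp
    have hv2 : ∫⁻ x, v x ^ 2 ∂μ ≤ 2 * (A * A * A₁ * τ) * N := by
      refine hB.lintegral_sq_sum_le hA₁ hFm hEm hEd (fun j z hz => ?_) J
      have : z ∉ Q j := by
        intro h
        have hz' : z ∈ Q (j + 1) \ partialSups Q j := by rwa [← disjointed_add_one]
        exact hz'.2 (le_partialSups Q j h)
      exact not_lt.1 this
    have hf0m : Measurable fun x => 2 * ‖f0 x‖ₑ ^ 2 :=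
      ((hf.indicator hΩm.compl).enorm.pow_const 2).const_mul _
    calc ∫⁻ x, ‖g x‖ₑ ^ 2 ∂μ ≤ ∫⁻ x, 2 * ‖f0 x‖ₑ ^ 2 + 2 * v x ^ 2 ∂μ := lintegral_mono hle
      _ = 2 * ∫⁻ x, ‖f0 x‖ₑ ^ 2 ∂μ + 2 * ∫⁻ x, v x ^ 2 ∂μ := by
          rw [lintegral_add_left hf0m, lintegral_const_mul' _ _ (by simp),
            lintegral_const_mul' _ _ (by simp)]
      _ ≤ 2 * (τ * N) + 2 * (2 * (A * A * A₁ * τ) * N) := by gcongr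
      _ = _ := by push_cast; ring
  have hNtop : N ≠ ∞ := by
    have := hf1.2
    rw [eLpNorm_one_eq_lintegral_enorm] at this
    exact this.ne
  have hgL : MemLp g 2 μ := by
    refine ⟨hgm, ?_⟩
    rw [eLpNorm_lt_top_iff_lintegral_rpow_enorm_lt_top (by simp) (by simp)]
    simp only [ENNReal.toReal_ofNat, ENNReal.rpow_ofNat]
    exact hg2.trans_lt (ENNReal.mul_lt_top
        (ENNReal.mul_lt_top ENNReal.coe_lt_top hNtop.lt_top) hτ'.lt_top)
  have hgood : τ * μ {x | τ / 2 < ‖conv μ g K x‖ₑ} ≤ 4 * ((2 + 4 * (A * A * A₁) : ℝ≥0) * N) := by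
    refine mul_measure_half_lt_le_of_sq (aestronglyMeasurable_conv hgm (hK.memLp 1).1).enorm hτ hτ'
      (le_trans ?_ hg2)
    have := hK2 g hgL
    rw [eLpNorm_eq_lintegral_rpow_enorm_toReal (by simp) (by simp),
      eLpNorm_eq_lintegral_rpow_enorm_toReal (by simp) (by simp),
      ENNReal.rpow_le_rpow_iff (by simp)] at this
    simpa using this
  -- the exceptional set
  set M : Set G := {x | ∃ j, τ / (A₂ + 1 : ℝ≥0) * μ (B 2 j) < ∫⁻ z in ballAt B 2 j x,
      F z ∂μ} with hM
  have hMm : MeasurableSet M := by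
    rw [hM, Set.ofPred_exists]
    exact .iUnion fun j => measurableSet_lt measurable_const (hB.measurable_average 2 j hFm)
  have hMμ : τ * μ M ≤ ((A₂ + 1) * Am : ℝ≥0) * N := by
    have := hAm F (τ / (A₂ + 1 : ℝ≥0))
    calc τ * μ M = (A₂ + 1 : ℝ≥0) * (τ / (A₂ + 1 : ℝ≥0) * μ M) := by
          rw [← mul_assoc, ENNReal.mul_div_cancel (by simp) (by simp)]
      _ ≤ (A₂ + 1 : ℝ≥0) * (Am * N) := mul_le_mul_right this _
      _ = _ := by push_cast; ring
  have hEM : ∀ j, ∀ z ∈ E j, ∀ x, z⁻¹ * x ∈ B 1 j → x ∈ M := by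
    intro j z hz x hx
    have hzQ : z ∈ Q j := disjointed_subset Q j hz
    refine ⟨j, lt_of_le_of_lt ?_ (hzQ.trans_le (lintegral_mono_set fun w hw => ?_))⟩
    · calc τ / (A₂ + 1 : ℝ≥0) * μ (B 2 j) ≤ τ / (A₂ + 1 : ℝ≥0) * ((A₂ + 1 : ℝ≥0) * μ (B 1 j)) := by
            refine mul_le_mul_right ((hA₂ j).trans (mul_le_mul' ?_ (measure_mono (hB.mono 0 j)))) _
            exact_mod_cast le_self_add
        _ = τ * μ (B 1 j) := by
            rw [← mul_assoc, ENNReal.div_mul_cancel (by simp) (by simp)]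
    · have := hB.mul_mem (hB.inv_mem hx) hw
      simpa [ballAt, mul_assoc] using this
  -- the bad part
  set b : G → ℂ := ∑ j ∈ Finset.range J, conv μ ((E j).indicator f) (H j) with hb
  have hbj : ∀ j, AEStronglyMeasurable (conv μ ((E j).indicator f) (H j)) μ := fun j =>
    aestronglyMeasurable_conv (hfi _ (hEm j)).1 ((hHk j).memLp 1).1
  have hbm : AEStronglyMeasurable b μ := Finset.aestronglyMeasurable_sum _ fun j _ => hbj j
  have hb1 : ∫⁻ x in Mᶜ, ‖b x‖ₑ ∂μ ≤ N := by
    calc ∫⁻ x in Mᶜ, ‖b x‖ₑ ∂μ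
        ≤ ∫⁻ x in Mᶜ, ∑ j ∈ Finset.range J, ‖conv μ ((E j).indicator f) (H j) x‖ₑ ∂μ := by
          refine lintegral_mono fun x => ?_
          simp only [hb, Finset.sum_apply]
          exact enorm_sum_le _ _
      _ = ∑ j ∈ Finset.range J, ∫⁻ x in Mᶜ, ‖conv μ ((E j).indicator f) (H j) x‖ₑ ∂μ :=
          lintegral_finsetSum' _ fun j _ => (hbj j).restrict.enorm
      _ ≤ ∑ j ∈ Finset.range J, ∫⁻ z, (E j).indicator F z ∂μ :=
          Finset.sum_le_sum fun j _ => hB.lintegral_conv_compl_le hMm (hEm j) j (hEM j) (hHk j) hf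
            (hK1 j)
      _ = ∫⁻ z, ∑ j ∈ Finset.range J, (E j).indicator F z ∂μ :=
          (lintegral_finsetSum _ fun j _ => hFm.indicator (hEm j)).symm
      _ ≤ N := lintegral_mono fun w => sum_indicator_le_self hEd _ w
  have hbad : τ * μ.restrict Mᶜ {x | τ / 2 < ‖b x‖ₑ} ≤ 2 * N :=
    mul_measure_half_lt_le hbm.restrict.enorm hb1
  have hset : {x | τ < ‖conv μ (f0 + ∑ j ∈ Finset.range J, (E j).indicator f) K x‖ₑ} ⊆
      {x | τ / 2 < ‖conv μ g K x‖ₑ} ∪ ({x | τ / 2 < ‖b x‖ₑ} ∩ Mᶜ ∪ M) := by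
    intro x hx
    simp only [Set.mem_union, Set.mem_inter_iff, Set.mem_compl_iff, Set.mem_ofPred_eq] at hx ⊢
    by_contra! h
    obtain ⟨h1, h2, h3⟩ := h
    have h4 : ‖b x‖ₑ ≤ τ / 2 := not_lt.1 fun h => h3 (h2 h)
    rw [hdec] at hx
    refine hx.not_ge ((enorm_add_le _ _).trans ((add_le_add h1 h4).trans ?_))
    rw [ENNReal.add_halves]
  calc _ ≤ τ * (μ {x | τ / 2 < ‖conv μ g K x‖ₑ} + (μ ({x | τ / 2 < ‖b x‖ₑ} ∩ Mᶜ) + μ M)) := by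
        refine mul_le_mul_right ((measure_mono hset).trans ((measure_union_le _ _).trans ?_)) _
        exact add_le_add_right (measure_union_le _ _) _
    _ = τ * μ {x | τ / 2 < ‖conv μ g K x‖ₑ} + τ * μ.restrict Mᶜ {x | τ / 2 < ‖b x‖ₑ}
        + τ * μ M := by
        rw [Measure.restrict_apply' hMm.compl]; ring
    _ ≤ 4 * ((2 + 4 * (A * A * A₁) : ℝ≥0) * N) + 2 * N + ((A₂ + 1) * Am : ℝ≥0) * N := by
        gcongr
    _ = _ := by push_cast; ring

/-- Weak type `(1,1)` for convolution with kernels bounded on `L²` that satisfy a Hörmander type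
condition relative to the approximate identity. The truncation at scale `J` is removed by dominated
convergence. -/
lemma exists_weakType_conv [μ.InnerRegularCompactLTTop] (hB : BallSystem μ B)
    (hk : ApproxId μ B θ A k) : ∃ C : ℝ≥0, ∀ K : G → ℂ, IsKernel K →
      (∀ f, MemLp f 2 μ → eLpNorm (conv μ f K) 2 μ ≤ eLpNorm f 2 μ) →
      (∀ j, ∫⁻ x in (B 1 j)ᶜ, ‖K x - conv μ (prev k j) K x‖ₑ ∂μ ≤ 1) →
      ∀ f, Measurable f → MemLp f 1 μ → ∀ τ : ℝ≥0∞, τ ≠ 0 → τ ≠ ∞ →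
        τ * μ {x | τ < ‖conv μ f K x‖ₑ} ≤ C * ∫⁻ x, ‖f x‖ₑ ∂μ := by
  obtain ⟨C, hC⟩ := exists_weakType_truncated hB hk
  refine ⟨C, fun K hK hK2 hK1 f hf hf1 τ hτ hτ' => ?_⟩
  obtain ⟨E, hEm, hEd, h⟩ := hC K hK hK2 hK1 f hf hf1 τ hτ hτ'
  set g : ℕ → G → ℂ := fun J => (⋃ j, E j)ᶜ.indicator f
    + ∑ j ∈ Finset.range J, (E j).indicator f with hg
  have hgle : ∀ J x, ‖g J x‖ ≤ ‖f x‖ := by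
    intro J x
    simp only [hg, Pi.add_apply, Finset.sum_apply]
    by_cases hx : ∃ j, x ∈ E j
    · obtain ⟨i, hi⟩ := hx
      have h1 : ∀ j, j ≠ i → (E j).indicator f x = 0 := fun j hj =>
        Set.indicator_of_notMem (fun hj' => (hEd hj).le_bot ⟨hj', hi⟩) _
      rw [Set.indicator_of_notMem (by simpa using ⟨i, hi⟩), zero_add]
      by_cases hiJ : i ∈ Finset.range J
      · rw [Finset.sum_eq_single_of_mem i hiJ fun j _ hj => h1 j hj, Set.indicator_of_mem hi]
      · rw [Finset.sum_eq_zero fun j hj => h1 j fun e => hiJ (e ▸ hj)]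
        simp
    · push Not at hx
      rw [Finset.sum_eq_zero fun j _ => Set.indicator_of_notMem (hx j) _, add_zero]
      exact norm_indicator_le_norm_self _ _
  have hglim : ∀ x, ∀ᶠ J in atTop, g J x = f x := by
    intro x
    simp only [hg, Pi.add_apply, Finset.sum_apply]
    by_cases hx : ∃ j, x ∈ E j
    · obtain ⟨i, hi⟩ := hx
      filter_upwards [eventually_gt_atTop i] with J hJ
      rw [Set.indicator_of_notMem (by simpa using ⟨i, hi⟩), zero_add,
        Finset.sum_eq_single_of_mem i (by simpa using hJ) fun j _ hj =>
          Set.indicator_of_notMem (fun hj' => (hEd hj).le_bot ⟨hj', hi⟩) _,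
        Set.indicator_of_mem hi]
    · push Not at hx
      refine Eventually.of_forall fun J => ?_
      rw [Finset.sum_eq_zero fun j _ => Set.indicator_of_notMem (hx j) _, add_zero,
        Set.indicator_of_mem (by simpa using hx)]
  have hgm : ∀ J, Measurable (g J) := fun J =>
    (hf.indicator (MeasurableSet.iUnion hEm).compl).add
      (Finset.sum_induction _ Measurable (fun _ _ h h' => h.add h') measurable_const
        fun j _ => hf.indicator (hEm j))
  have hlim : ∀ x, Tendsto (fun J => conv μ (g J) K x) atTop (𝓝 (conv μ f K x)) := by
    intro x
    have hloc : LocallyIntegrable f μ := hf1.locallyIntegrable le_rfl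
    refine tendsto_integral_of_dominated_convergence (fun y => ‖f (x * y⁻¹) * K y‖) (fun J => ?_)
      (integrable_conv hloc hK x).norm (fun J => ae_of_all _ fun y => ?_)
      (ae_of_all _ fun y => ?_)
    · have := hgm J
      have := hK.measurable
      exact Measurable.aestronglyMeasurable (by fun_prop)
    · rw [norm_mul, norm_mul]
      exact mul_le_mul_of_nonneg_right (hgle J _) (norm_nonneg _)
    · refine tendsto_const_nhds.congr' ?_
      filter_upwards [hglim (x * y⁻¹)] with J hJ
      rw [hJ]
  set T : ℕ → Set G := fun J => {x | ∀ J', J ≤ J' → τ < ‖conv μ (g J') K x‖ₑ} with hT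
  have hTm : Monotone T := fun J J' hJ x hx i hi => hx i (hJ.trans hi)
  have hsub : {x | τ < ‖conv μ f K x‖ₑ} ⊆ ⋃ J, T J := by
    intro x hx
    have := (hlim x).enorm.eventually (lt_mem_nhds hx)
    obtain ⟨J, hJ⟩ := eventually_atTop.1 this
    exact Set.mem_iUnion.2 ⟨J, hJ⟩
  refine (mul_le_mul_right (measure_mono hsub) τ).trans ?_
  rw [hTm.measure_iUnion, ENNReal.mul_iSup]
  refine iSup_le fun J => (mul_le_mul_right (measure_mono fun x hx => ?_) τ).trans (h J)
  exact hx J le_rfl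

end WeakType

/-! ### Square functions of finite sequences, duality and Khintchine's inequality -/

section FiniteSquare

variable {α : Type*} {s : Finset ℕ} {g h H : ℕ → α → ℂ}

/-- The pointwise `ℓ²` norm of the members of a sequence with index in the finite set `s`. -/
noncomputable def finSq (s : Finset ℕ) (g : ℕ → α → ℂ) (x : α) : ℝ := √(∑ j ∈ s, ‖g j x‖ ^ 2)

lemma finSq_nonneg (x : α) : 0 ≤ finSq s g x := Real.sqrt_nonneg _

lemma sq_finSq (x : α) : finSq s g x ^ 2 = ∑ j ∈ s, ‖g j x‖ ^ 2 :=
  Real.sq_sqrt (Finset.sum_nonneg fun _ _ => by positivity)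

lemma norm_le_finSq {j : ℕ} (hj : j ∈ s) (x : α) : ‖g j x‖ ≤ finSq s g x :=
  Real.le_sqrt_of_sq_le (Finset.single_le_sum (f := fun j => ‖g j x‖ ^ 2)
    (fun _ _ => by positivity) hj)

lemma finSq_le_sum (x : α) : finSq s g x ≤ ∑ j ∈ s, ‖g j x‖ := by
  refine Real.sqrt_le_iff.2 ⟨Finset.sum_nonneg fun _ _ => norm_nonneg _, ?_⟩
  exact Finset.sum_sq_le_sq_sum_of_nonneg fun _ _ => norm_nonneg _

lemma enorm_finSq_sq (x : α) : ‖finSq s g x‖ₑ ^ 2 = ∑ j ∈ s, ‖g j x‖ₑ ^ 2 := by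
  rw [← enorm_pow, sq_finSq, Real.enorm_eq_ofReal (Finset.sum_nonneg fun _ _ => by positivity),
    ENNReal.ofReal_sum_of_nonneg fun _ _ => by positivity]
  refine Finset.sum_congr rfl fun j _ => ?_
  rw [ENNReal.ofReal_pow (norm_nonneg _), ofReal_norm]

lemma finSq_singleton (j : ℕ) (x : α) : finSq {j} g x = ‖g j x‖ := by
  simp [finSq, Real.sqrt_sq]

variable [MeasurableSpace α] {μ : Measure α} {p q : ℝ≥0∞}

lemma aestronglyMeasurable_finSq (hg : ∀ j ∈ s, AEStronglyMeasurable (g j) μ) :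
    AEStronglyMeasurable (finSq s g) μ :=
  Real.continuous_sqrt.comp_aestronglyMeasurable
    (Finset.aestronglyMeasurable_fun_sum _ fun j hj => (hg j hj).norm.pow 2)

lemma memLp_finSq (hg : ∀ j ∈ s, MemLp (g j) p μ) : MemLp (finSq s g) p μ := by
  have h1 : MemLp (fun x => ∑ j ∈ s, ‖g j x‖) p μ := memLp_finsetSum _ fun j hj => (hg j hj).norm
  refine h1.of_le (aestronglyMeasurable_finSq fun j hj => (hg j hj).1) (ae_of_all _ fun x => ?_)
  rw [Real.norm_of_nonneg (finSq_nonneg x)]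
  exact (finSq_le_sum x).trans (le_abs_self _)

lemma MemLp.of_finSq (hg : ∀ j ∈ s, AEStronglyMeasurable (g j) μ) (h : MemLp (finSq s g) p μ)
    {j : ℕ} (hj : j ∈ s) : MemLp (g j) p μ :=
  h.of_le (hg j hj) (ae_of_all _ fun x => by
    rw [Real.norm_of_nonneg (finSq_nonneg x)]; exact norm_le_finSq hj x)

lemma norm_sum_mul_le_finSq (x : α) :
    ‖∑ j ∈ s, H j x * h j x‖ ≤ finSq s H x * finSq s h x := by
  refine (norm_sum_le _ _).trans ?_
  simp_rw [norm_mul]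
  exact Real.sum_mul_le_sqrt_mul_sqrt _ _ _

/-- Hölder's inequality for `ℓ²`-valued functions. -/
lemma enorm_integral_sum_mul_le [p.HolderConjugate q] (hH : ∀ j ∈ s, AEStronglyMeasurable (H j) μ)
    (hh : ∀ j ∈ s, AEStronglyMeasurable (h j) μ) :
    ‖∫ x, ∑ j ∈ s, H j x * h j x ∂μ‖ₑ ≤ eLpNorm (finSq s H) p μ * eLpNorm (finSq s h) q μ := by
  refine (enorm_integral_le_lintegral_enorm _).trans ?_
  have h1 := eLpNorm_smul_le_mul_eLpNorm (p := p) (q := q) (r := 1) (μ := μ)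
    (aestronglyMeasurable_finSq hh) (aestronglyMeasurable_finSq hH)
  rw [eLpNorm_one_eq_lintegral_enorm] at h1
  refine le_trans (lintegral_mono fun x => ?_) h1
  simp only [Pi.smul_apply', smul_eq_mul]
  rw [← ofReal_norm, ← ofReal_norm]
  refine ENNReal.ofReal_le_ofReal ((norm_sum_mul_le_finSq x).trans (le_abs_self _))

lemma toReal_holderConjugate [p.HolderConjugate q] (hp : p ≠ ∞) (hq : q ≠ ∞) :
    p.toReal.HolderConjugate q.toReal := by
  refine ENNReal.HolderConjugate.toReal ?_
  have := (ENNReal.HolderConjugate.lt_top_iff_one_lt q p).1 hq.lt_top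
  simpa using (ENNReal.toReal_lt_toReal (by simp) hp).2 this

/-- The converse of Hölder's inequality for `ℓ²`-valued functions. -/
lemma eLpNorm_finSq_le_of_dual [p.HolderConjugate q] (hp : p ≠ ∞) (hq : q ≠ ∞)
    (hH : ∀ j, MemLp (H j) p μ) {A : ℝ≥0∞}
    (hA : ∀ h : ℕ → α → ℂ, (∀ j, MemLp (h j) q μ) →
      ‖∫ x, ∑ j ∈ s, H j x * h j x ∂μ‖ₑ ≤ A * eLpNorm (finSq s h) q μ) :
    eLpNorm (finSq s H) p μ ≤ A := by
  have hpq := toReal_holderConjugate (p := p) (q := q) hp hq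
  set P := p.toReal with hP
  set Q := q.toReal with hQ
  have hp0 : p ≠ 0 := fun h => hpq.pos.ne' (by simp [hP, h])
  have hq0 : q ≠ 0 := fun h => hpq.symm.pos.ne' (by simp [hQ, h])
  have hφm := aestronglyMeasurable_finSq (s := s) fun j _ => (hH j).1
  have hφL := memLp_finSq (s := s) fun j _ => hH j
  -- the extremal sequence
  set h : ℕ → α → ℂ := fun j x => (starRingEnd ℂ) (s.piecewise H 0 j x)
    * ((finSq s H x ^ (P - 2) : ℝ) : ℂ) with hh
  have hsH : finSq s (s.piecewise H 0) = finSq s H := by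
    ext x
    simp only [finSq]
    congr 1
    exact Finset.sum_congr rfl fun j hj => by simp [hj]
  have hrp : ∀ x, finSq s H x * finSq s H x ^ (P - 2) = finSq s H x ^ (P - 1) := fun x => by
    rcases (finSq_nonneg (s := s) (g := H) x).eq_or_lt with h0 | h0
    · rw [← h0, zero_mul, Real.zero_rpow (sub_ne_zero.2 hpq.lt.ne')]
    · nth_rewrite 1 [← Real.rpow_one (finSq s H x)]
      rw [← Real.rpow_add h0]; ring_nf
  have hrp2 : ∀ x, finSq s H x * finSq s H x ^ (P - 1) = finSq s H x ^ P := fun x => by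
    rcases (finSq_nonneg (s := s) (g := H) x).eq_or_lt with h0 | h0
    · rw [← h0, zero_mul, Real.zero_rpow hpq.pos.ne']
    · nth_rewrite 1 [← Real.rpow_one (finSq s H x)]
      rw [← Real.rpow_add h0]; ring_nf
  have hsh : ∀ x, finSq s h x = finSq s H x ^ (P - 1) := fun x => by
    rw [← hrp, ← hsH, finSq]
    simp only [hh, norm_mul, mul_pow, RCLike.norm_conj, Complex.norm_real, ← Finset.sum_mul]
    rw [Real.sqrt_mul (Finset.sum_nonneg fun _ _ => by positivity), Real.sqrt_sq (norm_nonneg _),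
      Real.norm_of_nonneg (Real.rpow_nonneg (finSq_nonneg x) _)]
    rw [← finSq, hsH]
  have hhm : ∀ j, AEStronglyMeasurable (h j) μ := fun j => by
    refine (Complex.continuous_conj.comp_aestronglyMeasurable ?_).mul
      (Complex.continuous_ofReal.comp_aestronglyMeasurable ?_)
    · by_cases hj : j ∈ s
      · simpa [hj] using (hH j).1
      · simpa [hj] using aestronglyMeasurable_zero
    · exact (hφm.aemeasurable.pow_const _).aestronglyMeasurable
  set I := ∫⁻ x, ‖finSq s H x‖ₑ ^ P ∂μ with hI
  have hIp : eLpNorm (finSq s H) p μ = I ^ (1 / P) :=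
    eLpNorm_eq_lintegral_rpow_enorm_toReal hp0 hp
  have hItop : I ≠ ∞ := ((eLpNorm_lt_top_iff_lintegral_rpow_enorm_lt_top hp0 hp).1 hφL.2).ne
  have hIq : eLpNorm (finSq s h) q μ = I ^ (1 / Q) := by
    rw [eLpNorm_eq_lintegral_rpow_enorm_toReal hq0 hq]
    congr 1
    refine lintegral_congr fun x => ?_
    rw [hsh, Real.enorm_rpow_of_nonneg (finSq_nonneg x) hpq.sub_one_pos.le, ← ENNReal.rpow_mul]
    congr 1
    have := hpq.sub_one_mul_conj
    linarith
  have hL : ∀ j, MemLp (h j) q μ := fun j => by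
    by_cases hj : j ∈ s
    · refine MemLp.of_finSq (fun j _ => hhm j) ⟨aestronglyMeasurable_finSq fun j _ => hhm j, ?_⟩ hj
      rw [hIq]
      exact ENNReal.rpow_lt_top_of_nonneg (by positivity) hItop
    · have : h j = 0 := by ext x; simp [hh, hj]
      rw [this]
      exact MemLp.zero
  have hint : ‖∫ x, ∑ j ∈ s, H j x * h j x ∂μ‖ₑ = I := by
    have e1 : ∀ x, ∑ j ∈ s, H j x * h j x = ((finSq s H x ^ P : ℝ) : ℂ) := fun x => by
      rw [← hrp2, ← hrp, ← mul_assoc, ← sq, sq_finSq]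
      push_cast
      rw [Finset.sum_mul]
      refine Finset.sum_congr rfl fun j hj => ?_
      simp only [hh, Finset.piecewise_eq_of_mem _ _ _ hj]
      rw [← mul_assoc, Complex.mul_conj']
    simp_rw [e1]
    rw [integral_complex_ofReal, ← ofReal_norm, Complex.norm_real,
      Real.norm_of_nonneg (integral_nonneg fun x => Real.rpow_nonneg (finSq_nonneg x) _),
      ofReal_integral_eq_lintegral_ofReal]
    · refine lintegral_congr fun x => ?_
      rw [← Real.enorm_rpow_of_nonneg (finSq_nonneg x) hpq.nonneg, Real.enorm_eq_ofReal]
      exact Real.rpow_nonneg (finSq_nonneg x) _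
    · have := hφL.integrable_norm_rpow hp0 hp
      refine this.congr (ae_of_all _ fun x => ?_)
      simp only [Real.norm_of_nonneg (finSq_nonneg x), hP]
    · exact ae_of_all _ fun x => Real.rpow_nonneg (finSq_nonneg x) _
  have hmain := hA h hL
  rw [hint, hIq] at hmain
  rw [hIp]
  rcases eq_or_ne I 0 with h0 | h0
  · rw [h0, ENNReal.zero_rpow_of_pos (by simpa using hpq.pos)]
    exact zero_le
  have e : I = I ^ (1 / P) * I ^ (1 / Q) := by
    rw [← ENNReal.rpow_add _ _ h0 hItop, one_div, one_div, hpq.inv_add_inv_eq_one,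
      ENNReal.rpow_one]
  have hne : I ^ (1 / Q) ≠ 0 := by simp [h0, hItop]
  have hne' : I ^ (1 / Q) ≠ ∞ := ENNReal.rpow_ne_top_of_nonneg
      (by simpa using hpq.symm.nonneg) hItop
  exact (ENNReal.mul_le_mul_iff_left hne hne').1 (e ▸ hmain)

lemma enorm_integral_mul_le {u v : α → ℂ} [p.HolderConjugate q] (hu : AEStronglyMeasurable u μ)
    (hv : AEStronglyMeasurable v μ) :
    ‖∫ x, u x * v x ∂μ‖ₑ ≤ eLpNorm u p μ * eLpNorm v q μ := by
  have h := enorm_integral_sum_mul_le (s := {0}) (H := fun _ => u) (h := fun _ => v) (p := p)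
    (q := q) (fun _ _ => hu) (fun _ _ => hv)
  simp only [Finset.sum_singleton] at h
  refine h.trans (le_of_eq ?_)
  congr 1 <;> exact eLpNorm_congr_norm_ae (ae_of_all _ fun x => by simp [finSq_singleton])

/-- The converse of Hölder's inequality. -/
lemma eLpNorm_le_of_dual [p.HolderConjugate q] (hp : p ≠ ∞) (hq : q ≠ ∞) {u : α → ℂ}
    (hu : MemLp u p μ) {A : ℝ≥0∞}
    (hA : ∀ v : α → ℂ, MemLp v q μ → ‖∫ x, u x * v x ∂μ‖ₑ ≤ A * eLpNorm v q μ) :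
    eLpNorm u p μ ≤ A := by
  have h := eLpNorm_finSq_le_of_dual (s := {0}) (H := fun _ => u) hp hq (fun _ => hu) (A := A)
    fun h hh => by
      simp only [Finset.sum_singleton]
      refine (hA (h 0) (hh 0)).trans (le_of_eq ?_)
      congr 1
      exact eLpNorm_congr_norm_ae (ae_of_all _ fun x => by simp [finSq_singleton])
  refine le_trans (le_of_eq ?_) h
  exact eLpNorm_congr_norm_ae (ae_of_all _ fun x => by simp [finSq_singleton])

lemma exists_holderConjugate (hp1 : 1 < p) (hp2 : p < ∞) : ∃ q : ℝ≥0∞, p.HolderConjugate q ∧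
    1 < q ∧ q < ∞ ∧ (2 < p → q < 2) ∧ (p < 2 → 2 < q) := by
  obtain ⟨r, rfl⟩ : ∃ r : ℝ≥0, p = r := ⟨p.toNNReal, (ENNReal.coe_toNNReal hp2.ne).symm⟩
  have hr : 1 < r := by exact_mod_cast hp1
  have h := NNReal.HolderConjugate.conjExponent hr
  have h' : ENNReal.HolderConjugate r r.conjExponent := by
    rw [ENNReal.coe_conjExponent hr]; exact .conjExponent hp1.le
  refine ⟨r.conjExponent, h', by exact_mod_cast h.symm.lt, ENNReal.coe_lt_top,
    fun hlt => ?_, fun hlt => ?_⟩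
  all_goals
    have hr' : (1 : ℝ) < r := by exact_mod_cast hr
    have e : ((r.conjExponent : ℝ≥0) : ℝ) = r / (r - 1) := by
      rw [NNReal.conjExponent, NNReal.coe_div, NNReal.coe_sub hr.le]; simp
  · have h2 : (2 : ℝ) < r := by exact_mod_cast hlt
    have : ((r.conjExponent : ℝ≥0) : ℝ) < 2 := by
      rw [e, div_lt_iff₀ (by linarith)]; linarith
    exact_mod_cast this
  · have h2 : (r : ℝ) < 2 := by exact_mod_cast hlt
    have : 2 < ((r.conjExponent : ℝ≥0) : ℝ) := by
      rw [e, lt_div_iff₀ (by linarith)]; linarith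
    exact_mod_cast this

end FiniteSquare

section Khintchine

/-- The random sum with signs `+1` on `t` and `-1` off `t`. -/
noncomputable def signSum (s t : Finset ℕ) (a : ℕ → ℂ) : ℂ :=
  ∑ j ∈ s, (if j ∈ t then 1 else -1) * a j

lemma sum_signSum_insert (f : ℂ → ℝ) {s : Finset ℕ} {i : ℕ} (hi : i ∉ s) (a : ℕ → ℂ) :
    ∑ t ∈ (insert i s).powerset, f (signSum (insert i s) t a)
      = ∑ t ∈ s.powerset, (f (signSum s t a - a i) + f (signSum s t a + a i)) := by
  rw [Finset.sum_powerset_insert hi, ← Finset.sum_add_distrib]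
  refine Finset.sum_congr rfl fun t ht => ?_
  have hit : i ∉ t := fun h => hi (Finset.mem_powerset.1 ht h)
  have h1 : signSum (insert i s) t a = signSum s t a - a i := by
    rw [signSum, Finset.sum_insert hi, signSum]
    simp [hit]; ring
  have h2 : signSum (insert i s) (insert i t) a = signSum s t a + a i := by
    rw [signSum, Finset.sum_insert hi, signSum]
    rw [add_comm]
    congr 1
    · refine Finset.sum_congr rfl fun j hj => ?_
      have : j ≠ i := fun e => hi (e ▸ hj)
      simp [this]
    · simp
  rw [h1, h2]

lemma sum_norm_sq_signSum (s : Finset ℕ) (a : ℕ → ℂ) :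
    ∑ t ∈ s.powerset, ‖signSum s t a‖ ^ 2 = 2 ^ s.card * ∑ j ∈ s, ‖a j‖ ^ 2 := by
  induction s using Finset.induction_on with
  | empty => simp [signSum]
  | insert i s hi ih =>
    rw [sum_signSum_insert (fun z => ‖z‖ ^ 2) hi, Finset.card_insert_of_notMem hi,
      Finset.sum_insert hi]
    have h : ∀ z w : ℂ, ‖z - w‖ ^ 2 + ‖z + w‖ ^ 2 = 2 * ‖z‖ ^ 2 + 2 * ‖w‖ ^ 2 := fun z w => by
      have := parallelogram_law_with_norm ℝ z w
      nlinarith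
    simp_rw [h]
    rw [Finset.sum_add_distrib, ← Finset.mul_sum, ih]
    simp only [Finset.sum_const, Finset.card_powerset, nsmul_eq_mul]
    push_cast
    ring

lemma sum_norm_four_signSum_le (s : Finset ℕ) (a : ℕ → ℂ) :
    ∑ t ∈ s.powerset, ‖signSum s t a‖ ^ 4 ≤ 3 * 2 ^ s.card * (∑ j ∈ s, ‖a j‖ ^ 2) ^ 2 := by
  induction s using Finset.induction_on with
  | empty => simp [signSum]
  | insert i s hi ih =>
    rw [sum_signSum_insert (fun z => ‖z‖ ^ 4) hi, Finset.card_insert_of_notMem hi,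
      Finset.sum_insert hi]
    have h : ∀ z w : ℂ, ‖z - w‖ ^ 4 + ‖z + w‖ ^ 4
        ≤ 2 * ‖z‖ ^ 4 + 12 * ‖w‖ ^ 2 * ‖z‖ ^ 2 + 2 * ‖w‖ ^ 4 := fun z w => by
      have h1 := norm_sub_sq_real z w
      have h2 := norm_add_sq_real z w
      have h3 : (inner ℝ z w) ^ 2 ≤ ‖z‖ ^ 2 * ‖w‖ ^ 2 := by
        rw [← mul_pow, ← sq_abs]
        exact pow_le_pow_left₀ (abs_nonneg _) (abs_real_inner_le_norm z w) 2
      have e1 : ‖z - w‖ ^ 4 = (‖z - w‖ ^ 2) ^ 2 := by ring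
      have e2 : ‖z + w‖ ^ 4 = (‖z + w‖ ^ 2) ^ 2 := by ring
      rw [e1, e2, h1, h2]
      nlinarith
    refine (Finset.sum_le_sum fun t _ => h (signSum s t a) (a i)).trans ?_
    rw [Finset.sum_add_distrib, Finset.sum_add_distrib, ← Finset.mul_sum, ← Finset.mul_sum,
      sum_norm_sq_signSum]
    simp only [Finset.sum_const, Finset.card_powerset, nsmul_eq_mul]
    push_cast
    set σ := ∑ j ∈ s, ‖a j‖ ^ 2
    have h4 : 0 ≤ 2 ^ s.card * ‖a i‖ ^ 4 := by positivity
    rw [pow_succ' 2 s.card]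
    nlinarith

/-- One half of Khintchine's inequality, for every exponent `q > 0`: the `ℓ²` norm is controlled by
the `q`-th moment of the random sums. -/
lemma exists_khintchine {q : ℝ} (hq : 0 < q) : ∃ C : ℝ≥0, ∀ (s : Finset ℕ) (a : ℕ → ℂ),
    (√(∑ j ∈ s, ‖a j‖ ^ 2)) ^ q ≤ C * ((2 ^ s.card)⁻¹ * ∑ t ∈ s.powerset, ‖signSum s t a‖ ^ q) := by
  -- for `l` comparable to the `ℓ²` norm, both regimes of `q` follow from a bound of `X²` by
  -- `X ^ q` plus a term whose mean is half of the mean of `X²`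
  have key : ∃ c : ℝ, 0 < c ∧ ∀ l : ℝ, 0 < l → ∀ X : ℝ, 0 ≤ X →
      X ^ 2 ≤ c * l ^ (2 - q) * X ^ q + (l ^ 2 / 4 + X ^ 4 / (12 * l ^ 2)) := by
    have hX2 : ∀ X : ℝ, 0 < X → X ^ 2 = X ^ (2 - q) * X ^ q := fun X hX => by
      rw [← Real.rpow_add hX]; norm_num
    rcases le_total 2 q with h2 | h2
    · refine ⟨(1 / 2) ^ (2 - q), by positivity, fun l hl X hX => ?_⟩
      rcases le_total X (l / 2) with h | h
      · have : X ^ 2 ≤ l ^ 2 / 4 := by nlinarith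
        have : 0 ≤ (1 / 2 : ℝ) ^ (2 - q) * l ^ (2 - q) * X ^ q + X ^ 4 / (12 * l ^ 2) := by
          positivity
        linarith
      · have hX0 : 0 < X := by linarith
        have : X ^ 2 ≤ (1 / 2 : ℝ) ^ (2 - q) * l ^ (2 - q) * X ^ q := by
          rw [hX2 X hX0, ← Real.mul_rpow (by norm_num) hl.le]
          refine mul_le_mul_of_nonneg_right ?_ (by positivity)
          exact Real.rpow_le_rpow_of_nonpos (by positivity) (by linarith) (by linarith)
        have : 0 ≤ l ^ 2 / 4 + X ^ 4 / (12 * l ^ 2) := by positivity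
        linarith
    · refine ⟨4 ^ (2 - q), by positivity, fun l hl X hX => ?_⟩
      rcases le_total X (4 * l) with h | h
      · rcases hX.eq_or_lt with rfl | hX0
        · rw [zero_pow two_ne_zero]
          positivity
        have : X ^ 2 ≤ (4 : ℝ) ^ (2 - q) * l ^ (2 - q) * X ^ q := by
          rw [hX2 X hX0, ← Real.mul_rpow (by norm_num) hl.le]
          refine mul_le_mul_of_nonneg_right ?_ (by positivity)
          exact Real.rpow_le_rpow hX h (by linarith)
        have : 0 ≤ l ^ 2 / 4 + X ^ 4 / (12 * l ^ 2) := by positivity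
        linarith
      · have : X ^ 2 ≤ X ^ 4 / (12 * l ^ 2) := by
          rw [le_div_iff₀ (by positivity)]
          have : 12 * l ^ 2 ≤ X ^ 2 := by nlinarith
          nlinarith [sq_nonneg X]
        have : 0 ≤ (4 : ℝ) ^ (2 - q) * l ^ (2 - q) * X ^ q + l ^ 2 / 4 := by positivity
        linarith
  obtain ⟨c, hc, key⟩ := key
  refine ⟨Real.toNNReal (2 * c), fun s a => ?_⟩
  set σ := √(∑ j ∈ s, ‖a j‖ ^ 2) with hσ
  have hσ2 : σ ^ 2 = ∑ j ∈ s, ‖a j‖ ^ 2 := Real.sq_sqrt (Finset.sum_nonneg fun _ _ => by positivity)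
  rw [Real.coe_toNNReal _ (by positivity)]
  rcases (Real.sqrt_nonneg (∑ j ∈ s, ‖a j‖ ^ 2)).eq_or_lt with h0 | h0
  · rw [hσ, ← h0, Real.zero_rpow hq.ne']
    positivity
  rw [← hσ] at h0
  set n : ℝ := 2 ^ s.card with hn
  have hn0 : 0 < n := by positivity
  set m := ∑ t ∈ s.powerset, ‖signSum s t a‖ ^ q
  have h1 : n * σ ^ 2 ≤ c * σ ^ (2 - q) * m + (n * (σ ^ 2 / 4) + 3 * n * (σ ^ 2) ^ 2 /
      (12 * σ ^ 2)) := by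
    have h2 := Finset.sum_le_sum (s := s.powerset) fun t _ =>
      key σ h0 ‖signSum s t a‖ (norm_nonneg _)
    rw [sum_norm_sq_signSum, ← hσ2, Finset.sum_add_distrib, ← Finset.mul_sum,
      Finset.sum_add_distrib] at h2
    simp only [Finset.sum_const, Finset.card_powerset, nsmul_eq_mul] at h2
    push_cast at h2
    refine h2.trans ?_
    have := sum_norm_four_signSum_le s a
    rw [← hσ2] at this
    rw [← Finset.sum_div]
    gcongr
  have h3 : σ ^ 2 = σ ^ (2 - q) * σ ^ q := by
    rw [← Real.rpow_add h0]; norm_num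
  have h4 : 0 < σ ^ (2 - q) := Real.rpow_pos_of_pos h0 _
  have h5 : 3 * n * (σ ^ 2) ^ 2 / (12 * σ ^ 2) = n * σ ^ 2 / 4 := by field_simp; norm_num
  have h6 : σ ^ (2 - q) * (n * σ ^ q) ≤ σ ^ (2 - q) * (2 * c * m) := by
    rw [h5] at h1
    have : n * σ ^ 2 = σ ^ (2 - q) * (n * σ ^ q) := by rw [h3]; ring
    nlinarith
  have h7 := le_of_mul_le_mul_left h6 h4
  calc σ ^ q = n⁻¹ * (n * σ ^ q) := by field_simp
    _ ≤ n⁻¹ * (2 * c * m) := by gcongr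
    _ = _ := by ring

end Khintchine

/-! ### Bounds on `L^p` -/

section StrongType

lemma eLpNorm_le_of_lintegral_rpow_le {α E F : Type*} [MeasurableSpace α] {μ : Measure α}
    [NormedAddCommGroup E] [NormedAddCommGroup F] {u : α → E} {v : α → F} {p : ℝ≥0∞} (hp0 : p ≠ 0)
    (hp : p ≠ ∞) {C : ℝ≥0∞}
    (h : ∫⁻ x, ‖u x‖ₑ ^ p.toReal ∂μ ≤ C * ∫⁻ x, ‖v x‖ₑ ^ p.toReal ∂μ) :
    eLpNorm u p μ ≤ C ^ (1 / p.toReal) * eLpNorm v p μ := by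
  rw [eLpNorm_eq_lintegral_rpow_enorm_toReal hp0 hp, eLpNorm_eq_lintegral_rpow_enorm_toReal hp0 hp,
    ← ENNReal.mul_rpow_of_nonneg _ _ (by positivity)]
  exact ENNReal.rpow_le_rpow h (by positivity)

variable {G : Type*} [Group G] [TopologicalSpace G] [IsTopologicalGroup G] [T2Space G]
  [SecondCountableTopology G] [LocallyCompactSpace G] [MeasurableSpace G] [BorelSpace G]
  {μ : Measure G} [μ.IsHaarMeasure] [μ.IsMulRightInvariant] [μ.IsInvInvariant]
  {B : ℕ → ℕ → Set G} {θ A : ℝ≥0} {k κ : ℕ → G → ℂ} {f K : G → ℂ} {p q : ℝ≥0∞}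

lemma measurable_conv (hf : Measurable f) (hK : IsKernel K) : Measurable (conv μ f K) := by
  have := hK.measurable
  have h : Measurable fun q : G × G => f (q.1 * q.2⁻¹) * K q.2 := by fun_prop
  exact h.stronglyMeasurable.integral_prod_right'.measurable

/-- Splitting a function at a level produces an integrable and a square integrable part. -/
lemma memLp_split (hf : Measurable f) {q : ℝ} (hq1 : 1 ≤ q) (hq2 : q ≤ 2)
    (hfq : ∫⁻ x, ‖f x‖ₑ ^ q ∂μ < ∞) {τ : ℝ≥0∞} (hτ : τ ≠ 0) (hτ' : τ ≠ ∞) :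
    MemLp ({x | τ < ‖f x‖ₑ}.indicator f) 1 μ ∧ MemLp ({x | τ < ‖f x‖ₑ}ᶜ.indicator f) 2 μ := by
  have hs : MeasurableSet {x | τ < ‖f x‖ₑ} := measurableSet_lt measurable_const hf.enorm
  refine ⟨⟨(hf.indicator hs).aestronglyMeasurable, ?_⟩,
    (hf.indicator hs.compl).aestronglyMeasurable, ?_⟩
  · rw [eLpNorm_one_eq_lintegral_enorm]
    refine lt_of_le_of_lt (b := ∫⁻ x, τ ^ (1 - q) * ‖f x‖ₑ ^ q ∂μ) (lintegral_mono fun x => ?_) ?_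
    · by_cases hx : τ < ‖f x‖ₑ
      · rw [Set.indicator_of_mem (by exact hx)]
        have h0 : ‖f x‖ₑ ≠ 0 := (zero_le.trans_lt hx).ne'
        calc ‖f x‖ₑ = ‖f x‖ₑ ^ (1 - q) * ‖f x‖ₑ ^ q := by
              rw [← ENNReal.rpow_add _ _ h0 enorm_ne_top]; simp
          _ ≤ _ := by
              refine mul_le_mul_left ?_ _
              rw [← neg_sub q 1, ENNReal.rpow_neg, ENNReal.rpow_neg]
              exact ENNReal.inv_le_inv.2 (ENNReal.rpow_le_rpow hx.le (by linarith))
      · rw [Set.indicator_of_notMem (by exact hx)]; simp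
    · rw [lintegral_const_mul _ (hf.enorm.pow_const q)]
      exact ENNReal.mul_lt_top (ENNReal.rpow_ne_top_of_ne_zero hτ hτ').lt_top hfq
  · rw [eLpNorm_lt_top_iff_lintegral_rpow_enorm_lt_top (by simp) (by simp)]
    refine lt_of_le_of_lt (b := ∫⁻ x, τ ^ (2 - q) * ‖f x‖ₑ ^ q ∂μ) (lintegral_mono fun x => ?_) ?_
    · by_cases hx : τ < ‖f x‖ₑ
      · rw [Set.indicator_of_notMem (by simpa using hx)]; simp
      · rw [Set.indicator_of_mem (by exact hx)]
        have h0 : ‖f x‖ₑ ≠ ∞ := enorm_ne_top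
        calc ‖f x‖ₑ ^ (2 : ℝ≥0∞).toReal = ‖f x‖ₑ ^ (2 - q) * ‖f x‖ₑ ^ q := by
              rw [← ENNReal.rpow_add_of_nonneg _ _ (by linarith) (by linarith)]; norm_num
          _ ≤ _ := by
              refine mul_le_mul_left ?_ _
              exact ENNReal.rpow_le_rpow (not_lt.1 hx) (by linarith)
    · rw [lintegral_const_mul _ (hf.enorm.pow_const q)]
      exact ENNReal.mul_lt_top (ENNReal.rpow_lt_top_of_nonneg (by linarith) hτ') hfq

/-- Marcinkiewicz interpolation between weak type `(1,1)` and `L²`, normalized. -/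
lemma exists_strongType_normalized [μ.InnerRegularCompactLTTop] (hB : BallSystem μ B)
    (hk : ApproxId μ B θ A k) {q : ℝ} (hq1 : 1 < q) (hq2 : q < 2) : ∃ C : ℝ≥0, ∀ K : G → ℂ,
      IsKernel K → (∀ f, MemLp f 2 μ → eLpNorm (conv μ f K) 2 μ ≤ eLpNorm f 2 μ) →
      (∀ j, ∫⁻ x in (B 1 j)ᶜ, ‖K x - conv μ (prev k j) K x‖ₑ ∂μ ≤ 1) →
      ∀ f, Measurable f → ∫⁻ x, ‖f x‖ₑ ^ q ∂μ < ∞ →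
        ∫⁻ x, ‖conv μ f K x‖ₑ ^ q ∂μ ≤ C * ∫⁻ x, ‖f x‖ₑ ^ q ∂μ := by
  obtain ⟨C, hC⟩ := exists_weakType_conv hB hk
  refine ⟨q.toNNReal * (2 * C * (q - 1)⁻¹.toNNReal + 4 * (2 - q)⁻¹.toNNReal),
    fun K hK hK2 hK1 f hf hfq => ?_⟩
  refine (lintegral_rpow_le_of_weak (a := 2 * C) (b := 4) (measurable_conv hf hK).enorm hf.enorm
    hq1 (Or.inr hq2) fun t ht => ?_).trans (le_of_eq (by simp [ENNReal.ofReal]))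
  set τ := ENNReal.ofReal t with hτ
  have hτ0 : τ ≠ 0 := by simpa [hτ] using ht
  have hτt : τ ≠ ∞ := ENNReal.ofReal_ne_top
  obtain ⟨h1, h2⟩ := memLp_split hf hq1.le hq2.le hfq hτ0 hτt
  set s := {x | τ < ‖f x‖ₑ} with hs
  have hsm : MeasurableSet s := measurableSet_lt measurable_const hf.enorm
  have hdec : conv μ f K = conv μ (s.indicator f) K + conv μ (sᶜ.indicator f) K := by
    rw [← conv_add_left (h1.locallyIntegrable le_rfl) (h2.locallyIntegrable (by norm_num)) hK,
      Set.indicator_self_add_compl]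
  have hm2 : AEMeasurable (fun x => ‖conv μ (sᶜ.indicator f) K x‖ₑ) μ :=
    (measurable_conv (hf.indicator hsm.compl) hK).enorm.aemeasurable
  have e1 : ∫⁻ x, ‖s.indicator f x‖ₑ ∂μ = ∫⁻ x, (if τ < ‖f x‖ₑ then ‖f x‖ₑ else 0) ∂μ := by
    refine lintegral_congr fun x => ?_
    by_cases hx : τ < ‖f x‖ₑ
    · rw [Set.indicator_of_mem (by exact hx), if_pos hx]
    · rw [Set.indicator_of_notMem (by exact hx), if_neg hx]; simp
  have e2 : ∫⁻ x, ‖sᶜ.indicator f x‖ₑ ^ 2 ∂μ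
      = ∫⁻ x, (if τ < ‖f x‖ₑ then 0 else ‖f x‖ₑ ^ 2) ∂μ := by
    refine lintegral_congr fun x => ?_
    by_cases hx : τ < ‖f x‖ₑ
    · rw [Set.indicator_of_notMem (by simpa [hs] using hx), if_pos hx]; simp
    · rw [Set.indicator_of_mem (by exact hx), if_neg hx]
  have hti : ENNReal.ofReal t⁻¹ = τ⁻¹ := ENNReal.ofReal_inv_of_pos ht
  have hti2 : ENNReal.ofReal (t ^ 2)⁻¹ = τ⁻¹ * τ⁻¹ := by
    rw [← inv_pow, ENNReal.ofReal_pow (by positivity), hti, sq]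
  have w1 : τ * μ {x | τ / 2 < ‖conv μ (s.indicator f) K x‖ₑ}
      ≤ 2 * C * ∫⁻ x, ‖s.indicator f x‖ₑ ∂μ := by
    have := hC K hK hK2 hK1 _ (hf.indicator hsm) h1 (τ / 2) (by simpa using hτ0)
      (ENNReal.div_ne_top hτt (by simp))
    calc _ = 2 * (τ / 2 * μ {x | τ / 2 < ‖conv μ (s.indicator f) K x‖ₑ}) := by
          rw [← mul_assoc, ENNReal.mul_div_cancel (by simp) (by simp)]
      _ ≤ _ := by rw [mul_assoc]; exact mul_le_mul_right this _
  have w2 : τ * μ {x | τ / 2 < ‖conv μ (sᶜ.indicator f) K x‖ₑ}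
      ≤ 4 * (τ⁻¹ * ∫⁻ x, ‖sᶜ.indicator f x‖ₑ ^ 2 ∂μ) := by
    refine mul_measure_half_lt_le_of_sq hm2 hτ0 hτt ?_
    rw [mul_right_comm, ENNReal.inv_mul_cancel hτ0 hτt, one_mul]
    have := hK2 _ h2
    rw [eLpNorm_eq_lintegral_rpow_enorm_toReal (by simp) (by simp),
      eLpNorm_eq_lintegral_rpow_enorm_toReal (by simp) (by simp),
      ENNReal.rpow_le_rpow_iff (by simp)] at this
    simpa using this
  have hsub : {x | τ < ‖conv μ f K x‖ₑ} ⊆ {x | τ / 2 < ‖conv μ (s.indicator f) K x‖ₑ} ∪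
      {x | τ / 2 < ‖conv μ (sᶜ.indicator f) K x‖ₑ} := by
    intro x (hx : τ < ‖conv μ f K x‖ₑ)
    by_contra! h
    simp only [Set.mem_union, Set.mem_ofPred_eq, not_or, not_lt] at h
    rw [hdec] at hx
    refine hx.not_ge ((enorm_add_le _ _).trans ((add_le_add h.1 h.2).trans ?_))
    rw [ENNReal.add_halves]
  have w3 := (mul_le_mul_right ((measure_mono hsub).trans (measure_union_le (μ := μ) _ _)) τ).trans
    ((mul_add _ _ _).le.trans (add_le_add w1 w2))
  rw [hti, hti2, ← e1, ← e2]
  calc μ {x | τ < ‖conv μ f K x‖ₑ} = τ⁻¹ * (τ * μ {x | τ < ‖conv μ f K x‖ₑ}) := by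
        rw [← mul_assoc, ENNReal.inv_mul_cancel hτ0 hτt, one_mul]
    _ ≤ _ := (mul_le_mul_right w3 _).trans (le_of_eq (by ring))

/-- Convolution with a kernel that is bounded on `L²` and satisfies a Hörmander type condition is
bounded on `L^p` for `1 < p < 2`, with a bound linear in the constant of the hypotheses. -/
lemma exists_strongType_lt_two [μ.InnerRegularCompactLTTop] (hB : BallSystem μ B)
    (hk : ApproxId μ B θ A k) (hp1 : 1 < p) (hp2 : p < 2) : ∃ C : ℝ≥0, ∀ K : G → ℂ,
      IsKernel K → ∀ a : ℝ≥0, a ≠ 0 →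
      (∀ f, MemLp f 2 μ → eLpNorm (conv μ f K) 2 μ ≤ a * eLpNorm f 2 μ) →
      (∀ j, ∫⁻ x in (B 1 j)ᶜ, ‖K x - conv μ (prev k j) K x‖ₑ ∂μ ≤ a) →
      ∀ f, MemLp f p μ → eLpNorm (conv μ f K) p μ ≤ C * a * eLpNorm f p μ := by
  have hpt : p ≠ ∞ := (hp2.trans (by simp)).ne
  have hp0 : p ≠ 0 := (zero_lt_one.trans hp1).ne'
  have h1 : 1 < p.toReal := by simpa using (ENNReal.toReal_lt_toReal (by simp) hpt).2 hp1
  have h2 : p.toReal < 2 := by simpa using (ENNReal.toReal_lt_toReal hpt (by simp)).2 hp2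
  obtain ⟨C, hC⟩ := exists_strongType_normalized hB hk h1 h2
  refine ⟨C ^ (1 / p.toReal), fun K hK a ha hK2 hK1 f hf => ?_⟩
  have haC : (a : ℂ) ≠ 0 := by simpa using ha
  set K' : G → ℂ := fun x => (a : ℂ)⁻¹ * K x with hK'
  have hen : ∀ z : ℂ, ‖(a : ℂ)⁻¹ * z‖ₑ = (a : ℝ≥0∞)⁻¹ * ‖z‖ₑ := fun z => by
    rw [enorm_mul, enorm_inv haC]
    congr 2
    simp [← ofReal_norm]
  have hai : (a : ℝ≥0∞)⁻¹ * a = 1 := ENNReal.inv_mul_cancel (by simpa using ha) (by simp)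
  have hconv : ∀ g, conv μ g K' = fun x => (a : ℂ)⁻¹ * conv μ g K x := fun g =>
    conv_const_mul_right _
  have hnorm : ∀ (g : G → ℂ) (r : ℝ≥0∞), eLpNorm (fun x => (a : ℂ)⁻¹ * g x) r μ
      = (a : ℝ≥0∞)⁻¹ * eLpNorm g r μ := fun g r => by
    have := eLpNorm_const_smul (a : ℂ)⁻¹ g r μ
    rw [enorm_inv haC] at this
    have e : ‖(a : ℂ)‖ₑ = a := by simp [← ofReal_norm]
    rw [e] at this
    exact this
  have key := hC K' (hK.const_mul _) (fun g hg => ?_) (fun j => ?_) (hf.1.mk f)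
    hf.1.stronglyMeasurable_mk.measurable ?_
  · have h3 := eLpNorm_le_of_lintegral_rpow_le hp0 hpt key
    rw [conv_congr_ae hf.1.ae_eq_mk.symm, eLpNorm_congr_ae hf.1.ae_eq_mk.symm, hconv, hnorm] at h3
    calc eLpNorm (conv μ f K) p μ = a * ((a : ℝ≥0∞)⁻¹ * eLpNorm (conv μ f K) p μ) := by
          rw [← mul_assoc, mul_comm (a : ℝ≥0∞), hai, one_mul]
      _ ≤ a * ((C : ℝ≥0∞) ^ (1 / p.toReal) * eLpNorm f p μ) := mul_le_mul_right h3 _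
      _ = _ := by
          rw [ENNReal.coe_rpow_of_nonneg _ (by positivity)]; ring
  · rw [hconv, hnorm]
    calc _ ≤ (a : ℝ≥0∞)⁻¹ * (a * eLpNorm g 2 μ) := mul_le_mul_right (hK2 g hg) _
      _ = _ := by rw [← mul_assoc, hai, one_mul]
  · have e : ∀ x, ‖K' x - conv μ (prev k j) K' x‖ₑ
        = (a : ℝ≥0∞)⁻¹ * ‖K x - conv μ (prev k j) K x‖ₑ := fun x => by
      rw [hconv, ← hen, mul_sub]
    simp_rw [e]
    rw [lintegral_const_mul' _ _ (by simpa using ha)]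
    exact (mul_le_mul_right (hK1 j) _).trans hai.le
  · have := (eLpNorm_lt_top_iff_lintegral_rpow_enorm_lt_top hp0 hpt).1 hf.2
    rwa [lintegral_congr_ae (hf.1.ae_eq_mk.mono fun x hx => by rw [hx])] at this

/-- Sums of multiscale sequences act boundedly on `L^p`, uniformly in the number of terms, provided
the reflected sequence is multiscale as well. -/
lemma exists_eLpNorm_conv_sum_le [μ.InnerRegularCompactLTTop] (hB : BallSystem μ B)
    (hk : ApproxId μ B θ A k) (hθ : θ < 1) (hp1 : 1 < p) (hp2 : p < ∞) :
    ∃ C : ℝ≥0, ∀ (c : ℝ≥0) (κ : ℕ → G → ℂ), c ≠ 0 → Multiscale μ B k c θ κ →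
      Multiscale μ B (fun j => reflect (k j)) c θ (fun j => reflect (κ j)) →
      ∀ (s : Finset ℕ) (f : G → ℂ), MemLp f p μ →
        eLpNorm (conv μ f (∑ m ∈ s, κ m)) p μ ≤ C * c * eLpNorm f p μ := by
  have hlt : ∀ {l : ℕ → G → ℂ}, ApproxId μ B θ A l → ∀ {r : ℝ≥0∞}, 1 < r → r < 2 →
      ∃ C : ℝ≥0, ∀ (c : ℝ≥0) (κ : ℕ → G → ℂ), c ≠ 0 → Multiscale μ B l c θ κ →
      ∀ (s : Finset ℕ) (f : G → ℂ), MemLp f r μ →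
        eLpNorm (conv μ f (∑ m ∈ s, κ m)) r μ ≤ C * c * eLpNorm f r μ := by
    intro l hl r hr1 hr2
    obtain ⟨C, hC⟩ := exists_strongType_lt_two hB hl hr1 hr2
    refine ⟨C * (2 / (1 - θ)), fun c κ hc hκ s f hf => ?_⟩
    have h := hC (∑ m ∈ s, κ m) (IsKernel.sum s fun m _ => hκ.isKernel m) (c * (2 / (1 - θ)))
      (mul_ne_zero hc (div_ne_zero two_ne_zero (tsub_pos_of_lt hθ).ne'))
      (fun f hf => eLpNorm_two_conv_sum_le hκ.isKernel hθ hκ.orth_right hκ.orth_left s hf)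
      (fun j => hκ.lintegral_compl_le hB hl hθ s j) f hf
    refine h.trans (le_of_eq ?_)
    push_cast; ring
  rcases lt_trichotomy p 2 with h | rfl | h
  · obtain ⟨C, hC⟩ := hlt hk hp1 h
    exact ⟨C, fun c κ hc hκ _ => hC c κ hc hκ⟩
  · refine ⟨2 / (1 - θ), fun c κ _ hκ _ s f hf => ?_⟩
    refine (eLpNorm_two_conv_sum_le hκ.isKernel hθ hκ.orth_right hκ.orth_left s hf).trans ?_
    rw [mul_comm c, ENNReal.coe_mul]
  · -- above `2` by duality
    obtain ⟨q, hpq, hq1, hqt, hq2, -⟩ := exists_holderConjugate hp1 hp2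
    obtain ⟨C, hC⟩ := hlt (hk.reflectFamily hB) hq1 (hq2 h)
    refine ⟨C, fun c κ hc hκ hκ' s f hf => ?_⟩
    have hK : IsKernel (∑ m ∈ s, κ m) := IsKernel.sum s fun m _ => hκ.isKernel m
    refine eLpNorm_le_of_dual hp2.ne hqt.ne (memLp_conv hp1.le hp2.ne hf hK) fun v hv => ?_
    have e : (fun y => (∑ m ∈ s, κ m) y⁻¹) = ∑ m ∈ s, reflect (κ m) := by
      ext y; simp [reflect]
    have hK' : IsKernel (∑ m ∈ s, reflect (κ m)) := IsKernel.sum s fun m _ => hκ'.isKernel m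
    rw [integral_conv_mul hp2.ne hf hv hK, e]
    refine (enorm_integral_mul_le (p := p) (q := q) hf.1
      (aestronglyMeasurable_conv hv.1 (hK'.memLp 1).1)).trans ?_
    refine (mul_le_mul_right (hC c _ hc hκ' s v hv) _).trans (le_of_eq (by ring))

end StrongType

/-! ### The upper and the vector valued square function estimates -/

section SquareFunction

lemma lintegral_rpow_le_of_eLpNorm_le {α E F : Type*} [MeasurableSpace α] {μ : Measure α}
    [NormedAddCommGroup E] [NormedAddCommGroup F] {u : α → E} {v : α → F} {p : ℝ≥0∞} (hp0 : p ≠ 0)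
    (hp : p ≠ ∞) {C : ℝ≥0∞} (h : eLpNorm u p μ ≤ C * eLpNorm v p μ) :
    ∫⁻ x, ‖u x‖ₑ ^ p.toReal ∂μ ≤ C ^ p.toReal * ∫⁻ x, ‖v x‖ₑ ^ p.toReal ∂μ := by
  have hP : 0 < p.toReal := ENNReal.toReal_pos hp0 hp
  rw [eLpNorm_eq_lintegral_rpow_enorm_toReal hp0 hp,
    eLpNorm_eq_lintegral_rpow_enorm_toReal hp0 hp] at h
  have h' := ENNReal.rpow_le_rpow h hP.le
  rwa [ENNReal.mul_rpow_of_nonneg _ _ hP.le, ← ENNReal.rpow_mul, ← ENNReal.rpow_mul,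
    one_div_mul_cancel hP.ne', ENNReal.rpow_one, ENNReal.rpow_one] at h'

lemma exists_khintchine_enorm {q : ℝ} (hq : 0 < q) : ∃ C : ℝ≥0, ∀ (s : Finset ℕ) (a : ℕ → ℂ),
    ‖√(∑ j ∈ s, ‖a j‖ ^ 2)‖ₑ ^ q
      ≤ C * ((2 ^ s.card)⁻¹ * ∑ t ∈ s.powerset, ‖signSum s t a‖ₑ ^ q) := by
  obtain ⟨C, hC⟩ := exists_khintchine hq
  refine ⟨C, fun s a => ?_⟩
  have h := ENNReal.ofReal_le_ofReal (hC s a)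
  rw [← ENNReal.ofReal_rpow_of_nonneg (Real.sqrt_nonneg _) hq.le,
    ← Real.enorm_of_nonneg (Real.sqrt_nonneg _)] at h
  refine h.trans (le_of_eq ?_)
  rw [ENNReal.ofReal_mul (by positivity), ENNReal.ofReal_mul (by positivity),
    ENNReal.ofReal_sum_of_nonneg fun _ _ => by positivity, ENNReal.ofReal_coe_nnreal,
    ENNReal.ofReal_inv_of_pos (by positivity), ENNReal.ofReal_pow (by norm_num)]
  simp_rw [← ENNReal.ofReal_rpow_of_nonneg (norm_nonneg _) hq.le, ofReal_norm]
  norm_num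

variable {G : Type*} [Group G] [TopologicalSpace G] [IsTopologicalGroup G] [T2Space G]
  [SecondCountableTopology G] [LocallyCompactSpace G] [MeasurableSpace G] [BorelSpace G]
  {μ : Measure G} [μ.IsHaarMeasure] [μ.IsMulRightInvariant] [μ.IsInvInvariant]
  {B : ℕ → ℕ → Set G} {θ A : ℝ≥0} {k κ : ℕ → G → ℂ} {f K : G → ℂ} {p q : ℝ≥0∞}

/-- The square function of the difference kernels is bounded on `L^p`, by Khintchine's inequality
and the bounds for the sums of difference kernels with arbitrary signs. -/
lemma exists_eLpNorm_finSq_conv_diff_le [μ.InnerRegularCompactLTTop] (hB : BallSystem μ B)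
    (hk : ApproxId μ B θ A k) (hθ0 : 0 < θ) (hθ1 : θ < 1) (hp1 : 1 < p) (hp2 : p < ∞) :
    ∃ C : ℝ≥0, ∀ (s : Finset ℕ) (f : G → ℂ), MemLp f p μ →
      eLpNorm (finSq s fun j => conv μ f (diff k j)) p μ ≤ C * eLpNorm f p μ := by
  have hp0 : p ≠ 0 := (zero_lt_one.trans hp1).ne'
  have hP : 0 < p.toReal := ENNReal.toReal_pos hp0 hp2.ne
  obtain ⟨C, hC⟩ := exists_eLpNorm_conv_sum_le hB hk hθ1 hp1 hp2
  obtain ⟨D, hD⟩ := exists_khintchine_enorm hP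
  set M : ℝ≥0 := C * prodConst θ A with hM
  have hc0 : prodConst θ A ≠ 0 := (zero_lt_one.trans_le one_le_prodConst).ne'
  refine ⟨(D * M ^ p.toReal) ^ (1 / p.toReal), fun s f hf => ?_⟩
  have hloc : LocallyIntegrable f μ := hf.locallyIntegrable hp1.le
  have hd := hk.isKernel_diff
  have hfm : ∀ j, AEStronglyMeasurable (conv μ f (diff k j)) μ := fun j =>
    aestronglyMeasurable_conv hf.1 ((hd j).memLp 1).1
  have hsign : ∀ t ∈ s.powerset, ∫⁻ x, ‖signSum s t fun j => conv μ f (diff k j) x‖ₑ ^ p.toReal ∂μ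
      ≤ (M : ℝ≥0∞) ^ p.toReal * ∫⁻ x, ‖f x‖ₑ ^ p.toReal ∂μ := by
    intro t _
    set ε : ℕ → ℂ := fun j => if j ∈ t then 1 else -1 with hε
    have hε1 : ∀ m, ‖ε m‖ ≤ 1 := fun m => by
      simp only [hε]; split_ifs <;> simp
    have h1 := hk.multiscale_diff hB hθ0 hθ1 hε1
    have h2 := (hk.reflectFamily hB).multiscale_diff hB hθ0 hθ1 hε1
    have h3 := hC _ _ hc0 h1 (by
      convert h2 using 2 with j
      rw [← reflect_diff]; rfl) s f hf
    have e : conv μ f (∑ m ∈ s, fun x => ε m * diff k m x)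
        = fun x => signSum s t fun j => conv μ f (diff k j) x := by
      rw [conv_sum_right s hloc fun m _ => (hd m).const_mul _]
      ext x
      simp only [Finset.sum_apply, conv_const_mul_right, signSum, hε]
    rw [e] at h3
    exact lintegral_rpow_le_of_eLpNorm_le hp0 hp2.ne (by simpa [hM] using h3)
  rw [ENNReal.coe_rpow_of_nonneg _ (by positivity)]
  refine eLpNorm_le_of_lintegral_rpow_le hp0 hp2.ne ?_
  have hcard : (2 ^ s.card : ℝ≥0∞)⁻¹ * 2 ^ s.card = 1 :=
    ENNReal.inv_mul_cancel (by simp) (by simp)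
  calc ∫⁻ x, ‖finSq s (fun j => conv μ f (diff k j)) x‖ₑ ^ p.toReal ∂μ
      ≤ ∫⁻ x, D * ((2 ^ s.card)⁻¹ * ∑ t ∈ s.powerset,
          ‖signSum s t fun j => conv μ f (diff k j) x‖ₑ ^ p.toReal) ∂μ :=
        lintegral_mono fun x => hD s fun j => conv μ f (diff k j) x
    _ = D * ((2 ^ s.card)⁻¹ * ∑ t ∈ s.powerset,
          ∫⁻ x, ‖signSum s t fun j => conv μ f (diff k j) x‖ₑ ^ p.toReal ∂μ) := by
        rw [lintegral_const_mul' _ _ (by simp), lintegral_const_mul' _ _ (by simp),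
          lintegral_finsetSum']
        intro t _
        refine AEMeasurable.pow_const (AEStronglyMeasurable.enorm ?_) _
        exact Finset.aestronglyMeasurable_fun_sum _ fun j _ => (hfm j).const_mul _
    _ ≤ D * ((2 ^ s.card)⁻¹ * ∑ t ∈ s.powerset,
          ((M : ℝ≥0∞) ^ p.toReal * ∫⁻ x, ‖f x‖ₑ ^ p.toReal ∂μ)) := by
        gcongr with t ht
        exact hsign t ht
    _ = D * (((2 ^ s.card)⁻¹ * 2 ^ s.card) *
          ((M : ℝ≥0∞) ^ p.toReal * ∫⁻ x, ‖f x‖ₑ ^ p.toReal ∂μ)) := by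
        rw [Finset.sum_const, Finset.card_powerset, nsmul_eq_mul]
        push_cast
        rw [mul_assoc]
    _ = _ := by
        rw [hcard, one_mul, ENNReal.coe_mul D, ENNReal.coe_rpow_of_nonneg _ hP.le, mul_assoc]

/-- The Cauchy–Schwarz inequality for convolutions. -/
lemma enorm_conv_sq_le (hf : Measurable f) (hK : IsKernel K) (x : G) :
    ‖conv μ f K x‖ₑ ^ 2 ≤ eLpNorm K 1 μ * ∫⁻ z, ‖f z‖ₑ ^ 2 * ‖K (z⁻¹ * x)‖ₑ ∂μ := by
  have hKm := hK.measurable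
  have h1 := ENNReal.lintegral_mul_le_Lp_mul_Lq μ Real.HolderConjugate.two_two
    (f := fun z => ‖K (z⁻¹ * x)‖ₑ ^ (1 / 2 : ℝ))
    (g := fun z => ‖f z‖ₑ * ‖K (z⁻¹ * x)‖ₑ ^ (1 / 2 : ℝ))
    (by fun_prop) (by fun_prop)
  have hhalf : ∀ a : ℝ≥0∞, (a ^ (1 / 2 : ℝ)) ^ 2 = a := fun a => by
    rw [← ENNReal.rpow_natCast, ← ENNReal.rpow_mul]; norm_num
  have e1 : ∫⁻ z, ‖K (z⁻¹ * x)‖ₑ ∂μ = eLpNorm K 1 μ := by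
    rw [eLpNorm_one_eq_lintegral_enorm, ← lintegral_div_left_eq_self (fun z => ‖K (z⁻¹ * x)‖ₑ) x]
    simp [div_eq_mul_inv]
  have e2 : ∀ z, ‖K (z⁻¹ * x)‖ₑ ^ (1 / 2 : ℝ) * (‖f z‖ₑ * ‖K (z⁻¹ * x)‖ₑ ^ (1 / 2 : ℝ))
      = ‖f z‖ₑ * ‖K (z⁻¹ * x)‖ₑ := fun z => by
    rw [mul_left_comm, ← sq, hhalf]
  simp only [Pi.mul_apply, e2, ENNReal.rpow_two, mul_pow, hhalf, e1] at h1
  refine (pow_le_pow_left' ((enorm_conv_le f K x).trans h1) 2).trans ?_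
  rw [mul_pow, hhalf, hhalf]

/-- Averaging a weight against a difference kernel is dominated by the maximal function. -/
lemma ApproxId.lintegral_diff_mul_le (hB : BallSystem μ B) (hk : ApproxId μ B θ A k) (j : ℕ)
    {w : G → ℝ≥0∞} (hw : Measurable w) (z : G) :
    ∫⁻ x, ‖diff k j (z⁻¹ * x)‖ₑ * w x ∂μ ≤ 2 * A * maximal μ B 0 w z := by
  have hmaj : ∀ j, ∫⁻ x, majorant μ B A j (z⁻¹ * x) * w x ∂μ ≤ A * maximal μ B 0 w z := by
    intro j
    cases j with
    | zero => simp [majorant]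
    | succ j =>
      have e : ∀ x, majorant μ B A (j + 1) (z⁻¹ * x) * w x
          = A / μ (B 0 j) * (ballAt B 0 j z).indicator w x := fun x => by
        by_cases hx : z⁻¹ * x ∈ B 0 j
        · rw [Set.indicator_of_mem (by exact hx)]; simp [majorant, hx]
        · rw [Set.indicator_of_notMem (by exact hx)]; simp [majorant, hx]
      simp_rw [e]
      rw [lintegral_const_mul _ (hw.indicator (hB.measurableSet_ballAt 0 j z)),
        lintegral_indicator (hB.measurableSet_ballAt 0 j z), div_eq_mul_inv, mul_assoc]
      exact mul_le_mul_right (le_iSup (fun j => (μ (B 0 j))⁻¹ * ∫⁻ z in ballAt B 0 j z, w z ∂μ) j) _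
  calc ∫⁻ x, ‖diff k j (z⁻¹ * x)‖ₑ * w x ∂μ
      ≤ ∫⁻ x, majorant μ B A (j + 1) (z⁻¹ * x) * w x + majorant μ B A j (z⁻¹ * x) * w x ∂μ := by
        refine lintegral_mono fun x => ?_
        simp only
        rw [← add_mul]
        refine mul_le_mul_left ((enorm_sub_le).trans ?_) _
        exact add_le_add (hk.enorm_prev_le (j + 1) _) (hk.enorm_prev_le j _)
    _ ≤ A * maximal μ B 0 w z + A * maximal μ B 0 w z := by
        have := hB.measurable_majorant (A := A) (j + 1)
        rw [lintegral_add_left (by fun_prop)]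
        exact add_le_add (hmaj _) (hmaj _)
    _ = _ := by ring

/-- The vector valued inequality above `L²`, through the maximal function. -/
lemma exists_eLpNorm_finSq_conv_le_of_two_lt (hB : BallSystem μ B) (hk : ApproxId μ B θ A k)
    (hp1 : 2 < p) (hp2 : p < ∞) : ∃ C : ℝ≥0, ∀ (s : Finset ℕ) (g : ℕ → G → ℂ),
      (∀ j, MemLp (g j) p μ) →
      eLpNorm (finSq s fun j => conv μ (g j) (diff k j)) p μ ≤ C * eLpNorm (finSq s g) p μ := by
  have hp0 : p ≠ 0 := (zero_lt_two.trans hp1).ne'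
  have hP : 2 < p.toReal := by simpa using (ENNReal.toReal_lt_toReal (by simp) hp2.ne).2 hp1
  set r := p.toReal / 2 with hr
  have hr1 : 1 < r := by rw [hr]; linarith
  have hrr := Real.HolderConjugate.conjExponent hr1
  set r' := Real.conjExponent r with hr'
  have hrw : (r - 1) * r' = r := hrr.sub_one_mul_conj
  obtain ⟨D, hD⟩ := hB.strong_maximal 0 hrr.symm.lt
  have hd := hk.isKernel_diff
  set M : ℝ≥0 := 2 * A * (2 * A) * D ^ (1 / r') with hM
  refine ⟨M ^ (1 / 2 : ℝ), fun s g hg => ?_⟩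
  have hpp : p.toReal = 2 * r := by rw [hr]; ring
  -- measurable representatives
  suffices H : ∀ g : ℕ → G → ℂ, (∀ j, MemLp (g j) p μ) → (∀ j, Measurable (g j)) →
      eLpNorm (finSq s fun j => conv μ (g j) (diff k j)) p μ
        ≤ ((M ^ (1 / 2 : ℝ) : ℝ≥0) : ℝ≥0∞) * eLpNorm (finSq s g) p μ by
    have h := H (fun j => (hg j).1.mk (g j)) (fun j => (hg j).ae_eq (hg j).1.ae_eq_mk)
      fun j => (hg j).1.stronglyMeasurable_mk.measurable
    simp only [fun j => conv_congr_ae (hg j).1.ae_eq_mk.symm (diff k j)] at h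
    refine h.trans (le_of_eq ?_)
    congr 1
    refine eLpNorm_congr_ae ?_
    filter_upwards [ae_all_iff.2 fun j => (hg j).1.ae_eq_mk] with x hx
    simp only [finSq]
    congr 1
    exact Finset.sum_congr rfl fun j _ => by rw [← hx j]
  clear hg g
  intro g hg hgm
  set X : G → ℝ≥0∞ := fun x => ∑ j ∈ s, ‖conv μ (g j) (diff k j) x‖ₑ ^ 2 with hX
  set Y : G → ℝ≥0∞ := fun x => ∑ j ∈ s, ‖g j x‖ₑ ^ 2 with hY
  have hcm : ∀ j, Measurable (conv μ (g j) (diff k j)) := fun j => measurable_conv (hgm j) (hd j)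
  have hXm : Measurable X := Finset.measurable_fun_sum _ fun j _ => (hcm j).enorm.pow_const 2
  have hYm : Measurable Y := Finset.measurable_fun_sum _ fun j _ => (hgm j).enorm.pow_const 2
  have hnX : eLpNorm (finSq s fun j => conv μ (g j) (diff k j)) p μ
      = ((∫⁻ x, X x ^ r ∂μ) ^ (1 / r)) ^ (1 / 2 : ℝ) := by
    rw [eLpNorm_eq_lintegral_rpow_enorm_toReal hp0 hp2.ne, ← ENNReal.rpow_mul, hpp]
    congr 1
    · refine lintegral_congr fun x => ?_
      rw [ENNReal.rpow_mul, ENNReal.rpow_two, enorm_finSq_sq]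
    · field_simp
  have hnY : eLpNorm (finSq s g) p μ = ((∫⁻ x, Y x ^ r ∂μ) ^ (1 / r)) ^ (1 / 2 : ℝ) := by
    rw [eLpNorm_eq_lintegral_rpow_enorm_toReal hp0 hp2.ne, ← ENNReal.rpow_mul, hpp]
    congr 1
    · refine lintegral_congr fun x => ?_
      rw [ENNReal.rpow_mul, ENNReal.rpow_two, enorm_finSq_sq]
    · field_simp
  set I := ∫⁻ x, X x ^ r ∂μ with hI
  set J := ∫⁻ x, Y x ^ r ∂μ with hJ
  have hItop : I ≠ ∞ := by
    have h1 := memLp_finSq (s := s) fun j _ =>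
      memLp_conv ((one_le_two.trans_lt hp1).le) hp2.ne (hg j) (hd j)
    have h2 := h1.2
    rw [hnX] at h2
    intro h
    rw [h, ENNReal.top_rpow_of_pos (by positivity), ENNReal.top_rpow_of_pos (by positivity)] at h2
    exact lt_irrefl _ h2
  -- `w` is the weight that is extremal for the duality between `L^r` and `L^r'`
  set w : G → ℝ≥0∞ := fun x => X x ^ (r - 1) with hw
  have hwm : Measurable w := hXm.pow_const _
  have hterm : ∀ j, ∫⁻ x, ‖conv μ (g j) (diff k j) x‖ₑ ^ 2 * w x ∂μ
      ≤ 2 * A * (2 * A) * ∫⁻ z, ‖g j z‖ₑ ^ 2 * maximal μ B 0 w z ∂μ := by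
    intro j
    have hdm := (hd j).measurable
    have hgj := hgm j
    calc ∫⁻ x, ‖conv μ (g j) (diff k j) x‖ₑ ^ 2 * w x ∂μ
        ≤ ∫⁻ x, 2 * A * ∫⁻ z, ‖g j z‖ₑ ^ 2 * (‖diff k j (z⁻¹ * x)‖ₑ * w x) ∂μ ∂μ := by
          refine lintegral_mono fun x => ?_
          simp only [← mul_assoc]
          rw [lintegral_mul_const _ (by fun_prop), ← mul_assoc]
          refine mul_le_mul_left ((enorm_conv_sq_le (hgm j) (hd j) x).trans ?_) _
          exact mul_le_mul_left (by exact_mod_cast hk.eLpNorm_diff_le hB j) _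
      _ = 2 * A * ∫⁻ z, ‖g j z‖ₑ ^ 2 * ∫⁻ x, ‖diff k j (z⁻¹ * x)‖ₑ * w x ∂μ ∂μ := by
          rw [lintegral_const_mul' _ _ (by finiteness), lintegral_lintegral_swap]
          · congr 1
            refine lintegral_congr fun z => ?_
            rw [lintegral_const_mul _ (by fun_prop)]
          · have : Measurable fun q : G × G =>
                ‖g j q.2‖ₑ ^ 2 * (‖diff k j (q.2⁻¹ * q.1)‖ₑ * w q.1) := by fun_prop
            exact this.aemeasurable
      _ ≤ 2 * A * ∫⁻ z, ‖g j z‖ₑ ^ 2 * (2 * A * maximal μ B 0 w z) ∂μ := by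
          gcongr with z
          exact hk.lintegral_diff_mul_le hB j hwm z
      _ = _ := by
          have e : ∀ z, ‖g j z‖ₑ ^ 2 * (2 * A * maximal μ B 0 w z)
              = 2 * A * (‖g j z‖ₑ ^ 2 * maximal μ B 0 w z) := fun z => by ring
          simp_rw [e]
          rw [lintegral_const_mul' _ _ (by finiteness), ← mul_assoc]
  have hXw : ∀ x, X x ^ r = X x * w x := fun x => by
    simp only [hw]
    nth_rewrite 2 [← ENNReal.rpow_one (X x)]
    rw [← ENNReal.rpow_add_of_nonneg _ _ zero_le_one (by linarith)]
    ring_nf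
  have hmm := hB.measurable_maximal 0 hwm
  have hmain : I ≤ M * J ^ (1 / r) * I ^ (1 / r') := by
    calc I = ∑ j ∈ s, ∫⁻ x, ‖conv μ (g j) (diff k j) x‖ₑ ^ 2 * w x ∂μ := by
          rw [hI]
          simp_rw [hXw, hX, Finset.sum_mul]
          exact lintegral_finsetSum _ fun j _ => ((hcm j).enorm.pow_const 2).mul hwm
      _ ≤ ∑ j ∈ s, 2 * A * (2 * A) * ∫⁻ z, ‖g j z‖ₑ ^ 2 * maximal μ B 0 w z ∂μ :=
          Finset.sum_le_sum fun j _ => hterm j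
      _ = 2 * A * (2 * A) * ∫⁻ z, (Y * maximal μ B 0 w) z ∂μ := by
          simp only [hY, Pi.mul_apply, Finset.sum_mul]
          rw [← Finset.mul_sum, lintegral_finsetSum]
          exact fun j _ => ((hgm j).enorm.pow_const 2).mul hmm
      _ ≤ 2 * A * (2 * A) * (J ^ (1 / r) * (D * I) ^ (1 / r')) := by
          refine mul_le_mul_right ((ENNReal.lintegral_mul_le_Lp_mul_Lq μ hrr hYm.aemeasurable
            hmm.aemeasurable).trans ?_) _
          refine mul_le_mul_right (ENNReal.rpow_le_rpow ((hD w hwm).trans (le_of_eq ?_))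
            (by have := hrr.symm.pos; positivity)) _
          congr 1
          refine lintegral_congr fun x => ?_
          simp only [hw]
          rw [← ENNReal.rpow_mul, hrw]
      _ = _ := by
          have : 0 ≤ 1 / r' := by have := hrr.symm.pos; positivity
          rw [ENNReal.mul_rpow_of_nonneg _ _ this, hM]
          push_cast
          rw [ENNReal.coe_rpow_of_nonneg _ this]
          ring
  -- the factor `I ^ (1 / r')` is finite by the qualitative bound for each term and cancels
  have hfin : I ^ (1 / r) ≤ M * J ^ (1 / r) := by
    rcases eq_or_ne I 0 with h0 | h0
    · rw [h0, ENNReal.zero_rpow_of_pos (by positivity)]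
      exact zero_le
    have e : I = I ^ (1 / r) * I ^ (1 / r') := by
      rw [← ENNReal.rpow_add _ _ h0 hItop, one_div, one_div, hrr.inv_add_inv_eq_one,
        ENNReal.rpow_one]
    have hne : I ^ (1 / r') ≠ 0 := by simp [h0, hItop]
    have hne' : I ^ (1 / r') ≠ ∞ :=
      ENNReal.rpow_ne_top_of_nonneg (by simpa using hrr.symm.nonneg) hItop
    exact (ENNReal.mul_le_mul_iff_left hne hne').1 (e ▸ hmain)
  rw [hnX, hnY, ENNReal.coe_rpow_of_nonneg _ (by positivity),
    ← ENNReal.mul_rpow_of_nonneg _ _ (by positivity)]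
  exact ENNReal.rpow_le_rpow hfin (by positivity)

lemma integral_sum_conv_mul [p.HolderConjugate q] (hp : p ≠ ∞) (hq : q ≠ ∞) {g h : ℕ → G → ℂ}
    (hg : ∀ j, MemLp (g j) p μ) (hh : ∀ j, MemLp (h j) q μ) (hκ : ∀ j, IsKernel (κ j))
    {s : Finset ℕ} : ∫ x, ∑ j ∈ s, conv μ (g j) (κ j) x * h j x ∂μ
      = ∫ x, ∑ j ∈ s, g j x * conv μ (h j) (reflect (κ j)) x ∂μ := by
  have hp1 : 1 ≤ p := ENNReal.HolderConjugate.one_le p q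
  have hq1 : 1 ≤ q := ENNReal.HolderConjugate.one_le q p
  have i1 : ∀ j, Integrable (fun x => conv μ (g j) (κ j) x * h j x) μ := fun j =>
    (memLp_conv hp1 hp (hg j) (hκ j)).integrable_mul (hh j)
  have i2 : ∀ j, Integrable (fun x => g j x * conv μ (h j) (reflect (κ j)) x) μ := fun j =>
    (hg j).integrable_mul (memLp_conv hq1 hq (hh j) (hκ j).reflect)
  rw [integral_finsetSum _ fun j _ => i1 j, integral_finsetSum _ fun j _ => i2 j]
  exact Finset.sum_congr rfl fun j _ => integral_conv_mul hp (hg j) (hh j) (hκ j)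

/-- The vector valued inequality. Exponent `2` follows from Young's inequality in each term, and
exponents below `2` by duality. -/
lemma exists_eLpNorm_finSq_conv_le (hB : BallSystem μ B) (hk : ApproxId μ B θ A k)
    (hp1 : 1 < p) (hp2 : p < ∞) : ∃ C : ℝ≥0, ∀ (s : Finset ℕ) (g : ℕ → G → ℂ),
      (∀ j, MemLp (g j) p μ) →
      eLpNorm (finSq s fun j => conv μ (g j) (diff k j)) p μ ≤ C * eLpNorm (finSq s g) p μ := by
  have hd := hk.isKernel_diff
  rcases lt_trichotomy p 2 with h | rfl | h
  · -- below `2` by duality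
    obtain ⟨q, hpq, hq1, hqt, -, hq2⟩ := exists_holderConjugate hp1 hp2
    obtain ⟨C, hC⟩ := exists_eLpNorm_finSq_conv_le_of_two_lt hB (hk.reflectFamily hB) (hq2 h) hqt
    refine ⟨C, fun s g hg => ?_⟩
    have hcL : ∀ j, MemLp (conv μ (g j) (diff k j)) p μ := fun j =>
      memLp_conv hp1.le hp2.ne (hg j) (hd j)
    refine eLpNorm_finSq_le_of_dual hp2.ne hqt.ne hcL fun h hh => ?_
    have hd' := (hk.reflectFamily hB).isKernel_diff
    have hcL' : ∀ j, MemLp (conv μ (h j) (diff (fun j => reflect (k j)) j)) q μ := fun j =>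
      memLp_conv hq1.le hqt.ne (hh j) (hd' j)
    have e := integral_sum_conv_mul (s := s) hp2.ne hqt.ne hg hh hd
    simp only [reflect_diff] at e
    rw [e]
    refine (enorm_integral_sum_mul_le (p := p) (q := q) (fun j _ => (hg j).1)
      fun j _ => (hcL' j).1).trans ?_
    exact (mul_le_mul_right (hC s h hh) _).trans (le_of_eq (by ring))
  · -- on `L²` term by term
    refine ⟨2 * A, fun s g hg => ?_⟩
    have hsq : ∀ h : ℕ → G → ℂ, (∀ j, AEStronglyMeasurable (h j) μ) →
        eLpNorm (finSq s h) 2 μ = (∑ j ∈ s, eLpNorm (h j) 2 μ ^ 2) ^ (1 / 2 : ℝ) := by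
      intro h hh
      have e : ∀ u : G → ℂ, eLpNorm u 2 μ ^ 2 = ∫⁻ x, ‖u x‖ₑ ^ 2 ∂μ := fun u => by
        rw [eLpNorm_eq_lintegral_rpow_enorm_toReal (by simp) (by simp), ← ENNReal.rpow_natCast,
          ← ENNReal.rpow_mul]
        simp
      simp_rw [e]
      rw [← lintegral_finsetSum' _ fun j _ => (hh j).enorm.pow_const 2,
        eLpNorm_eq_lintegral_rpow_enorm_toReal (by simp) (by simp)]
      simp [enorm_finSq_sq]
    rw [hsq _ fun j => (hg j).1, hsq _ fun j => aestronglyMeasurable_conv (hg j).1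
        ((hd j).memLp 1).1]
    have e2 : ((2 * A : ℝ≥0) : ℝ≥0∞) = (((2 * A : ℝ≥0) : ℝ≥0∞) ^ 2) ^ (1 / 2 : ℝ) := by
      rw [← ENNReal.rpow_natCast, ← ENNReal.rpow_mul]; simp
    rw [e2, ← ENNReal.mul_rpow_of_nonneg _ _ (by positivity), Finset.mul_sum]
    refine ENNReal.rpow_le_rpow (Finset.sum_le_sum fun j _ => ?_) (by positivity)
    rw [← mul_pow]
    refine pow_le_pow_left' ((eLpNorm_conv_le one_le_two (by simp) (hg j).1
      ((hd j).memLp 1).1).trans ?_) 2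
    exact mul_le_mul_left (hk.eLpNorm_diff_le hB j) _
  · exact exists_eLpNorm_finSq_conv_le_of_two_lt hB hk h hp2

end SquareFunction

/-! ### The lower square function estimate -/

section LowerBound

lemma sum_range_eq_sum_diagonals {M : Type*} [AddCommMonoid M] (F : ℕ → ℕ → M) (n : ℕ) :
    ∑ i ∈ Finset.range n, ∑ j ∈ Finset.range n, F i j
      = ∑ ℓ ∈ Finset.range n, ∑ m ∈ Finset.range (n - ℓ), F m (m + ℓ)
        + ∑ ℓ ∈ Finset.range n, ∑ m ∈ Finset.range (n - 1 - ℓ), F (m + (ℓ + 1)) m := by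
  have h1 : ∀ i ∈ Finset.range n, ∑ j ∈ Finset.range n, F i j
      = ∑ ℓ ∈ Finset.range (n - i), F i (i + ℓ) + ∑ j ∈ Finset.range i, F i j := by
    intro i hi
    rw [add_comm, ← Finset.sum_Ico_eq_sum_range, Finset.range_eq_Ico, Finset.range_eq_Ico,
      Finset.sum_Ico_consecutive _ (Nat.zero_le i) (Finset.mem_range.1 hi).le]
  rw [Finset.sum_congr rfl h1, Finset.sum_add_distrib]
  congr 1
  · refine Finset.sum_comm' fun i ℓ => ?_
    simp only [Finset.mem_range]; lia
  · have h2 : ∑ i ∈ Finset.range n, ∑ j ∈ Finset.range i, F i j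
        = ∑ j ∈ Finset.range n, ∑ i ∈ Finset.Ico (j + 1) n, F i j := by
      refine Finset.sum_comm' fun i j => ?_
      simp only [Finset.mem_range, Finset.mem_Ico]; lia
    rw [h2]
    simp_rw [Finset.sum_Ico_eq_sum_range]
    rw [Finset.sum_comm' (t' := Finset.range n) (s' := fun ℓ => Finset.range (n - 1 - ℓ))]
    · refine Finset.sum_congr rfl fun ℓ _ => Finset.sum_congr rfl fun m _ => ?_
      rw [add_right_comm, add_assoc, add_comm ℓ 1, ← add_assoc, add_assoc m, add_comm 1 ℓ]
    · intro j ℓ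
      simp only [Finset.mem_range]; lia

variable {G : Type*} [Group G] [TopologicalSpace G] [IsTopologicalGroup G] [T2Space G]
  [SecondCountableTopology G] [LocallyCompactSpace G] [MeasurableSpace G] [BorelSpace G]
  {μ : Measure G} [μ.IsHaarMeasure] [μ.IsMulRightInvariant] [μ.IsInvInvariant]
  {B : ℕ → ℕ → Set G} {θ A : ℝ≥0} {k κ : ℕ → G → ℂ} {f K : G → ℂ} {p q : ℝ≥0∞}

lemma finSq_comp_le {α : Type*} {s t : Finset ℕ} {a : ℕ → ℕ} (ha : Function.Injective a)
    (hst : ∀ m ∈ s, a m ∈ t) (g : ℕ → α → ℂ) (x : α) :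
    finSq s (fun m => g (a m)) x ≤ finSq t g x := by
  refine Real.sqrt_le_sqrt ?_
  rw [← Finset.sum_image (f := fun j => ‖g j x‖ ^ 2) (g := a) (s := s) (ha.injOn)]
  refine Finset.sum_le_sum_of_subset_of_nonneg ?_ fun _ _ _ => by positivity
  intro j hj
  obtain ⟨m, hm, rfl⟩ := Finset.mem_image.1 hj
  exact hst m hm

/-- A single diagonal is controlled by the square function, by duality. -/
lemma exists_eLpNorm_diagonal_le [μ.InnerRegularCompactLTTop] (hB : BallSystem μ B)
    (hk : ApproxId μ B θ A k) (hθ0 : 0 < θ) (hθ1 : θ < 1) (hp1 : 1 < p) (hp2 : p < ∞) :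
    ∃ C : ℝ≥0, ∀ (s t : Finset ℕ) (a b : ℕ → ℕ), Function.Injective a → Function.Injective b →
      (∀ m ∈ s, a m ∈ t) → ∀ f, MemLp f p μ →
      eLpNorm (∑ m ∈ s, conv μ (conv μ f (diff k (a m))) (diff k (b m))) p μ
        ≤ C * eLpNorm (finSq t fun j => conv μ f (diff k j)) p μ := by
  obtain ⟨q, hpq, hq1, hqt, -, -⟩ := exists_holderConjugate hp1 hp2
  obtain ⟨C, hC⟩ := exists_eLpNorm_finSq_conv_diff_le hB (hk.reflectFamily hB) hθ0 hθ1 hq1 hqt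
  refine ⟨C, fun s t a b ha hb hst f hf => ?_⟩
  have hd := hk.isKernel_diff
  have hfd : ∀ j, MemLp (conv μ f (diff k j)) p μ := fun j => memLp_conv hp1.le hp2.ne hf (hd j)
  have hL : MemLp (∑ m ∈ s, conv μ (conv μ f (diff k (a m))) (diff k (b m))) p μ :=
    memLp_finsetSum' _ fun m _ => memLp_conv hp1.le hp2.ne (hfd _) (hd _)
  refine eLpNorm_le_of_dual hp2.ne hqt.ne hL fun v hv => ?_
  have hvd : ∀ j, MemLp (conv μ v (reflect (diff k j))) q μ := fun j =>
    memLp_conv hq1.le hqt.ne hv (hd j).reflect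
  have e := integral_sum_conv_mul (s := s) hp2.ne hqt.ne (g := fun m => conv μ f (diff k (a m)))
    (h := fun _ => v) (κ := fun m => diff k (b m)) (fun m => hfd _) (fun _ => hv) (fun m => hd _)
  simp only [Finset.sum_apply, Finset.sum_mul]
  rw [e]
  refine (enorm_integral_sum_mul_le (p := p) (q := q) (fun m _ => (hfd _).1)
    fun m _ => (hvd _).1).trans ?_
  have h1 : eLpNorm (finSq s fun m => conv μ f (diff k (a m))) p μ
      ≤ eLpNorm (finSq t fun j => conv μ f (diff k j)) p μ := by
    refine eLpNorm_mono_real fun x => ?_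
    rw [Real.norm_of_nonneg (finSq_nonneg x)]
    exact finSq_comp_le ha hst (fun j => conv μ f (diff k j)) x
  have h2 : eLpNorm (finSq s fun m => conv μ v (reflect (diff k (b m)))) q μ
      ≤ C * eLpNorm v q μ := by
    refine le_trans (eLpNorm_mono_real fun x => ?_) (hC (s.image b) v hv)
    rw [Real.norm_of_nonneg (finSq_nonneg x)]
    simp only [reflect_diff]
    exact finSq_comp_le hb (fun m hm => Finset.mem_image_of_mem b hm)
      (fun j => conv μ v (diff (fun j => reflect (k j)) j)) x
  exact (mul_le_mul' h1 h2).trans (le_of_eq (by ring))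

/-- A diagonal far from the main one has small norm. -/
lemma exists_eLpNorm_far_diagonal_le [μ.InnerRegularCompactLTTop] (hB : BallSystem μ B)
    (hk : ApproxId μ B θ A k) (hθ0 : 0 < θ) (hθ1 : θ < 1) (hp1 : 1 < p) (hp2 : p < ∞) :
    ∃ C : ℝ≥0, ∀ (s : Finset ℕ) (ℓ : ℕ) (a b : ℕ → ℕ),
      ((a = fun m => m) ∧ (b = fun m => m + ℓ) ∨ (a = fun m => m + ℓ) ∧ b = fun m => m) →
      ∀ f, MemLp f p μ →
      eLpNorm (∑ m ∈ s, conv μ (conv μ f (diff k (a m))) (diff k (b m))) p μ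
        ≤ C * θ ^ ℓ * eLpNorm f p μ := by
  obtain ⟨C, hC⟩ := exists_eLpNorm_conv_sum_le hB hk hθ1 hp1 hp2
  refine ⟨C * prodConst θ A, fun s ℓ a b hab f hf => ?_⟩
  have hd := hk.isKernel_diff
  have hloc := hf.locallyIntegrable hp1.le
  have h1 := hk.multiscale_conv_diff hB hθ0 hθ1 hab
  have h2 := (hk.reflectFamily hB).multiscale_conv_diff hB hθ0 hθ1 (a := b) (b := a) (ℓ := ℓ)
    (by tauto)
  have h3 := hC _ _ (mul_ne_zero (zero_lt_one.trans_le one_le_prodConst).ne'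
    (pow_ne_zero _ hθ0.ne')) h1 (by
      simp only [reflect_conv, reflect_diff]
      exact h2) s f hf
  rw [conv_sum_right s hloc fun m _ => (hd _).conv (hd _)] at h3
  simp only [fun m => (conv_assoc hloc (hd (a m)) (hd (b m))).symm] at h3
  refine h3.trans (le_of_eq ?_)
  push_cast
  ring

/-- The lower square function estimate, for `f` convolved twice with a member of the approximate
identity. -/
lemma exists_eLpNorm_conv_conv_le [μ.InnerRegularCompactLTTop] (hB : BallSystem μ B)
    (hk : ApproxId μ B θ A k) (hθ0 : 0 < θ) (hθ1 : θ < 1) (hp1 : 1 < p) (hp2 : p < ∞) :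
    ∃ C : ℝ≥0, ∀ (J : ℕ) (f : G → ℂ), MemLp f p μ →
      eLpNorm (conv μ (conv μ f (k J)) (k J)) p μ
        ≤ C * eLpNorm (finSq (Finset.range (J + 1)) fun j => conv μ f (diff k j)) p μ
          + 2⁻¹ * eLpNorm f p μ := by
  obtain ⟨C, hC⟩ := exists_eLpNorm_diagonal_le hB hk hθ0 hθ1 hp1 hp2
  obtain ⟨D, hD⟩ := exists_eLpNorm_far_diagonal_le hB hk hθ0 hθ1 hp1 hp2
  -- the diagonals beyond the first `N` together have norm at most `‖f‖ / 4`
  obtain ⟨N, hN⟩ : ∃ N, D * θ ^ N * (1 - θ)⁻¹ ≤ 4⁻¹ := by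
    have : Tendsto (fun N => D * θ ^ N * (1 - θ)⁻¹) atTop (𝓝 (D * 0 * (1 - θ)⁻¹)) :=
      ((NNReal.tendsto_pow_atTop_nhds_zero_of_lt_one hθ1).const_mul D).mul_const _
    rw [mul_zero, zero_mul] at this
    exact (this.eventually (Iic_mem_nhds (by norm_num))).exists
  refine ⟨2 * N * C, fun J f hf => ?_⟩
  have hd := hk.isKernel_diff
  have hloc := hf.locallyIntegrable hp1.le
  set n := J + 1 with hn
  set a := eLpNorm (finSq (Finset.range n) fun j => conv μ f (diff k j)) p μ with ha
  have hfd : ∀ j, MemLp (conv μ f (diff k j)) p μ := fun j => memLp_conv hp1.le hp2.ne hf (hd j)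
  set F : ℕ → ℕ → G → ℂ := fun i j => conv μ (conv μ f (diff k i)) (diff k j) with hF
  have hFm : ∀ i j, AEStronglyMeasurable (F i j) μ := fun i j =>
    (memLp_conv hp1.le hp2.ne (hfd i) (hd j)).1
  have hexp : conv μ (conv μ f (k J)) (k J)
      = ∑ i ∈ Finset.range n, ∑ j ∈ Finset.range n, F i j := by
    have e := sum_diff k J
    rw [← hn] at e
    rw [← e, conv_sum_right _ hloc fun j _ => hd j,
      conv_sum_left _ (fun j _ => (hfd j).locallyIntegrable hp1.le)
        (IsKernel.sum _ fun j _ => hd j)]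
    refine Finset.sum_congr rfl fun i _ => ?_
    rw [conv_sum_right _ ((hfd i).locallyIntegrable hp1.le) fun j _ => hd j]
  rw [hexp, sum_range_eq_sum_diagonals]
  -- both halves are sums over diagonals, of which the first `N` are treated by duality
  have hhalf : ∀ U : ℕ → G → ℂ, (∀ ℓ, AEStronglyMeasurable (U ℓ) μ) →
      (∀ ℓ, eLpNorm (U ℓ) p μ ≤ C * a) →
      (∀ ℓ, eLpNorm (U ℓ) p μ ≤ D * θ ^ ℓ * eLpNorm f p μ) →
      eLpNorm (∑ ℓ ∈ Finset.range n, U ℓ) p μ ≤ N * (C * a) + 4⁻¹ * eLpNorm f p μ := by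
    intro U hU h1 h2
    refine (eLpNorm_sum_le (fun ℓ _ => hU ℓ) hp1.le).trans ?_
    rw [← Finset.sum_filter_add_sum_filter_not _ (fun ℓ => ℓ < N)]
    refine add_le_add ?_ ?_
    · refine (Finset.sum_le_card_nsmul _ _ (C * a) fun ℓ _ => h1 ℓ).trans ?_
      rw [nsmul_eq_mul]
      refine mul_le_mul_left ?_ _
      have : ((Finset.range n).filter (fun ℓ => ℓ < N)).card ≤ N := by
        refine (Finset.card_le_card (t := Finset.range N) fun ℓ hℓ => ?_).trans (by simp)
        simpa using (Finset.mem_filter.1 hℓ).2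
      exact_mod_cast this
    · refine (Finset.sum_le_sum fun ℓ _ => h2 ℓ).trans ?_
      rw [← Finset.sum_mul]
      refine mul_le_mul_left ?_ _
      have h3 : ∑ ℓ ∈ Finset.range n with ¬ ℓ < N, D * θ ^ ℓ ≤ D * θ ^ N * (1 - θ)⁻¹ := by
        rw [mul_assoc, ← Finset.mul_sum, ← NNReal.tsum_geometric hθ1, ← NNReal.tsum_mul_left]
        refine mul_le_mul_right ?_ D
        have hs : Summable fun i => θ ^ N * θ ^ i := (NNReal.summable_geometric hθ1).mul_left _
        calc ∑ ℓ ∈ Finset.range n with ¬ ℓ < N, θ ^ ℓ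
            ≤ ∑ ℓ ∈ (Finset.range n).image (fun i => N + i), θ ^ ℓ := by
              refine Finset.sum_le_sum_of_subset fun ℓ hℓ => ?_
              simp only [Finset.mem_filter, Finset.mem_range, not_lt] at hℓ
              exact Finset.mem_image.2 ⟨ℓ - N, by simp; lia, by lia⟩
          _ = ∑ i ∈ Finset.range n, θ ^ N * θ ^ i := by
              rw [Finset.sum_image (by intro x _ y _ h; simpa using h)]
              simp_rw [pow_add]
          _ ≤ _ := hs.sum_le_tsum _ fun i _ => by positivity
      have h4 := h3.trans hN
      have h5 : ((∑ ℓ ∈ Finset.range n with ¬ ℓ < N, D * θ ^ ℓ : ℝ≥0) : ℝ≥0∞)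
          ≤ ((4⁻¹ : ℝ≥0) : ℝ≥0∞) := by exact_mod_cast h4
      push_cast at h5
      simpa using h5
  have hsm : ∀ (s : Finset ℕ) (a b : ℕ → ℕ),
      AEStronglyMeasurable (∑ m ∈ s, F (a m) (b m)) μ := fun s a b =>
    Finset.aestronglyMeasurable_sum _ fun m _ => hFm _ _
  have hadd : ∀ ℓ : ℕ, Function.Injective fun m => m + ℓ := fun ℓ => add_left_injective ℓ
  refine (eLpNorm_add_le (Finset.aestronglyMeasurable_sum _ fun ℓ _ => hsm _ _ _)
    (Finset.aestronglyMeasurable_sum _ fun ℓ _ => hsm _ _ _) hp1.le).trans ?_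
  have g1 := hhalf (fun ℓ => ∑ m ∈ Finset.range (n - ℓ), F m (m + ℓ)) (fun ℓ => hsm _ _ _)
    (fun ℓ => hC _ (Finset.range n) (fun m => m) (fun m => m + ℓ) (fun _ _ h => h) (hadd ℓ)
      (fun m hm => by simp only [Finset.mem_range] at hm ⊢; lia) f hf)
    (fun ℓ => hD _ ℓ (fun m => m) (fun m => m + ℓ) (Or.inl ⟨rfl, rfl⟩) f hf)
  have g2 := hhalf (fun ℓ => ∑ m ∈ Finset.range (n - 1 - ℓ), F (m + (ℓ + 1)) m)
    (fun ℓ => hsm _ _ _)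
    (fun ℓ => hC _ (Finset.range n) (fun m => m + (ℓ + 1)) (fun m => m) (hadd _) (fun _ _ h => h)
      (fun m hm => by simp only [Finset.mem_range] at hm ⊢; lia) f hf)
    (fun ℓ => (hD _ (ℓ + 1) (fun m => m + (ℓ + 1)) (fun m => m) (Or.inr ⟨rfl, rfl⟩) f hf).trans (by
      gcongr ?_ * _
      rw [pow_succ]
      have : (θ : ℝ≥0∞) ≤ 1 := by exact_mod_cast hθ1.le
      exact mul_le_mul_right (mul_le_of_le_one_right' this) _))
  refine (add_le_add g1 g2).trans (le_of_eq ?_)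
  have h4 : (4⁻¹ : ℝ≥0∞) + 4⁻¹ = 2⁻¹ := by
    rw [← two_mul, show (4 : ℝ≥0∞) = 2 * 2 by norm_num, ENNReal.mul_inv (by simp) (by simp),
      ← mul_assoc, ENNReal.mul_inv_cancel (by simp) (by simp), one_mul]
  calc _ = 2 * N * C * a + (4⁻¹ + 4⁻¹) * eLpNorm f p μ := by ring
    _ = _ := by rw [h4]; push_cast; rfl

/-- The lower square function estimate: `f * k J * k J` tends to `f`, and the term `‖f‖ / 2` is
absorbed. -/
lemma exists_eLpNorm_le_finSq [μ.InnerRegularCompactLTTop] (hB : BallSystem μ B)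
    (hk : ApproxId μ B θ A k) (hθ0 : 0 < θ) (hθ1 : θ < 1) (hp1 : 1 < p) (hp2 : p < ∞) :
    ∃ C : ℝ≥0, ∀ (f : G → ℂ), MemLp f p μ → ∀ b : ℝ≥0∞,
      (∀ n, eLpNorm (finSq (Finset.range n) fun j => conv μ f (diff k j)) p μ ≤ b) →
      eLpNorm f p μ ≤ C * b := by
  obtain ⟨C, hC⟩ := exists_eLpNorm_conv_conv_le hB hk hθ0 hθ1 hp1 hp2
  refine ⟨2 * C, fun f hf b hb => ?_⟩
  have hkk := hk.isKernel
  have hfk : ∀ J, MemLp (conv μ f (k J)) p μ := fun J => memLp_conv hp1.le hp2.ne hf (hkk J)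
  have hlim := tendsto_eLpNorm_conv_sub_self hp1.le hp2.ne hf hkk hk.integral_eq_one
    (fun j => hk.eLpNorm_le hB j) fun U hU => by
      filter_upwards [hB.shrink 0 U hU] with j hj y hy
      exact hj (by_contra fun h => hy (hk.support j y h))
  have hbound : ∀ J, eLpNorm f p μ ≤ (A + 1) * eLpNorm (conv μ f (k J) - f) p μ
      + (C * b + 2⁻¹ * eLpNorm f p μ) := by
    intro J
    have hsubL : MemLp (conv μ f (k J) - f) p μ := (hfk J).sub hf
    have hcc : MemLp (conv μ (conv μ f (k J)) (k J)) p μ :=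
      memLp_conv hp1.le hp2.ne (hfk J) (hkk J)
    have e : f = conv μ (conv μ f (k J)) (k J)
        - (conv μ (conv μ f (k J) - f) (k J) + (conv μ f (k J) - f)) := by
      rw [conv_sub_left ((hfk J).locallyIntegrable hp1.le) (hf.locallyIntegrable hp1.le) (hkk J)]
      abel
    have h1 : eLpNorm (conv μ (conv μ f (k J) - f) (k J)) p μ
        ≤ A * eLpNorm (conv μ f (k J) - f) p μ :=
      (eLpNorm_conv_le hp1.le hp2.ne hsubL.1 ((hkk J).memLp 1).1).trans
        (mul_le_mul_left (hk.eLpNorm_le hB J) _)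
    have hm : MemLp (conv μ (conv μ f (k J) - f) (k J)) p μ :=
      memLp_conv hp1.le hp2.ne hsubL (hkk J)
    calc eLpNorm f p μ = eLpNorm (conv μ (conv μ f (k J)) (k J)
        - (conv μ (conv μ f (k J) - f) (k J) + (conv μ f (k J) - f))) p μ := by rw [← e]
      _ ≤ eLpNorm (conv μ (conv μ f (k J)) (k J)) p μ
          + (eLpNorm (conv μ (conv μ f (k J) - f) (k J)) p μ
            + eLpNorm (conv μ f (k J) - f) p μ) :=
          (eLpNorm_sub_le hcc.1 (hm.add hsubL).1 hp1.le).trans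
            (add_le_add_right (eLpNorm_add_le hm.1 hsubL.1 hp1.le) _)
      _ ≤ (C * b + 2⁻¹ * eLpNorm f p μ) + (A * eLpNorm (conv μ f (k J) - f) p μ
            + eLpNorm (conv μ f (k J) - f) p μ) := by
          gcongr
          exact (hC J f hf).trans (by gcongr; exact hb _)
      _ = _ := by ring
  have hle : eLpNorm f p μ ≤ C * b + 2⁻¹ * eLpNorm f p μ := by
    have h0 : Tendsto (fun J => (A + 1) * eLpNorm (conv μ f (k J) - f) p μ
        + (C * b + 2⁻¹ * eLpNorm f p μ)) atTop
        (𝓝 ((A + 1) * 0 + (C * b + 2⁻¹ * eLpNorm f p μ))) :=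
      (ENNReal.Tendsto.const_mul hlim (Or.inr (by finiteness))).add_const _
    rw [mul_zero, zero_add] at h0
    exact ge_of_tendsto' h0 hbound
  have hhalf : eLpNorm f p μ = 2⁻¹ * eLpNorm f p μ + 2⁻¹ * eLpNorm f p μ := by
    rw [← add_mul, ENNReal.inv_two_add_inv_two, one_mul]
  have hfin : 2⁻¹ * eLpNorm f p μ ≠ ∞ := ENNReal.mul_ne_top (by simp) hf.2.ne
  have h5 : 2⁻¹ * eLpNorm f p μ ≤ C * b := by
    nth_rewrite 1 [hhalf] at hle
    exact (ENNReal.add_le_add_iff_right hfin).1 hle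
  calc eLpNorm f p μ = 2 * (2⁻¹ * eLpNorm f p μ) := by
        rw [← mul_assoc, ENNReal.mul_inv_cancel (by simp) (by simp), one_mul]
    _ ≤ 2 * (C * b) := mul_le_mul_right h5 _
    _ = _ := by push_cast; ring

end LowerBound

section InfiniteSquare

variable {α : Type*} [MeasurableSpace α] {μ : Measure α} {p : ℝ≥0∞} {g : ℕ → α → ℂ}

lemma enorm_finSq (s : Finset ℕ) (x : α) :
    ‖finSq s g x‖ₑ = (∑ j ∈ s, ‖g j x‖ₑ ^ 2) ^ (1 / 2 : ℝ) := by
  rw [← enorm_finSq_sq, ← ENNReal.rpow_natCast, ← ENNReal.rpow_mul]; simp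

lemma eLpNorm_finSq_le_tsum (s : Finset ℕ) :
    eLpNorm (finSq s g) p μ ≤ eLpNorm (fun x => (∑' j, ‖g j x‖ₑ ^ 2) ^ (1 / 2 : ℝ)) p μ := by
  refine eLpNorm_mono_enorm fun x => ?_
  rw [enorm_finSq, enorm_eq_self]
  exact ENNReal.rpow_le_rpow (ENNReal.sum_le_tsum _) (by positivity)

lemma eLpNorm_tsum_le_of_finSq (hp0 : p ≠ 0) (hp : p ≠ ∞)
    (hg : ∀ j, AEStronglyMeasurable (g j) μ) {b : ℝ≥0∞}
    (hb : ∀ n, eLpNorm (finSq (Finset.range n) g) p μ ≤ b) :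
    eLpNorm (fun x => (∑' j, ‖g j x‖ₑ ^ 2) ^ (1 / 2 : ℝ)) p μ ≤ b := by
  have hP : 0 < p.toReal := ENNReal.toReal_pos hp0 hp
  have h1 : ∀ x, ‖(∑' j, ‖g j x‖ₑ ^ 2) ^ (1 / 2 : ℝ)‖ₑ ^ p.toReal
      = ⨆ n, ‖finSq (Finset.range n) g x‖ₑ ^ p.toReal := fun x => by
    simp_rw [enorm_finSq, enorm_eq_self, ← ENNReal.rpow_mul, ENNReal.tsum_eq_iSup_nat]
    have hpos : 0 < 1 / 2 * p.toReal := by positivity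
    exact (ENNReal.orderIsoRpow _ hpos).map_iSup _
  rw [eLpNorm_eq_lintegral_rpow_enorm_toReal hp0 hp]
  simp_rw [h1]
  rw [lintegral_iSup']
  · rw [one_div, ENNReal.rpow_inv_le_iff hP]
    refine iSup_le fun n => ?_
    have := hb n
    rwa [eLpNorm_eq_lintegral_rpow_enorm_toReal hp0 hp, one_div, ENNReal.rpow_inv_le_iff hP] at this
  · exact fun n => (aestronglyMeasurable_finSq fun j _ => hg j).enorm.pow_const _
  · refine ae_of_all _ fun x m n hmn => ENNReal.rpow_le_rpow ?_ hP.le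
    rw [enorm_finSq, enorm_finSq]
    exact ENNReal.rpow_le_rpow (Finset.sum_le_sum_of_subset (Finset.range_mono hmn)) (by positivity)

end InfiniteSquare

end GroupLP

namespace HeisenbergLP

/-! ### The curve: monotonicity and growth -/

section Curve

lemma le_of_hasDerivAt_nonneg {f f' : ℝ → ℝ} {t s : ℝ} (hts : t ≤ s)
    (h : ∀ x ∈ Set.Icc t s, HasDerivAt f (f' x) x) (h0 : ∀ x ∈ Set.Icc t s, 0 ≤ f' x) :
    f t ≤ f s := by
  refine monotoneOn_of_deriv_nonneg (convex_Icc t s)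
    (fun x hx => (h x hx).continuousAt.continuousWithinAt)
    (fun x hx => (h x (interior_subset hx)).differentiableAt.differentiableWithinAt)
    (fun x hx => ?_) (Set.left_mem_Icc.2 hts) (Set.right_mem_Icc.2 hts) hts
  rw [(h x (interior_subset hx)).deriv]
  exact h0 x (interior_subset hx)

/-- The differential inequality `φ' ≥ c φ / t` forces a gain under halving the argument. -/
lemma le_rpow_mul_of_growth {φ : ℝ → ℝ} {c : ℝ} (hd : ∀ t, 0 < t → DifferentiableAt ℝ φ t)
    (hc : ∀ t, 0 < t → c * (φ t / t) ≤ deriv φ t) {t : ℝ} (ht : 0 < t) :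
    φ t ≤ (2 : ℝ) ^ (-c) * φ (2 * t) := by
  have h := le_of_hasDerivAt_nonneg (f := fun x => φ x * x ^ (-c))
    (f' := fun x => deriv φ x * x ^ (-c) + φ x * (-c * x ^ (-c - 1))) (t := t) (s := 2 * t)
    (by linarith) (fun x hx => ?_) fun x hx => ?_
  · rw [Real.mul_rpow zero_le_two ht.le] at h
    have hp : 0 < t ^ (-c) := Real.rpow_pos_of_pos ht _
    refine le_of_mul_le_mul_right (h.trans (le_of_eq ?_)) hp
    ring
  · have hx0 : 0 < x := ht.trans_le hx.1
    exact (hd x hx0).hasDerivAt.mul (Real.hasDerivAt_rpow_const (Or.inl hx0.ne'))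
  · have hx0 : 0 < x := ht.trans_le hx.1
    have h1 := hc x hx0
    have e : x ^ (-c - 1) = x ^ (-c) / x := Real.rpow_sub_one hx0.ne' _
    have hp : 0 < x ^ (-c) := Real.rpow_pos_of_pos hx0 _
    rw [e]
    have : deriv φ x * x ^ (-c) + φ x * (-c * (x ^ (-c) / x))
        = (deriv φ x - c * (φ x / x)) * x ^ (-c) := by ring
    rw [this]
    exact mul_nonneg (by linarith) hp.le

variable {α β : ℝ → ℝ} {t s : ℝ}

lemma AdmissibleCurve.alpha_zero (hΓ : AdmissibleCurve α β) : α 0 = 0 := by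
  have := hΓ.odd_alpha 0
  simp at this
  linarith

lemma hasDerivAt_of_contDiffOn {γ : ℝ → ℝ} (hγ : ContDiffOn ℝ 3 γ (Set.Ioi 0)) (ht : 0 < t) :
    HasDerivAt γ (deriv γ t) t :=
  ((hγ.contDiffAt (Ioi_mem_nhds ht)).differentiableAt (by norm_num)).hasDerivAt

lemma hasDerivAt_deriv_of_contDiffOn {γ : ℝ → ℝ} (hγ : ContDiffOn ℝ 3 γ (Set.Ioi 0)) (ht : 0 < t) :
    HasDerivAt (deriv γ) (iteratedDeriv 2 γ t) t := by
  have h3 : ContDiffOn ℝ (2 + 1) γ (Set.Ioi 0) := by convert hγ; norm_num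
  have h := ((contDiffOn_succ_iff_deriv_of_isOpen isOpen_Ioi).1 h3).2.2
  rw [iteratedDeriv_succ, iteratedDeriv_one]
  exact ((h.contDiffAt (Ioi_mem_nhds ht)).differentiableAt (by norm_num)).hasDerivAt

lemma AdmissibleCurve.hasDerivAt_h2 (hΓ : AdmissibleCurve α β) (ht : 0 < t) :
    HasDerivAt (h2 α) (t * D2 α t) t := by
  have h := ((hasDerivAt_id t).mul (hasDerivAt_deriv_of_contDiffOn hΓ.contDiffOn_alpha ht)).sub
    (hasDerivAt_of_contDiffOn hΓ.contDiffOn_alpha ht)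
  exact HasDerivAt.congr_deriv (f := h2 α) h (by simp [D2])

lemma AdmissibleCurve.h2_le (hΓ : AdmissibleCurve α β) (ht : 0 < t) (hts : t ≤ s) :
    h2 α t ≤ h2 α s :=
  le_of_hasDerivAt_nonneg hts (fun _ hx => hΓ.hasDerivAt_h2 (ht.trans_le hx.1)) fun x hx =>
    mul_nonneg (ht.le.trans hx.1) (hΓ.D2_pos x (ht.trans_le hx.1)).le

lemma AdmissibleCurve.h2_pos (hΓ : AdmissibleCurve α β) (ht : 0 < t) : 0 < h2 α t := by
  have hmono : StrictMonoOn (deriv α) (Set.Ioi 0) := by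
    refine strictMonoOn_of_deriv_pos (convex_Ioi 0) (fun x hx =>
      (hasDerivAt_deriv_of_contDiffOn hΓ.contDiffOn_alpha hx).continuousAt.continuousWithinAt)
      fun x hx => ?_
    rw [interior_Ioi] at hx
    rw [(hasDerivAt_deriv_of_contDiffOn hΓ.contDiffOn_alpha hx).deriv]
    exact hΓ.D2_pos x hx
  obtain ⟨ξ, hξ, e⟩ := exists_hasDerivAt_eq_slope α (deriv α) ht hΓ.continuous_alpha.continuousOn
    fun x hx => hasDerivAt_of_contDiffOn hΓ.contDiffOn_alpha hx.1
  have h1 := hmono (Set.mem_Ioi.2 hξ.1) (Set.mem_Ioi.2 ht) hξ.2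
  rw [e, hΓ.alpha_zero, sub_zero, sub_zero, div_lt_iff₀ ht] at h1
  rw [h2]
  linarith

lemma AdmissibleCurve.intervalIntegrable_h2 (hΓ : AdmissibleCurve α β) (ht : 0 < t) :
    IntervalIntegrable (h2 α) volume 0 t := by
  -- at the origin `h2 α 0 = 0` whatever the value of the derivative is
  refine MonotoneOn.intervalIntegrable fun x hx y hy hxy => ?_
  rw [Set.uIcc_of_le ht.le] at hx hy
  have h0 : h2 α 0 = 0 := by simp [h2, hΓ.alpha_zero]
  rcases hx.1.eq_or_lt with rfl | hx0
  · rcases hy.1.eq_or_lt with rfl | hy0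
    · exact le_rfl
    · rw [h0]; exact (hΓ.h2_pos hy0).le
  · exact hΓ.h2_le hx0 hxy

lemma AdmissibleCurve.h3Bar_pos (hΓ : AdmissibleCurve α β) (ht : 0 < t) : 0 < h3Bar α β t := by
  obtain ⟨c, hc, h⟩ := hΓ.h3Bar_dominates
  refine lt_of_lt_of_le (mul_pos hc ?_) (h t ht)
  exact intervalIntegral.intervalIntegral_pos_of_pos_on (hΓ.intervalIntegrable_h2 ht)
    (fun x hx => hΓ.h2_pos hx.1) ht

lemma AdmissibleCurve.deriv_h3Bar_pos (hΓ : AdmissibleCurve α β) (ht : 0 < t) :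
    0 < deriv (h3Bar α β) t := by
  obtain ⟨c, hc, h⟩ := hΓ.h3Bar_growth
  exact lt_of_lt_of_le (mul_pos hc (div_pos (hΓ.h3Bar_pos ht) ht)) (h t ht)

lemma AdmissibleCurve.differentiableAt_h3Bar (hΓ : AdmissibleCurve α β) (ht : 0 < t) :
    DifferentiableAt ℝ (h3Bar α β) t :=
  -- a nonzero value of `deriv` is never a junk value
  differentiableAt_of_deriv_ne_zero (hΓ.deriv_h3Bar_pos ht).ne'

lemma AdmissibleCurve.h3Bar_le (hΓ : AdmissibleCurve α β) (ht : 0 < t) (hts : t ≤ s) :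
    h3Bar α β t ≤ h3Bar α β s :=
  le_of_hasDerivAt_nonneg hts
    (fun _ hx => (hΓ.differentiableAt_h3Bar (ht.trans_le hx.1)).hasDerivAt) fun _ hx =>
    (hΓ.deriv_h3Bar_pos (ht.trans_le hx.1)).le

lemma AdmissibleCurve.hasDerivAt_betaBar' (hΓ : AdmissibleCurve α β) (ht : 0 < t) :
    HasDerivAt (betaBar α β) (deriv β t - 1 / 2 * h2 α t) t := by
  have hcont : ContinuousOn (h2 α) (Set.Ioi 0) := fun x hx =>
    (hΓ.hasDerivAt_h2 hx).continuousAt.continuousWithinAt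
  exact (hasDerivAt_of_contDiffOn hΓ.contDiffOn_beta ht).sub
    ((intervalIntegral.integral_hasDerivAt_right (hΓ.intervalIntegrable_h2 ht)
      (hcont.stronglyMeasurableAtFilter isOpen_Ioi t ht)
      (hΓ.hasDerivAt_h2 ht).continuousAt).const_mul _)

lemma AdmissibleCurve.hasDerivAt_betaBar (hΓ : AdmissibleCurve α β) (ht : 0 < t) :
    HasDerivAt (betaBar α β) (deriv (betaBar α β) t) t :=
  (hΓ.hasDerivAt_betaBar' ht).differentiableAt.hasDerivAt

lemma AdmissibleCurve.hasDerivAt_deriv_betaBar (hΓ : AdmissibleCurve α β) (ht : 0 < t) :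
    HasDerivAt (deriv (betaBar α β)) (iteratedDeriv 2 (betaBar α β) t) t := by
  rw [iteratedDeriv_succ, iteratedDeriv_one]
  refine DifferentiableAt.hasDerivAt ?_
  have h := (hasDerivAt_deriv_of_contDiffOn hΓ.contDiffOn_beta ht).sub
    ((hΓ.hasDerivAt_h2 ht).const_mul (1 / 2))
  refine h.differentiableAt.congr_of_eventuallyEq ?_
  filter_upwards [Ioi_mem_nhds ht] with x hx
  exact (hΓ.hasDerivAt_betaBar' hx).deriv

lemma AdmissibleCurve.hasDerivAt_hBetaBar (hΓ : AdmissibleCurve α β) (ht : 0 < t) :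
    HasDerivAt (hBetaBar α β) (t * iteratedDeriv 2 (betaBar α β) t) t := by
  have h := ((hasDerivAt_id t).mul (hΓ.hasDerivAt_deriv_betaBar ht)).sub (hΓ.hasDerivAt_betaBar ht)
  exact HasDerivAt.congr_deriv (f := hBetaBar α β) h (by simp)

/-- The determinant `N̄₃` in terms of `h₂` and `h̄_β`. -/
lemma AdmissibleCurve.h3Bar_mul (hΓ : AdmissibleCurve α β) (ht : 0 < t) : h3Bar α β t * D2 α t
    = iteratedDeriv 2 (betaBar α β) t * h2 α t - D2 α t * hBetaBar α β t := by
  rw [h3Bar, div_mul_cancel₀ _ (hΓ.D2_pos t ht).ne', N3Bar, Matrix.det_fin_three]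
  simp [h2, hBetaBar, D2]
  ring

/-- The slope `h̄_β / h₂` has derivative `t α'' h̄₃ / h₂²`, which is positive. -/
lemma AdmissibleCurve.hasDerivAt_slope (hΓ : AdmissibleCurve α β) (ht : 0 < t) :
    HasDerivAt (fun x => hBetaBar α β x / h2 α x)
      (t * D2 α t * h3Bar α β t / h2 α t ^ 2) t := by
  have h := (hΓ.hasDerivAt_hBetaBar ht).div (hΓ.hasDerivAt_h2 ht) (hΓ.h2_pos ht).ne'
  refine HasDerivAt.congr_deriv (f := fun x => hBetaBar α β x / h2 α x) h ?_
  congr 1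
  linear_combination -t * hΓ.h3Bar_mul ht

lemma AdmissibleCurve.slope_le (hΓ : AdmissibleCurve α β) (ht : 0 < t) (hts : t ≤ s) :
    hBetaBar α β t / h2 α t ≤ hBetaBar α β s / h2 α s :=
  le_of_hasDerivAt_nonneg hts (fun _ hx => hΓ.hasDerivAt_slope (ht.trans_le hx.1)) fun x hx => by
    have hx0 := ht.trans_le hx.1
    have := hΓ.D2_pos x hx0
    have := hΓ.h3Bar_pos hx0
    positivity

/-- The derivative of the slope is at most `h̄₃(s)` times that of `-1 / h₂` on `[t, s]`. -/
lemma AdmissibleCurve.slope_sub_le (hΓ : AdmissibleCurve α β) (ht : 0 < t) (hts : t ≤ s) :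
    h2 α t * (hBetaBar α β s / h2 α s - hBetaBar α β t / h2 α t) ≤ h3Bar α β s := by
  have h := le_of_hasDerivAt_nonneg
    (f := fun x => -(hBetaBar α β x / h2 α x) - h3Bar α β s * (h2 α x)⁻¹)
    (f' := fun x => -(x * D2 α x * h3Bar α β x / h2 α x ^ 2)
      - h3Bar α β s * (-(x * D2 α x) / h2 α x ^ 2)) hts
    (fun x hx => (hΓ.hasDerivAt_slope (ht.trans_le hx.1)).neg.sub
      (((hΓ.hasDerivAt_h2 (ht.trans_le hx.1)).inv (hΓ.h2_pos (ht.trans_le hx.1)).ne').const_mul _))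
    fun x hx => by
      have hx0 := ht.trans_le hx.1
      have h1 := hΓ.D2_pos x hx0
      have h4 := hΓ.h3Bar_le hx0 hx.2
      have e : -(x * D2 α x * h3Bar α β x / h2 α x ^ 2)
          - h3Bar α β s * (-(x * D2 α x) / h2 α x ^ 2)
          = x * D2 α x / h2 α x ^ 2 * (h3Bar α β s - h3Bar α β x) := by ring
      rw [e]
      exact mul_nonneg (by positivity) (by linarith)
  have ht2 := hΓ.h2_pos ht
  have hs2 := hΓ.h2_pos (ht.trans_le hts)
  have hs3 := hΓ.h3Bar_pos (ht.trans_le hts)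
  have h1 : hBetaBar α β s / h2 α s - hBetaBar α β t / h2 α t ≤ h3Bar α β s * (h2 α t)⁻¹ := by
    have : 0 ≤ h3Bar α β s * (h2 α s)⁻¹ := by positivity
    linarith
  calc _ ≤ h2 α t * (h3Bar α β s * (h2 α t)⁻¹) := mul_le_mul_of_nonneg_left h1 ht2.le
    _ = _ := by field_simp

lemma hasDerivAt_div_id {γ : ℝ → ℝ} {γ' : ℝ} (h : HasDerivAt γ γ' t) (ht : 0 < t) :
    HasDerivAt (fun x => γ x / x) ((t * γ' - γ t) / t ^ 2) t := by
  refine HasDerivAt.congr_deriv (f := fun x => γ x / x) (h.div (hasDerivAt_id t) ht.ne') ?_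
  simp [mul_comm]

/-- A bound for the entry `(2,1)` of the transition matrix `Ã(s)⁻¹ Ã(t)`, which is the left-hand
side divided by `h₂(s)`. -/
lemma AdmissibleCurve.abs_entry_two_one_le (hΓ : AdmissibleCurve α β) (ht : 0 < t) (hts : t ≤ s) :
    |α t - t / s * α s| ≤ h2 α s := by
  have hs := ht.trans_le hts
  have hd : ∀ x ∈ Set.Icc t s, HasDerivAt (fun x => α x / x) (h2 α x / x ^ 2) x := fun x hx =>
    hasDerivAt_div_id (hasDerivAt_of_contDiffOn hΓ.contDiffOn_alpha (ht.trans_le hx.1))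
      (ht.trans_le hx.1)
  have h1 := le_of_hasDerivAt_nonneg hts hd fun x hx => by
    have := hΓ.h2_pos (ht.trans_le hx.1)
    positivity
  have h3 := le_of_hasDerivAt_nonneg (f := fun x => -(α x / x) - h2 α s * x⁻¹)
    (f' := fun x => -(h2 α x / x ^ 2) - h2 α s * (-(x ^ 2)⁻¹)) hts
    (fun x hx => (hd x hx).neg.sub ((hasDerivAt_inv (ht.trans_le hx.1).ne').const_mul _))
    fun x hx => by
      have e : -(h2 α x / x ^ 2) - h2 α s * (-(x ^ 2)⁻¹) = (h2 α s - h2 α x) * (x ^ 2)⁻¹ := by ring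
      rw [e]
      exact mul_nonneg (sub_nonneg.2 (hΓ.h2_le (ht.trans_le hx.1) hx.2)) (by positivity)
  have e1 : α t - t / s * α s = t * (α t / t - α s / s) := by field_simp
  rw [e1, abs_le]
  have hs2 := hΓ.h2_pos hs
  have e2 : t * (h2 α s * t⁻¹) = h2 α s := by field_simp
  have h4 : 0 ≤ h2 α s * s⁻¹ := by positivity
  constructor
  · have : α s / s - α t / t ≤ h2 α s * t⁻¹ := by linarith
    have := mul_le_mul_of_nonneg_left this ht.le
    linarith
  · have := mul_nonneg ht.le (sub_nonneg.2 h1)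
    linarith

/-- A bound for the entry `(3,2)` of the transition matrix, which is the left-hand side divided by
`s h₂(s) + h̄₃(s)`. -/
lemma AdmissibleCurve.abs_entry_three_two_le (hΓ : AdmissibleCurve α β) (ht : 0 < t) (hts : t ≤ s) :
    |hBetaBar α β t - hBetaBar α β s * (h2 α t / h2 α s)| ≤ h3Bar α β s := by
  have h1 := hΓ.slope_le ht hts
  have h3 := hΓ.slope_sub_le ht hts
  have ht2 := hΓ.h2_pos ht
  have hs2 := hΓ.h2_pos (ht.trans_le hts)
  have hs3 := hΓ.h3Bar_pos (ht.trans_le hts)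
  have e : hBetaBar α β t - hBetaBar α β s * (h2 α t / h2 α s)
      = -(h2 α t * (hBetaBar α β s / h2 α s - hBetaBar α β t / h2 α t)) := by
    field_simp; ring
  rw [e, abs_neg, abs_of_nonneg (mul_nonneg ht2.le (sub_nonneg.2 h1))]
  exact h3

/-- A bound for the entry `(3,1)` of the transition matrix, which is the left-hand side divided by
`s h₂(s) + h̄₃(s)`. -/
lemma AdmissibleCurve.abs_entry_three_one_le (hΓ : AdmissibleCurve α β) (ht : 0 < t) (hts : t ≤ s) :
    |betaBar α β t - t / s * betaBar α β s
      - hBetaBar α β s * ((α t - t / s * α s) / h2 α s)| ≤ h3Bar α β s := by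
  have hs := ht.trans_le hts
  set m := hBetaBar α β s / h2 α s with hm
  have hd : ∀ x ∈ Set.Icc t s, HasDerivAt (fun x => (betaBar α β x - m * α x) / x)
      (-(h2 α x * (m - hBetaBar α β x / h2 α x)) / x ^ 2) x := fun x hx => by
    have hx0 := ht.trans_le hx.1
    have := hasDerivAt_div_id ((hΓ.hasDerivAt_betaBar hx0).sub
      ((hasDerivAt_of_contDiffOn hΓ.contDiffOn_alpha hx0).const_mul m)) hx0
    refine HasDerivAt.congr_deriv (f := fun x => (betaBar α β x - m * α x) / x) this ?_
    have h2x := (hΓ.h2_pos hx0).ne'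
    have e : h2 α x * (m - hBetaBar α β x / h2 α x) = h2 α x * m - hBetaBar α β x := by field_simp
    rw [e, hBetaBar, h2]
    simp only [Pi.sub_apply]
    ring
  have hb : ∀ x ∈ Set.Icc t s, 0 ≤ h2 α x * (m - hBetaBar α β x / h2 α x) ∧
      h2 α x * (m - hBetaBar α β x / h2 α x) ≤ h3Bar α β s := fun x hx => by
    have hx0 := ht.trans_le hx.1
    exact ⟨mul_nonneg (hΓ.h2_pos hx0).le (sub_nonneg.2 (hΓ.slope_le hx0 hx.2)),
      hΓ.slope_sub_le hx0 hx.2⟩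
  have h1 := le_of_hasDerivAt_nonneg hts (fun x hx => (hd x hx).neg) fun x hx => by
    have := (hb x hx).1
    rw [neg_div, neg_neg]
    positivity
  have h3 := le_of_hasDerivAt_nonneg
    (f := fun x => (betaBar α β x - m * α x) / x - h3Bar α β s * x⁻¹)
    (f' := fun x => -(h2 α x * (m - hBetaBar α β x / h2 α x)) / x ^ 2
      - h3Bar α β s * (-(x ^ 2)⁻¹)) hts
    (fun x hx => (hd x hx).sub ((hasDerivAt_inv (ht.trans_le hx.1).ne').const_mul _))
    fun x hx => by
      have e : -(h2 α x * (m - hBetaBar α β x / h2 α x)) / x ^ 2 - h3Bar α β s * (-(x ^ 2)⁻¹)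
        = (h3Bar α β s - h2 α x * (m - hBetaBar α β x / h2 α x)) * (x ^ 2)⁻¹ := by ring
      rw [e]
      exact mul_nonneg (sub_nonneg.2 (hb x hx).2) (by positivity)
  simp only [Pi.neg_apply] at h1
  have hs2 := (hΓ.h2_pos hs).ne'
  have e1 : betaBar α β t - t / s * betaBar α β s
      - hBetaBar α β s * ((α t - t / s * α s) / h2 α s)
      = t * ((betaBar α β t - m * α t) / t - (betaBar α β s - m * α s) / s) := by
    rw [hm]; field_simp; ring
  rw [e1, abs_of_nonneg (mul_nonneg ht.le (by linarith))]
  have hs3 := hΓ.h3Bar_pos hs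
  have h4 : 0 ≤ h3Bar α β s * s⁻¹ := by positivity
  calc _ ≤ t * (h3Bar α β s * t⁻¹) := mul_le_mul_of_nonneg_left (by linarith) ht.le
    _ = _ := by field_simp

/-- The diagonal entries of the transition matrices between consecutive scales stay away from one.
-/
lemma AdmissibleCurve.exists_contraction (hΓ : AdmissibleCurve α β) :
    ∃ σ : ℝ, 1 / 2 ≤ σ ∧ σ < 1 ∧ ∀ t, 0 < t →
    h2 α t ≤ σ * h2 α (2 * t) ∧ h3Bar α β t ≤ σ * h3Bar α β (2 * t) := by
  obtain ⟨c, hc, h⟩ := hΓ.h2_growth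
  obtain ⟨c', hc', h'⟩ := hΓ.h3Bar_growth
  have hlt : ∀ c : ℝ, 0 < c → (2 : ℝ) ^ (-c) < 1 := fun c hc =>
    Real.rpow_lt_one_of_one_lt_of_neg one_lt_two (neg_neg_of_pos hc)
  refine ⟨max (1 / 2) (max (2 ^ (-c)) (2 ^ (-c'))), le_max_left _ _,
    max_lt (by norm_num) (max_lt (hlt c hc) (hlt c' hc')), fun t ht => ⟨?_, ?_⟩⟩
  · refine (le_rpow_mul_of_growth (fun t ht =>
      (hΓ.hasDerivAt_h2 ht).differentiableAt) h ht).trans ?_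
    refine mul_le_mul_of_nonneg_right ?_ (hΓ.h2_pos (by linarith)).le
    exact (le_max_left _ _).trans (le_max_right _ _)
  · refine (le_rpow_mul_of_growth (fun t ht => hΓ.differentiableAt_h3Bar ht) h' ht).trans ?_
    refine mul_le_mul_of_nonneg_right ?_ (hΓ.h3Bar_pos (by linarith)).le
    exact (le_max_right _ _).trans (le_max_right _ _)

end Curve

/-! ### The Heisenberg group and its adapted coordinates -/

open Filter Topology

section Group

lemma inv_eq_neg (x : H1) : inv x = -x := by
  ext i; fin_cases i <;> simp [inv]

lemma continuous_mul : Continuous fun q : H1 × H1 => mul q.1 q.2 := by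
  refine continuous_pi fun i => ?_
  fin_cases i <;> simp [mul] <;> fun_prop

/-- The Heisenberg group as a multiplicative group. It is a type synonym of `H1`, on which a
pointwise multiplication is already present. -/
def Heis : Type := H1

noncomputable instance : Group Heis where
  mul := mul
  one := (0 : H1)
  inv := inv
  mul_assoc x y z := by
    change mul (mul x y) z = mul x (mul y z)
    ext i; fin_cases i <;> simp [mul] <;> ring
  one_mul x := by
    change mul 0 x = x
    ext i; fin_cases i <;> simp [mul]
  mul_one x := by
    change mul x 0 = x
    ext i; fin_cases i <;> simp [mul]
  inv_mul_cancel x := by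
    change mul (inv x) x = (0 : H1)
    ext i; fin_cases i <;> simp [mul, inv]; ring

instance : TopologicalSpace Heis := inferInstanceAs (TopologicalSpace H1)
instance : T2Space Heis := inferInstanceAs (T2Space H1)
instance : SecondCountableTopology Heis := inferInstanceAs (SecondCountableTopology H1)
instance : LocallyCompactSpace Heis := inferInstanceAs (LocallyCompactSpace H1)
instance : MeasurableSpace Heis := inferInstanceAs (MeasurableSpace H1)
instance : BorelSpace Heis := inferInstanceAs (BorelSpace H1)

instance : IsTopologicalGroup Heis where
  continuous_mul := continuous_mul
  continuous_inv := by
    change Continuous (inv : H1 → H1)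
    rw [show (inv : H1 → H1) = fun x => -x from funext inv_eq_neg]
    exact continuous_neg

/-- Lebesgue measure on the Heisenberg group. -/
noncomputable def heisVolume : Measure Heis := (volume : Measure H1)

/-- Translations of the Heisenberg group are affine maps with unipotent linear part. -/
lemma map_add_toLin'_volume (a : H1) {L : Matrix (Fin 3) (Fin 3) ℝ} (hL : L.det = 1) :
    Measure.map (fun y : H1 => a + L.mulVec y) volume = volume := by
  have h1 := Real.map_matrix_volume_pi_eq_smul_volume_pi (M := L) (by rw [hL]; norm_num)
  rw [hL] at h1
  simp only [inv_one, abs_one, ENNReal.ofReal_one, one_smul] at h1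
  have h2 : (fun y : H1 => a + L.mulVec y) = (fun y => a + y) ∘ (Matrix.toLin' L) := by
    ext y; simp
  rw [h2, ← Measure.map_map (measurable_const_add a)
    (LinearMap.continuous_on_pi _).measurable, h1]
  exact map_add_left_eq_self volume a

lemma map_mul_left_volume (x : H1) : Measure.map (fun y : H1 => mul x y) volume = volume := by
  have e : (fun y : H1 => mul x y)
      = fun y => x + (!![1, 0, 0; 0, 1, 0; -(x 1) / 2, x 0 / 2, 1] : Matrix _ _ ℝ).mulVec y := by
    ext y i
    fin_cases i <;> simp [mul, dotProduct, Fin.sum_univ_three]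
    ring
  rw [e]
  exact map_add_toLin'_volume _ (by simp [Matrix.det_fin_three])

lemma map_mul_right_volume (x : H1) : Measure.map (fun y : H1 => mul y x) volume = volume := by
  have e : (fun y : H1 => mul y x)
      = fun y => x + (!![1, 0, 0; 0, 1, 0; x 1 / 2, -(x 0) / 2, 1] : Matrix _ _ ℝ).mulVec y := by
    ext y i
    fin_cases i <;> simp [mul, dotProduct, Fin.sum_univ_three]
    · ring
    · ring
    · ring
  rw [e]
  exact map_add_toLin'_volume _ (by simp [Matrix.det_fin_three])

instance : heisVolume.IsMulLeftInvariant := ⟨map_mul_left_volume⟩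

instance : heisVolume.IsMulRightInvariant := ⟨map_mul_right_volume⟩

instance : heisVolume.IsInvInvariant := ⟨by
  change Measure.map (inv : H1 → H1) volume = volume
  rw [show (inv : H1 → H1) = Neg.neg from funext inv_eq_neg]
  exact Measure.map_neg_eq_self _⟩

instance : IsFiniteMeasureOnCompacts heisVolume :=
  inferInstanceAs (IsFiniteMeasureOnCompacts (volume : Measure H1))

instance : heisVolume.IsOpenPosMeasure :=
  inferInstanceAs (Measure.IsOpenPosMeasure (volume : Measure H1))

instance : heisVolume.IsHaarMeasure where

instance : heisVolume.InnerRegularCompactLTTop :=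
  inferInstanceAs (Measure.InnerRegularCompactLTTop (volume : Measure H1))

end Group

section Coordinates

variable {α β : ℝ → ℝ} (j : ℕ)

lemma dy_pos : 0 < dy j := by unfold dy; positivity

lemma two_mul_dy_succ : 2 * dy (j + 1) = dy j := by
  rw [dy, dy, pow_succ]; ring

/-- The last diagonal entry of `ATilde`. -/
noncomputable def g3 (α β : ℝ → ℝ) (j : ℕ) : ℝ := dy j * h2 α (dy j) + h3Bar α β (dy j)

lemma mulVec_ATilde (u : H1) : (ATilde α β j).mulVec u = ![dy j * u 0,
    α (dy j) * u 0 + h2 α (dy j) * u 1,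
    betaBar α β (dy j) * u 0 + hBetaBar α β (dy j) * u 1 + g3 α β j * u 2] := by
  ext i
  fin_cases i <;> simp [ATilde, Matrix.mulVec, dotProduct, Fin.sum_univ_three, g3]

lemma det_ATilde : (ATilde α β j).det = S α β j := by
  rw [ATilde, Matrix.det_fin_three, S]
  simp

/-- The coordinates adapted to the scale `j`. -/
noncomputable def coord (α β : ℝ → ℝ) (j : ℕ) (x : H1) : H1 := (ATilde α β j)⁻¹.mulVec x

variable {j}

lemma AdmissibleCurve.h2_dy_pos (hΓ : AdmissibleCurve α β) : 0 < h2 α (dy j) := hΓ.h2_pos (dy_pos j)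

lemma AdmissibleCurve.g3_pos (hΓ : AdmissibleCurve α β) : 0 < g3 α β j :=
  add_pos (mul_pos (dy_pos j) hΓ.h2_dy_pos) (hΓ.h3Bar_pos (dy_pos j))

lemma AdmissibleCurve.S_pos (hΓ : AdmissibleCurve α β) : 0 < S α β j :=
  mul_pos (mul_pos (dy_pos j) hΓ.h2_dy_pos) hΓ.g3_pos

lemma AdmissibleCurve.isUnit_det (hΓ : AdmissibleCurve α β) : IsUnit (ATilde α β j).det := by
  rw [det_ATilde]; exact hΓ.S_pos.ne'.isUnit

lemma AdmissibleCurve.coord_mulVec (hΓ : AdmissibleCurve α β) (u : H1) :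
    coord α β j ((ATilde α β j).mulVec u) = u := by
  rw [coord, Matrix.mulVec_mulVec, Matrix.nonsing_inv_mul _ hΓ.isUnit_det, Matrix.one_mulVec]

lemma AdmissibleCurve.mulVec_coord (hΓ : AdmissibleCurve α β) (x : H1) :
    (ATilde α β j).mulVec (coord α β j x) = x := by
  rw [coord, Matrix.mulVec_mulVec, Matrix.mul_nonsing_inv _ hΓ.isUnit_det, Matrix.one_mulVec]

/-- The group law in the coordinates adapted to a scale. The matrices `ATilde` are not
automorphisms, but being triangular they only rescale the commutator term, by a factor `c`. -/
noncomputable def law (c : ℝ) (u v : H1) : H1 :=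
  ![u 0 + v 0, u 1 + v 1, u 2 + v 2 + c / 2 * (u 0 * v 1 - u 1 * v 0)]

/-- The coefficient of the group law in the coordinates adapted to the scale `j`. It is at most one
because the last diagonal entry of `ATilde` contains the summand `2^{-j} h₂(2^{-j})`. -/
noncomputable def lawCoeff (α β : ℝ → ℝ) (j : ℕ) : ℝ := dy j * h2 α (dy j) / g3 α β j

lemma AdmissibleCurve.lawCoeff_nonneg (hΓ : AdmissibleCurve α β) : 0 ≤ lawCoeff α β j :=
  div_nonneg (mul_nonneg (dy_pos j).le hΓ.h2_dy_pos.le) hΓ.g3_pos.le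

lemma AdmissibleCurve.lawCoeff_le_one (hΓ : AdmissibleCurve α β) : lawCoeff α β j ≤ 1 := by
  rw [lawCoeff, div_le_one hΓ.g3_pos, g3]
  linarith [hΓ.h3Bar_pos (dy_pos j)]

lemma AdmissibleCurve.coord_mul (hΓ : AdmissibleCurve α β) (x y : H1) :
    coord α β j (mul x y) = law (lawCoeff α β j) (coord α β j x) (coord α β j y) := by
  have h : mul x y
      = (ATilde α β j).mulVec (law (lawCoeff α β j) (coord α β j x) (coord α β j y)) := by
    conv_lhs => rw [← hΓ.mulVec_coord (j := j) x, ← hΓ.mulVec_coord (j := j) y]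
    simp only [mulVec_ATilde]
    have hg := (hΓ.g3_pos (j := j)).ne'
    ext i
    fin_cases i
    · simp [mul, law]; ring
    · simp [mul, law]; ring
    · simp [mul, law, lawCoeff]; field_simp; ring
  rw [h, hΓ.coord_mulVec]

lemma coord_inv (x : H1) : coord α β j (inv x) = -coord α β j x := by
  rw [inv_eq_neg, coord, Matrix.mulVec_neg, coord]

lemma AdmissibleCurve.coord_inv_mul (hΓ : AdmissibleCurve α β) (x y : H1) :
    coord α β j (mul (inv x) y) = law (lawCoeff α β j) (-coord α β j x) (coord α β j y) := by
  rw [hΓ.coord_mul, coord_inv]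

lemma AdmissibleCurve.coord_mul_inv (hΓ : AdmissibleCurve α β) (x y : H1) :
    coord α β j (mul x (inv y)) = law (lawCoeff α β j) (coord α β j x) (-coord α β j y) := by
  rw [hΓ.coord_mul, coord_inv]

/-- Passing to the next coarser scale contracts the coordinates, up to off-diagonal terms. -/
lemma AdmissibleCurve.abs_coord_le (hΓ : AdmissibleCurve α β) {σ : ℝ} (hσ : 1 / 2 ≤ σ)
    (h : ∀ t, 0 < t →
    h2 α t ≤ σ * h2 α (2 * t) ∧ h3Bar α β t ≤ σ * h3Bar α β (2 * t)) (x : H1) :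
    |coord α β j x 0| ≤ σ * |coord α β (j + 1) x 0| ∧
    |coord α β j x 1| ≤ |coord α β (j + 1) x 0| + σ * |coord α β (j + 1) x 1| ∧
    |coord α β j x 2| ≤ |coord α β (j + 1) x 0| + |coord α β (j + 1) x 1|
      + σ * |coord α β (j + 1) x 2| := by
  set u := coord α β j x with hu
  set v := coord α β (j + 1) x with hv
  have e := (hΓ.mulVec_coord (j := j) x).trans (hΓ.mulVec_coord (j := j + 1) x).symm
  rw [← hu, ← hv, mulVec_ATilde, mulVec_ATilde] at e
  set t := dy (j + 1) with ht
  have hs : dy j = 2 * t := (two_mul_dy_succ j).symm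
  have ht0 : 0 < t := dy_pos _
  have e0 := congrFun e 0
  have e1 := congrFun e 1
  have e2 := congrFun e 2
  simp only [Matrix.cons_val] at e0 e1 e2
  have g1 : g3 α β (j + 1) = t * h2 α t + h3Bar α β t := rfl
  have g0 : g3 α β j = 2 * t * h2 α (2 * t) + h3Bar α β (2 * t) := by rw [g3, hs]
  rw [g1] at e2
  rw [g0] at e2
  rw [hs] at e0 e1 e2
  have hts : t ≤ 2 * t := by linarith
  have b1 := hΓ.abs_entry_two_one_le ht0 hts
  have b2 := hΓ.abs_entry_three_two_le ht0 hts
  have b3 := hΓ.abs_entry_three_one_le ht0 hts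
  obtain ⟨c1, c2⟩ := h t ht0
  have p1 := hΓ.h2_pos ht0
  have p2 := hΓ.h2_pos (ht0.trans_le hts)
  have p3 := hΓ.h3Bar_pos ht0
  have p4 := hΓ.h3Bar_pos (ht0.trans_le hts)
  have hfrac : t / (2 * t) = 1 / 2 := by field_simp
  rw [hfrac] at b1 b3
  set s := 2 * t with hs'
  set X := α t - 1 / 2 * α s with hX
  set Y := hBetaBar α β t - hBetaBar α β s * (h2 α t / h2 α s) with hY
  set Z := betaBar α β t - 1 / 2 * betaBar α β s - hBetaBar α β s * (X / h2 α s) with hZ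
  have u0 : u 0 = 1 / 2 * v 0 := by
    have : s * u 0 = s * (1 / 2 * v 0) := by rw [e0, hs']; ring
    exact mul_left_cancel₀ (by positivity) this
  have u1 : h2 α s * u 1 = X * v 0 + h2 α t * v 1 := by
    rw [u0] at e1
    rw [hX]; linarith
  have u2 : (s * h2 α s + h3Bar α β s) * u 2
      = Z * v 0 + Y * v 1 + (t * h2 α t + h3Bar α β t) * v 2 := by
    have u1' : u 1 = (X * v 0 + h2 α t * v 1) / h2 α s := by
      rw [← u1]; field_simp
    rw [u0, u1'] at e2
    rw [hZ, hY]
    linear_combination e2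
  refine ⟨?_, ?_, ?_⟩
  · rw [u0, abs_mul]
    have := abs_nonneg (v 0)
    rw [abs_of_pos (by norm_num : (0 : ℝ) < 1 / 2)]
    nlinarith
  · have : h2 α s * |u 1| ≤ h2 α s * (|v 0| + σ * |v 1|) := by
      calc h2 α s * |u 1| = |X * v 0 + h2 α t * v 1| := by rw [← u1, abs_mul, abs_of_pos p2]
        _ ≤ |X| * |v 0| + h2 α t * |v 1| := by
          refine (abs_add_le _ _).trans ?_
          rw [abs_mul, abs_mul, abs_of_pos p1]
        _ ≤ h2 α s * |v 0| + σ * h2 α s * |v 1| := by gcongr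
        _ = _ := by ring
    exact le_of_mul_le_mul_left this p2
  · have hg : 0 < s * h2 α s + h3Bar α β s := by positivity
    have hle : h3Bar α β s ≤ s * h2 α s + h3Bar α β s := by
      have : 0 ≤ s * h2 α s := by positivity
      linarith
    have hle2 : t * h2 α t + h3Bar α β t ≤ σ * (s * h2 α s + h3Bar α β s) := by
      have : t * h2 α t ≤ s * (σ * h2 α s) := by gcongr
      linarith
    have : (s * h2 α s + h3Bar α β s) * |u 2|
        ≤ (s * h2 α s + h3Bar α β s) * (|v 0| + |v 1| + σ * |v 2|) := by
      calc (s * h2 α s + h3Bar α β s) * |u 2|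
          = |Z * v 0 + Y * v 1 + (t * h2 α t + h3Bar α β t) * v 2| := by
            rw [← u2, abs_mul, abs_of_pos hg]
        _ ≤ |Z| * |v 0| + |Y| * |v 1| + (t * h2 α t + h3Bar α β t) * |v 2| := by
          refine (abs_add_three _ _ _).trans ?_
          rw [abs_mul, abs_mul, abs_mul, abs_of_pos (a := t * h2 α t + h3Bar α β t) (by positivity)]
        _ ≤ (s * h2 α s + h3Bar α β s) * |v 0| + (s * h2 α s + h3Bar α β s) * |v 1|
            + σ * (s * h2 α s + h3Bar α β s) * |v 2| := by
          gcongr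
          · exact b3.trans hle
          · exact b2.trans hle
        _ = _ := by ring
    exact le_of_mul_le_mul_left this hg

/-- Change of variables to the coordinates adapted to the scale `j`. -/
lemma AdmissibleCurve.map_coord (hΓ : AdmissibleCurve α β) :
    Measure.map (coord α β j) volume = ENNReal.ofReal (S α β j) • volume := by
  have hS := hΓ.S_pos (j := j)
  have hdet : ((ATilde α β j)⁻¹).det = (S α β j)⁻¹ := by
    rw [Matrix.det_nonsing_inv, Ring.inverse_eq_inv', det_ATilde]
  have h := Real.map_matrix_volume_pi_eq_smul_volume_pi (M := (ATilde α β j)⁻¹)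
    (by rw [hdet]; exact (inv_pos.2 hS).ne')
  rw [hdet, inv_inv, abs_of_pos hS] at h
  exact h

end Coordinates

/-! ### Balls and bumps on the Heisenberg group -/

section Gauge

/-- A weighted maximum norm on `ℝ³`. For large `M` the maps from the coordinates at one scale to
those at the next are strict contractions for it. -/
noncomputable def wnorm (M : ℝ) (u : H1) : ℝ := max (M ^ 2 * |u 0|) (max (M * |u 1|) |u 2|)

variable {M : ℝ} {u v : H1} {c r : ℝ}

lemma wnorm_le_iff : wnorm M u ≤ r ↔ M ^ 2 * |u 0| ≤ r ∧ M * |u 1| ≤ r ∧ |u 2| ≤ r := by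
  simp [wnorm]

lemma continuous_wnorm : Continuous (wnorm M) := by
  unfold wnorm; fun_prop

lemma wnorm_neg : wnorm M (-u) = wnorm M u := by simp [wnorm]

lemma wnorm_zero : wnorm M 0 = 0 := by simp [wnorm]

lemma wnorm_nonneg : 0 ≤ wnorm M u := (abs_nonneg _).trans (wnorm_le_iff.1 le_rfl).2.2

lemma abs_apply_le_wnorm (hM : 1 ≤ M) (i : Fin 3) : |u i| ≤ wnorm M u := by
  obtain ⟨h0, h1, h2⟩ := wnorm_le_iff.1 (le_refl (wnorm M u))
  fin_cases i
  · exact (le_mul_of_one_le_left (abs_nonneg _) (one_le_pow₀ hM)).trans h0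
  · exact (le_mul_of_one_le_left (abs_nonneg _) hM).trans h1
  · exact h2

lemma norm_le_wnorm (hM : 1 ≤ M) : ‖u‖ ≤ wnorm M u :=
  (pi_norm_le_iff_of_nonneg wnorm_nonneg).2 fun i => abs_apply_le_wnorm hM i

lemma abs_half_det_le (hM : 1 ≤ M) (hc0 : 0 ≤ c) (hc1 : c ≤ 1) :
    |c / 2 * (u 0 * v 1 - u 1 * v 0)| ≤ wnorm M u * wnorm M v := by
  have a := abs_apply_le_wnorm hM (u := u)
  have b := abs_apply_le_wnorm hM (u := v)
  have hu := wnorm_nonneg (M := M) (u := u)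
  have h : |u 0 * v 1 - u 1 * v 0| ≤ 2 * (wnorm M u * wnorm M v) := by
    refine (abs_sub _ _).trans ?_
    rw [abs_mul, abs_mul, two_mul]
    gcongr <;> first | exact a _ | exact b _
  rw [abs_mul, abs_of_nonneg (by positivity)]
  calc c / 2 * |u 0 * v 1 - u 1 * v 0| ≤ 1 / 2 * (2 * (wnorm M u * wnorm M v)) := by gcongr
    _ = _ := by ring

lemma wnorm_law_le (hM : 1 ≤ M) (hc0 : 0 ≤ c) (hc1 : c ≤ 1) :
    wnorm M (law c u v) ≤ wnorm M u + wnorm M v + wnorm M u * wnorm M v := by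
  obtain ⟨a0, a1, a2⟩ := wnorm_le_iff.1 (le_refl (wnorm M u))
  obtain ⟨b0, b1, b2⟩ := wnorm_le_iff.1 (le_refl (wnorm M v))
  have hd := abs_half_det_le (u := u) (v := v) hM hc0 hc1
  have hn : 0 ≤ wnorm M u * wnorm M v := mul_nonneg wnorm_nonneg wnorm_nonneg
  have hM0 : 0 ≤ M := by linarith
  have e0 : law c u v 0 = u 0 + v 0 := rfl
  have e1 : law c u v 1 = u 1 + v 1 := rfl
  have e2 : law c u v 2 = u 2 + v 2 + c / 2 * (u 0 * v 1 - u 1 * v 0) := rfl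
  rw [wnorm_le_iff, e0, e1, e2]
  refine ⟨?_, ?_, ?_⟩
  · have := mul_le_mul_of_nonneg_left (abs_add_le (u 0) (v 0)) (sq_nonneg M)
    linarith
  · have := mul_le_mul_of_nonneg_left (abs_add_le (u 1) (v 1)) hM0
    linarith
  · have := abs_add_three (u 2) (v 2) (c / 2 * (u 0 * v 1 - u 1 * v 0))
    linarith

lemma norm_law_sub_right_le (hM : 1 ≤ M) (hc0 : 0 ≤ c) (hc1 : c ≤ 1) :
    ‖law c u v - v‖ ≤ wnorm M u * (1 + wnorm M v) := by
  have hd := abs_half_det_le (u := u) (v := v) hM hc0 hc1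
  have a := abs_apply_le_wnorm hM (u := u)
  have hn : 0 ≤ wnorm M u * wnorm M v := mul_nonneg wnorm_nonneg wnorm_nonneg
  have h0 := wnorm_nonneg (M := M) (u := u)
  refine (pi_norm_le_iff_of_nonneg (by nlinarith)).2 fun i => ?_
  have := a i
  rw [Real.norm_eq_abs]
  fin_cases i
  · simp [law] at this ⊢; linarith
  · simp [law] at this ⊢; linarith
  · have e : (law c u v - v) 2 = u 2 + c / 2 * (u 0 * v 1 - u 1 * v 0) := by
      simp [law]; ring
    change |(law c u v - v) 2| ≤ _
    rw [e]
    have := (abs_add_le (u 2) (c / 2 * (u 0 * v 1 - u 1 * v 0))).trans (add_le_add (a 2) hd)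
    linarith

lemma norm_law_sub_left_le (hM : 1 ≤ M) (hc0 : 0 ≤ c) (hc1 : c ≤ 1) :
    ‖law c u v - u‖ ≤ wnorm M v * (1 + wnorm M u) := by
  have h := norm_law_sub_right_le (u := -v) (v := -u) hM hc0 hc1
  rw [wnorm_neg, wnorm_neg] at h
  have e : law c (-v) (-u) - -u = -(law c u v - u) := by
    ext i
    simp only [Pi.sub_apply, Pi.neg_apply]
    fin_cases i <;> simp [law] <;> ring
  rwa [e, norm_neg] at h

lemma isCompact_wnorm_le (hM : 1 ≤ M) (r : ℝ) : IsCompact {u : H1 | wnorm M u ≤ r} := by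
  refine (isCompact_closedBall (0 : H1) r).of_isClosed_subset
    (isClosed_le continuous_wnorm continuous_const) fun u hu => ?_
  rw [mem_closedBall_zero_iff]
  exact (norm_le_wnorm hM).trans hu

lemma volume_wnorm_le_ne_zero (hr : 0 < r) :
    (volume : Measure H1) {u | wnorm M u ≤ r} ≠ 0 := by
  have hopen : IsOpen {u : H1 | wnorm M u < r} := isOpen_lt continuous_wnorm continuous_const
  refine ((hopen.measure_pos volume ⟨0, ?_⟩).trans_le (measure_mono fun u hu => ?_)).ne'
  · simpa [wnorm_zero] using hr
  · exact le_of_lt (show wnorm M u < r from hu)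

/-- The radii of the balls: `rad M 0` makes the ball contain the unit cube, and each step allows
for the triangle inequality with its error term. -/
noncomputable def rad (M : ℝ) : ℕ → ℝ
  | 0 => M ^ 2
  | m + 1 => 2 * rad M m + rad M m ^ 2

lemma rad_pos (hM : 1 ≤ M) (m : ℕ) : 0 < rad M m := by
  induction m with
  | zero => simp only [rad]; positivity
  | succ m ih => simp only [rad]; positivity

end Gauge

section Balls

/-- The nonisotropic balls of the Heisenberg group adapted to the curve. -/
def hball (α β : ℝ → ℝ) (M : ℝ) (m j : ℕ) : Set Heis :=
  {x | wnorm M (coord α β j x) ≤ rad M m}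

variable {α β : ℝ → ℝ} {M ρ : ℝ} {j : ℕ}

lemma continuous_coord : Continuous (coord α β j) := by
  unfold coord; fun_prop

lemma AdmissibleCurve.heisVolume_hball (hΓ : AdmissibleCurve α β) (m : ℕ) :
    heisVolume (hball α β M m j)
      = ENNReal.ofReal (S α β j) * volume {u : H1 | wnorm M u ≤ rad M m} := by
  rw [← smul_eq_mul, ← Measure.smul_apply, ← hΓ.map_coord, Measure.map_apply
    continuous_coord.measurable (isClosed_le continuous_wnorm continuous_const).measurableSet]
  rfl

/-- The matrices linking the coordinates at consecutive scales are triangular with diagonal entries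
at most `σ < 1`, so they contract a norm that is weighted heavily against the off-diagonal
entries. -/
lemma AdmissibleCurve.exists_wnorm_coord_le (hΓ : AdmissibleCurve α β) :
    ∃ M ρ : ℝ, 1 ≤ M ∧ 0 < ρ ∧ ρ < 1 ∧ ∀ j n x,
      wnorm M (coord α β j x) ≤ ρ ^ n * wnorm M (coord α β (j + n) x) := by
  obtain ⟨σ, hσ, hσ1, h⟩ := hΓ.exists_contraction
  have hd : 0 < 1 - σ := by linarith
  refine ⟨4 / (1 - σ), (1 + σ) / 2, ?_, by linarith, by linarith, ?_⟩
  · rw [le_div_iff₀ hd]; linarith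
  set M := 4 / (1 - σ) with hM
  have hM1 : 1 ≤ M := by rw [hM, le_div_iff₀ hd]; linarith
  have hM0 : 0 < M := by linarith
  have hMd : M * (1 - σ) = 4 := by rw [hM]; field_simp
  have step : ∀ j x, wnorm M (coord α β j x) ≤ (1 + σ) / 2 * wnorm M (coord α β (j + 1) x) := by
    intro j x
    obtain ⟨h0, h1, h2⟩ := hΓ.abs_coord_le (j := j) hσ h x
    obtain ⟨b0, b1, b2⟩ := wnorm_le_iff.1 (le_refl (wnorm M (coord α β (j + 1) x)))
    set N := wnorm M (coord α β (j + 1) x) with hN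
    set v := coord α β (j + 1) x
    set u := coord α β j x
    have hN0 : 0 ≤ N := wnorm_nonneg
    -- `|v 0| ≤ N / M` and `|v 1| ≤ N / M`, where `1 / M = (1 - σ) / 4`
    have c1 : |v 1| ≤ (1 - σ) / 4 * N := by
      have : M * |v 1| ≤ M * ((1 - σ) / 4 * N) := by
        calc M * |v 1| ≤ N := b1
          _ = M * (1 - σ) / 4 * N := by rw [hMd]; ring
          _ = _ := by ring
      exact le_of_mul_le_mul_left this hM0
    have c0' : M * |v 0| ≤ (1 - σ) / 4 * N := by
      have : M * (M * |v 0|) ≤ M * ((1 - σ) / 4 * N) := by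
        calc M * (M * |v 0|) = M ^ 2 * |v 0| := by ring
          _ ≤ N := b0
          _ = M * (1 - σ) / 4 * N := by rw [hMd]; ring
          _ = _ := by ring
      exact le_of_mul_le_mul_left this hM0
    have c0 : |v 0| ≤ (1 - σ) / 4 * N :=
      (le_mul_of_one_le_left (abs_nonneg _) hM1).trans c0'
    have hσN : 0 ≤ (1 - σ) * N := by positivity
    rw [wnorm_le_iff]
    refine ⟨?_, ?_, ?_⟩
    · calc M ^ 2 * |u 0| ≤ M ^ 2 * (σ * |v 0|) := by gcongr
        _ = σ * (M ^ 2 * |v 0|) := by ring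
        _ ≤ σ * N := by gcongr
        _ ≤ _ := by linarith
    · calc M * |u 1| ≤ M * (|v 0| + σ * |v 1|) := by gcongr
        _ = M * |v 0| + σ * (M * |v 1|) := by ring
        _ ≤ (1 - σ) / 4 * N + σ * N := by gcongr
        _ ≤ _ := by linarith
    · calc |u 2| ≤ |v 0| + |v 1| + σ * |v 2| := h2
        _ ≤ (1 - σ) / 4 * N + (1 - σ) / 4 * N + σ * N := by gcongr
        _ = _ := by ring
  intro j n x
  induction n with
  | zero => simp
  | succ n ih =>
    refine ih.trans ?_
    rw [pow_succ, mul_assoc]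
    exact mul_le_mul_of_nonneg_left (step (j + n) x) (by positivity)

lemma AdmissibleCurve.ballSystem (hΓ : AdmissibleCurve α β) (hM : 1 ≤ M) (hρ0 : 0 < ρ)
    (hρ : ρ < 1)
    (hc : ∀ j n x, wnorm M (coord α β j x) ≤ ρ ^ n * wnorm M (coord α β (j + n) x)) :
    GroupLP.BallSystem heisVolume (hball α β M) where
  isCompact m j := by
    have h := (isCompact_wnorm_le hM (rad M m)).image
      (show Continuous fun u : H1 => (ATilde α β j).mulVec u by fun_prop)
    have e : ({x : H1 | wnorm M (coord α β j x) ≤ rad M m} : Set H1)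
        = (fun u : H1 => (ATilde α β j).mulVec u) '' {u | wnorm M u ≤ rad M m} := by
      ext x
      refine ⟨fun hx => ⟨coord α β j x, hx, hΓ.mulVec_coord x⟩, ?_⟩
      rintro ⟨u, hu, rfl⟩
      change wnorm M (coord α β j _) ≤ _
      rwa [hΓ.coord_mulVec]
    rw [← e] at h
    exact h
  inv_mem {m j x} hx := by
    have e : wnorm M (coord α β j (x⁻¹ : Heis)) = wnorm M (coord α β j x) :=
      (congrArg (wnorm M) (coord_inv (α := α) (β := β) (j := j) x)).trans wnorm_neg
    exact e.trans_le hx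
  mul_mem {m j x y} hx hy := by
    change wnorm M (coord α β j x) ≤ _ at hx
    change wnorm M (coord α β j y) ≤ _ at hy
    change wnorm M (coord α β j (x * y : Heis)) ≤ 2 * rad M m + rad M m ^ 2
    refine (congrArg (wnorm M) (hΓ.coord_mul (j := j) x y)).trans_le ?_
    refine (wnorm_law_le hM hΓ.lawCoeff_nonneg hΓ.lawCoeff_le_one).trans ?_
    have := mul_le_mul hx hy wnorm_nonneg (rad_pos hM m).le
    nlinarith
  anti m := by
    intro i j hij x hx
    obtain ⟨n, rfl⟩ := Nat.exists_eq_add_of_le hij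
    refine (hc i n x).trans (le_trans ?_ hx)
    exact mul_le_of_le_one_left wnorm_nonneg (pow_le_one₀ hρ0.le hρ.le)
  mono m j x hx := by
    change wnorm M (coord α β j x) ≤ _ at hx
    change wnorm M (coord α β j x) ≤ _
    refine hx.trans ?_
    have := rad_pos hM m
    simp only [rad]
    nlinarith
  one_mem m j := by
    change wnorm M (coord α β j (0 : H1)) ≤ _
    rw [coord, Matrix.mulVec_zero, wnorm_zero]
    exact (rad_pos hM m).le
  pos j := by
    rw [hΓ.heisVolume_hball]
    exact mul_ne_zero (ENNReal.ofReal_pos.2 hΓ.S_pos).ne' (volume_wnorm_le_ne_zero (rad_pos hM 0))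
  doubling m := by
    have h0 := volume_wnorm_le_ne_zero (M := M) (rad_pos hM 0)
    have h0' := (isCompact_wnorm_le hM (rad M 0)).measure_lt_top (μ := volume) |>.ne
    have hm := (isCompact_wnorm_le hM (rad M m)).measure_lt_top (μ := volume) |>.ne
    refine ⟨(volume {u : H1 | wnorm M u ≤ rad M m} /
      volume {u : H1 | wnorm M u ≤ rad M 0}).toNNReal, fun j => ?_⟩
    rw [ENNReal.coe_toNNReal (ENNReal.div_ne_top hm h0), hΓ.heisVolume_hball,
      hΓ.heisVolume_hball, mul_left_comm, ENNReal.div_mul_cancel h0 h0']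
  shrink m U hU := by
    have hcont : Continuous fun u : H1 => (ATilde α β 0).mulVec u := by fun_prop
    have hU' : (fun u : H1 => (ATilde α β 0).mulVec u) ⁻¹' U ∈ 𝓝 (0 : H1) := by
      refine hcont.continuousAt ?_
      rw [Matrix.mulVec_zero]
      exact hU
    obtain ⟨δ, hδ, hδU⟩ := Metric.mem_nhds_iff.1 hU'
    have hlim : Tendsto (fun j : ℕ => ρ ^ j * rad M m) atTop (𝓝 0) := by
      simpa using (tendsto_pow_atTop_nhds_zero_of_lt_one hρ0.le hρ).mul_const (rad M m)
    filter_upwards [hlim.eventually (gt_mem_nhds hδ)] with j hj x hx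
    have h0 : wnorm M (coord α β 0 x) < δ := by
      refine ((hc 0 j x).trans ?_).trans_lt hj
      rw [zero_add]
      exact mul_le_mul_of_nonneg_left hx (by positivity)
    have h1 : coord α β 0 x ∈ Metric.ball (0 : H1) δ := by
      rw [mem_ball_zero_iff]
      exact (norm_le_wnorm hM).trans_lt h0
    have h2 : (ATilde α β 0).mulVec (coord α β 0 x) ∈ U := hδU h1
    have h3 : (ATilde α β 0).mulVec (coord α β 0 x) = x := hΓ.mulVec_coord (j := 0) x
    rw [h3] at h2
    exact h2

end Balls

section Kernels

variable {α β : ℝ → ℝ} {M ρ : ℝ} {sig0 : H1 → ℂ}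

/-- The bump `sig0` transported to the scale `j`, normalized in `L¹`. -/
noncomputable def kern (α β : ℝ → ℝ) (sig0 : H1 → ℂ) (j : ℕ) (y : Heis) : ℂ :=
  ((S α β j : ℝ) : ℂ)⁻¹ * sig0 (coord α β j y)

lemma norm_kern_sub (hΓ : AdmissibleCurve α β) (j : ℕ) (x y : Heis) :
    ‖kern α β sig0 j x - kern α β sig0 j y‖
      = (S α β j)⁻¹ * ‖sig0 (coord α β j x) - sig0 (coord α β j y)‖ := by
  rw [kern, kern, ← mul_sub, norm_mul, norm_inv, Complex.norm_real, Real.norm_of_nonneg hΓ.S_pos.le]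

lemma integral_kern (hΓ : AdmissibleCurve α β) (hcont : Continuous sig0) (hint : ∫ y, sig0 y = 1)
    (j : ℕ) : ∫ y, kern α β sig0 j y ∂heisVolume = 1 := by
  have hS := hΓ.S_pos (j := j)
  have h : ∫ y : H1, sig0 (coord α β j y) = S α β j := by
    rw [← integral_map (φ := coord α β j) (f := sig0) continuous_coord.aemeasurable
      hcont.aestronglyMeasurable, hΓ.map_coord, integral_smul_measure, hint,
      ENNReal.toReal_ofReal hS.le]
    simp
  change ∫ y : H1, ((S α β j : ℝ) : ℂ)⁻¹ * sig0 (coord α β j y) = 1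
  rw [integral_const_mul, h]
  exact inv_mul_cancel₀ (Complex.ofReal_ne_zero.2 hS.ne')

lemma eLpNorm_one_le_of_bound {X : Type*} [MeasurableSpace X] {μ : Measure X} {E : Set X}
    (hE : MeasurableSet E) {F : X → ℂ} {D : ℝ} (hD : ∀ x ∈ E, ‖F x‖ ≤ D)
    (h0 : ∀ x ∉ E, F x = 0) : eLpNorm F 1 μ ≤ ENNReal.ofReal D * μ E := by
  rw [eLpNorm_one_eq_lintegral_enorm]
  calc ∫⁻ x, ‖F x‖ₑ ∂μ ≤ ∫⁻ x, E.indicator (fun _ => ENNReal.ofReal D) x ∂μ := by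
        refine lintegral_mono fun x => ?_
        by_cases hx : x ∈ E
        · rw [Set.indicator_of_mem hx, ← ofReal_norm]
          exact ENNReal.ofReal_le_ofReal (hD x hx)
        · simp [h0 x hx]
    _ = _ := by rw [lintegral_indicator hE, setLIntegral_const]

/-- The bumps at all scales form an approximate identity, with smoothness measured by the
contraction factor of the adapted coordinates. -/
lemma AdmissibleCurve.exists_approxId (hΓ : AdmissibleCurve α β)
    (hsmooth : ContDiff ℝ (⊤ : ℕ∞) sig0)
    (hsupp : tsupport sig0 ⊆ Set.Icc (fun _ => -1) (fun _ => 1)) (hint : ∫ y, sig0 y = 1) :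
    ∃ (B : ℕ → ℕ → Set Heis) (θ A : ℝ≥0), 0 < θ ∧ θ < 1 ∧ GroupLP.BallSystem heisVolume B ∧
      GroupLP.ApproxId heisVolume B θ A (kern α β sig0) := by
  obtain ⟨M, ρ, hM, hρ0, hρ, hc⟩ := hΓ.exists_wnorm_coord_le
  have hB := hΓ.ballSystem hM hρ0 hρ hc
  have hcs : HasCompactSupport sig0 := isCompact_Icc.of_isClosed_subset (isClosed_tsupport _) hsupp
  have hcont : Continuous sig0 := hsmooth.continuous
  obtain ⟨b, hb⟩ := hcs.exists_bound_of_continuous hcont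
  obtain ⟨L, hL⟩ := ContDiff.lipschitzWith_of_hasCompactSupport hcs hsmooth (by simp)
  have hb0 : 0 ≤ b := (norm_nonneg _).trans (hb 0)
  have hsupport : ∀ j, ∀ x ∉ hball α β M 0 j, kern α β sig0 j x = 0 := by
    intro j x hx
    have : coord α β j x ∉ tsupport sig0 := fun h => hx <| by
      obtain ⟨h1, h2⟩ := hsupp h
      have h3 : ∀ i, |coord α β j x i| ≤ 1 := fun i => abs_le.2 ⟨h1 i, h2 i⟩
      change wnorm M (coord α β j x) ≤ M ^ 2
      have hM2 : M ≤ M ^ 2 := by nlinarith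
      refine wnorm_le_iff.2 ⟨?_, ?_, ?_⟩
      · exact mul_le_of_le_one_right (by positivity) (h3 0)
      · exact (mul_le_of_le_one_right (by linarith) (h3 1)).trans hM2
      · exact (h3 2).trans (hM.trans hM2)
    rw [kern, image_eq_zero_of_notMem_tsupport this, mul_zero]
  set V : ℕ → ℝ≥0∞ := fun m => volume {u : H1 | wnorm M u ≤ rad M m} with hV
  have hVtop : ∀ m, V m ≠ ∞ := fun m => (isCompact_wnorm_le hM (rad M m)).measure_lt_top.ne
  obtain ⟨θ, hθ⟩ : ∃ θ : ℝ≥0, (θ : ℝ) = ρ ^ (1 / 4 : ℝ) :=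
    ⟨(ρ ^ (1 / 4 : ℝ)).toNNReal, Real.coe_toNNReal _ (by positivity)⟩
  have hθ4 : ∀ n : ℕ, ((θ ^ (4 * n) : ℝ≥0) : ℝ) = ρ ^ n := by
    intro n
    rw [pow_mul, NNReal.coe_pow, NNReal.coe_pow, hθ, ← Real.rpow_natCast
      (ρ ^ (1 / 4 : ℝ)) 4, ← Real.rpow_mul hρ0.le]
    norm_num
  set E : ℝ := L * (M ^ 2 * (1 + rad M 1)) with hE
  have hE0 : 0 ≤ E := by have := rad_pos hM 1; positivity
  set A : ℝ≥0 := b.toNNReal * (V 0).toNNReal + E.toNNReal * (V 1).toNNReal with hA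
  -- the common part of the two smoothness estimates
  have key : ∀ j n (F : Heis → ℂ), (∀ x ∈ hball α β M 1 j, ‖F x‖ ≤ (S α β j)⁻¹ * (E * ρ ^ n)) →
      (∀ x ∉ hball α β M 1 j, F x = 0) →
      eLpNorm F 1 heisVolume ≤ (A * θ ^ (4 * n) : ℝ≥0) := by
    intro j n F h1 h2
    have hS := hΓ.S_pos (j := j)
    refine (eLpNorm_one_le_of_bound (hB.measurableSet 1 j) h1 h2).trans ?_
    rw [hΓ.heisVolume_hball, ← mul_assoc, ← ENNReal.ofReal_mul (by positivity),
      mul_comm (S α β j)⁻¹, mul_assoc, inv_mul_cancel₀ hS.ne', mul_one,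
      ENNReal.ofReal_mul hE0, ← hθ4, ENNReal.ofReal_coe_nnreal, mul_right_comm, ENNReal.coe_mul]
    gcongr
    rw [hA, ENNReal.coe_add, ENNReal.coe_mul, ENNReal.coe_mul, ENNReal.coe_toNNReal (hVtop 1)]
    exact le_add_self
  have hin : ∀ j n, ∀ w ∈ hball α β M 0 (j + n), wnorm M (coord α β j w) ≤ ρ ^ n * M ^ 2 :=
    fun j n w hw => (hc j n w).trans (mul_le_mul_of_nonneg_left hw (by positivity))
  have hlip : ∀ u v : H1, ‖sig0 u - sig0 v‖ ≤ L * ‖u - v‖ := fun u v => hL.norm_sub_le u v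
  refine ⟨hball α β M, θ, A, ?_, ?_, hB, ?_⟩
  · rw [← NNReal.coe_pos, hθ]
    exact Real.rpow_pos_of_pos hρ0 _
  · rw [← NNReal.coe_lt_one, hθ]
    exact Real.rpow_lt_one hρ0.le hρ (by norm_num)
  refine ⟨fun j => ⟨?_, ⟨(S α β j)⁻¹ * b, fun x => ?_⟩, _, hB.isCompact 0 j, hsupport j⟩,
    hsupport, fun j x => ?_, integral_kern hΓ hcont hint, fun j n w hw => ?_, fun j n w hw => ?_⟩
  · exact (continuous_const.mul (hcont.comp continuous_coord)).measurable
  · rw [kern, norm_mul, norm_inv, Complex.norm_real, Real.norm_of_nonneg hΓ.S_pos.le]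
    have := hΓ.S_pos (j := j)
    gcongr
    exact hb _
  · have hS := hΓ.S_pos (j := j)
    rw [ENNReal.le_div_iff_mul_le (Or.inl (hB.pos j)) (Or.inl (hB.ne_top 0 j)),
      hΓ.heisVolume_hball, kern, enorm_mul, ← ofReal_norm, norm_inv, Complex.norm_real,
      Real.norm_of_nonneg hS.le, ← ofReal_norm]
    calc ENNReal.ofReal (S α β j)⁻¹ * ENNReal.ofReal ‖sig0 (coord α β j x)‖ *
          (ENNReal.ofReal (S α β j) * V 0)
        = ENNReal.ofReal ((S α β j)⁻¹ * S α β j) *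
          (ENNReal.ofReal ‖sig0 (coord α β j x)‖ * V 0) := by
          rw [ENNReal.ofReal_mul (by positivity)]; ring
      _ ≤ ENNReal.ofReal b * V 0 := by
          rw [inv_mul_cancel₀ hS.ne', ENNReal.ofReal_one, one_mul]
          gcongr
          exact hb _
      _ ≤ A := by
          rw [hA, ENNReal.coe_add, ENNReal.coe_mul, ENNReal.coe_mul,
            ENNReal.coe_toNNReal (hVtop 0)]
          exact le_self_add
  · have hw0 : w ∈ hball α β M 0 j := hB.anti 0 (Nat.le_add_right j n) hw
    refine key j n _ (fun x hx => ?_) fun x hx => ?_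
    · rw [norm_kern_sub hΓ]
      refine mul_le_mul_of_nonneg_left ?_ (inv_nonneg.2 hΓ.S_pos.le)
      refine (hlip _ _).trans ?_
      have e : coord α β j (w⁻¹ * x) = law (lawCoeff α β j) (-coord α β j w) (coord α β j x) :=
        hΓ.coord_inv_mul w x
      rw [e, hE, mul_assoc]
      gcongr
      refine (norm_law_sub_right_le hM hΓ.lawCoeff_nonneg hΓ.lawCoeff_le_one).trans ?_
      rw [wnorm_neg]
      calc wnorm M (coord α β j w) * (1 + wnorm M (coord α β j x))
          ≤ (ρ ^ n * M ^ 2) * (1 + rad M 1) := by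
            have : (0 : ℝ) ≤ wnorm M (coord α β j x) := wnorm_nonneg
            gcongr
            · exact hin j n w hw
            · exact hx
        _ = _ := by ring
    · rw [hsupport j x fun h => hx (hB.mono 0 j h), hsupport j (w⁻¹ * x) fun h => hx ?_, sub_zero]
      simpa using hB.mul_mem hw0 h
  · have hw0 : w ∈ hball α β M 0 j := hB.anti 0 (Nat.le_add_right j n) hw
    refine key j n _ (fun x hx => ?_) fun x hx => ?_
    · rw [norm_kern_sub hΓ]
      refine mul_le_mul_of_nonneg_left ?_ (inv_nonneg.2 hΓ.S_pos.le)
      refine (hlip _ _).trans ?_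
      have e : coord α β j (x * w⁻¹) = law (lawCoeff α β j) (coord α β j x) (-coord α β j w) :=
        hΓ.coord_mul_inv x w
      rw [e, hE, mul_assoc]
      gcongr
      refine (norm_law_sub_left_le hM hΓ.lawCoeff_nonneg hΓ.lawCoeff_le_one).trans ?_
      rw [wnorm_neg]
      calc wnorm M (coord α β j w) * (1 + wnorm M (coord α β j x))
          ≤ (ρ ^ n * M ^ 2) * (1 + rad M 1) := by
            have : (0 : ℝ) ≤ wnorm M (coord α β j x) := wnorm_nonneg
            gcongr
            · exact hin j n w hw
            · exact hx
        _ = _ := by ring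
    · rw [hsupport j x fun h => hx (hB.mono 0 j h), hsupport j (x * w⁻¹) fun h => hx ?_, sub_zero]
      simpa using hB.mul_mem h hw0

end Kernels

/-! ### The operators `𝒟_j` -/

section SquareFunction

open GroupLP

variable {α β : ℝ → ℝ} {sig0 : H1 → ℂ}

/-- The kernel of `𝒟_j` is the difference of consecutive members of the approximate identity. -/
lemma inv_S_mul_sig (hΓ : AdmissibleCurve α β) (j : ℕ) (y : H1) :
    ((S α β j : ℝ) : ℂ)⁻¹ * sig α β sig0 j (coord α β j y) = diff (kern α β sig0) j y := by
  cases j with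
  | zero =>
    change ((S α β 0 : ℝ) : ℂ)⁻¹ * sig0 (coord α β 0 y)
      = ((S α β 0 : ℝ) : ℂ)⁻¹ * sig0 (coord α β 0 y) - 0
    rw [sub_zero]
  | succ j =>
    have h1 : ((ATilde α β j)⁻¹ * ATilde α β (j + 1)).mulVec (coord α β (j + 1) y)
        = coord α β j y := by
      rw [← Matrix.mulVec_mulVec, hΓ.mulVec_coord, coord]
    have hS : ((S α β (j + 1) : ℝ) : ℂ) ≠ 0 := Complex.ofReal_ne_zero.2 hΓ.S_pos.ne'
    change ((S α β (j + 1) : ℝ) : ℂ)⁻¹ * (sig0 (coord α β (j + 1) y)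
        - ((S α β (j + 1) / S α β j : ℝ) : ℂ) * sig0 (((ATilde α β j)⁻¹ *
          ATilde α β (j + 1)).mulVec (coord α β (j + 1) y)))
      = ((S α β (j + 1) : ℝ) : ℂ)⁻¹ * sig0 (coord α β (j + 1) y)
        - ((S α β j : ℝ) : ℂ)⁻¹ * sig0 (coord α β j y)
    rw [h1, Complex.ofReal_div, mul_sub, ← mul_assoc, div_eq_mul_inv, inv_mul_cancel_left₀ hS]

lemma DOp_eq_conv (hΓ : AdmissibleCurve α β) (j : ℕ) (f : H1 → ℂ) :
    DOp α β sig0 j f = conv (G := Heis) heisVolume f (diff (kern α β sig0) j) := by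
  ext x
  change _ = ∫ y : H1, f (mul x (inv y)) * diff (kern α β sig0) j y
  rw [DOp, ← integral_const_mul]
  refine integral_congr_ae (ae_of_all _ fun y => ?_)
  change _ = f (mul x (inv y)) * diff (kern α β sig0) j y
  rw [← inv_S_mul_sig hΓ]
  change _ * (_ * sig α β sig0 j (coord α β j y)) = _
  ring

end SquareFunction

end HeisenbergLP

open HeisenbergLP in
theorem mainTheorem4 (α β : ℝ → ℝ) (hΓ : HeisenbergLP.AdmissibleCurve α β)
    (sig0 : HeisenbergLP.H1 → ℂ) (hsmooth : ContDiff ℝ (⊤ : ℕ∞) sig0)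
    (hsupp : tsupport sig0 ⊆ Set.Icc (fun _ => -1) (fun _ => 1))
    (hint : ∫ y, sig0 y = 1)
    (p : ℝ≥0∞) (hp1 : 1 < p) (hp2 : p < ∞) :
    (∃ C : ℝ≥0, ∀ f : HeisenbergLP.H1 → ℂ, MemLp f p volume →
      eLpNorm f p volume
          ≤ C * eLpNorm (HeisenbergLP.sqFun fun j => HeisenbergLP.DOp α β sig0 j f) p volume ∧
      eLpNorm (HeisenbergLP.sqFun fun j => HeisenbergLP.DOp α β sig0 j f) p volume
          ≤ C * eLpNorm f p volume) ∧
    (∃ C : ℝ≥0, ∀ g : ℕ → HeisenbergLP.H1 → ℂ,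
      (∀ j, AEStronglyMeasurable (g j) volume) →
      eLpNorm (HeisenbergLP.sqFun g) p volume < ∞ →
      eLpNorm (HeisenbergLP.sqFun fun j => HeisenbergLP.DOp α β sig0 j (g j)) p volume
          ≤ C * eLpNorm (HeisenbergLP.sqFun g) p volume) := by
  obtain ⟨B, θ, A, hθ0, hθ1, hB, hk⟩ := hΓ.exists_approxId hsmooth hsupp hint
  have hp0 : p ≠ 0 := (zero_lt_one.trans hp1).ne'
  simp only [DOp_eq_conv hΓ]
  have hmem : ∀ (f : Heis → ℂ) j, MemLp f p heisVolume →
      MemLp (GroupLP.conv heisVolume f (GroupLP.diff (kern α β sig0) j)) p heisVolume :=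
    fun f j hf => GroupLP.memLp_conv hp1.le hp2.ne hf (hk.isKernel_diff j)
  constructor
  · obtain ⟨C, hC⟩ := GroupLP.exists_eLpNorm_finSq_conv_diff_le hB hk hθ0 hθ1 hp1 hp2
    obtain ⟨D, hD⟩ := GroupLP.exists_eLpNorm_le_finSq hB hk hθ0 hθ1 hp1 hp2
    refine ⟨C + D, fun f hf => ⟨?_, ?_⟩⟩
    · refine (hD f hf _ fun n => GroupLP.eLpNorm_finSq_le_tsum _).trans ?_
      refine mul_le_mul_left (ENNReal.coe_le_coe.2 le_add_self) _
    · refine (GroupLP.eLpNorm_tsum_le_of_finSq hp0 hp2.ne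
        (fun j => (hmem f j hf).aestronglyMeasurable) fun n => hC (Finset.range n) f hf).trans ?_
      refine mul_le_mul_left (ENNReal.coe_le_coe.2 le_self_add) _
  · obtain ⟨C, hC⟩ := GroupLP.exists_eLpNorm_finSq_conv_le hB hk hp1 hp2
    refine ⟨C, fun g hg hfin => ?_⟩
    have hgj : ∀ j, MemLp (g j) p volume := fun j => by
      refine ⟨hg j, lt_of_le_of_lt (eLpNorm_mono_enorm fun x => ?_) hfin⟩
      rw [enorm_eq_self]
      calc ‖g j x‖ₑ = (‖g j x‖ₑ ^ 2) ^ (1 / 2 : ℝ) := by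
            rw [← ENNReal.rpow_natCast, ← ENNReal.rpow_mul]; norm_num
        _ ≤ sqFun g x := ENNReal.rpow_le_rpow (ENNReal.le_tsum j) (by positivity)
    refine GroupLP.eLpNorm_tsum_le_of_finSq hp0 hp2.ne
      (fun j => (hmem (g j) j (hgj j)).aestronglyMeasurable) fun n => ?_
    refine (hC (Finset.range n) g hgj).trans ?_
    gcongr
    exact GroupLP.eLpNorm_finSq_le_tsum _
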